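/- **Conventions.** First-order temporal formulae are built from predicate symbols (infinitely many of each arity; nullary ones are propositions), variables and constants, without equality and function symbols, by Boolean connectives, quantifiers and $\bigcirc,\Box,\Diamond,\mathrm U,\mathrm W$. They are interpreted over time $\mathbb N$ with a constant nonempty domain, rigid constants and flexible predicates ($\mathfrak M_n\models\phi\,\mathrm U\,\psi$ iff $\mathfrak M_m\models\psi$ for some $m\ge n$ and $\mathfrak M_i\models\phi$ for $n\le i<m$; $\phi\,\mathrm W\,\psi$ means $\phi\,\mathrm U\,\psi$ or $\Box\phi$); a formula is satisfiable if it is true at moment $0$ of some structure under some assignment. A formula is *monodic* if every subformula whose main connective is temporal has at most one free variable. It is in *negation normal form* if $\wedge,\vee,\neg$ are its only Boolean connectives (besides $\mathbf{true},\mathbf{false}$) and $\neg$ is applied to atoms only. A class of formulae is *decidable* if there is an algorithm that determines of every formula whether it belongs to the class and of every member whether it is satisfiable. For every formula $\chi$ whose main connective is temporal, reserve a *surrogate*: a unary predicate $P_\chi(x)$ if $x$ is the free variable of $\chi$, a proposition $p_\chi$ if $\chi$ is closed. Let $\overline\phi$ be the first-order formula obtained from $\phi$ by replacing every subformula whose main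 connective is temporal, and that is not in the scope of another temporal operator, by its surrogate. Reserve moreover for every formula $\psi$ a new unary predicate $N_\psi$ (and a new proposition $n_\psi$). For a class $\mathfrak C$ of first-order formulae in the language so extended, $\mathcal T_{ren}\mathfrak C$ is the class of monodic formulae $\phi$ in negation normal form (without reserved symbols) such that $\overline\phi\in\mathfrak C$ and, for every argument $\psi$ of a temporal operator in $\phi$, either $\overline\psi$ is closed and $\overline\psi\in\mathfrak C$, or $\forall x(N_\psi(x)\to\overline\psi)\in\mathfrak C$ (here $x$ is the free variable of $\psi$, or a fixed variable if $\psi$ is closed). A *temporal problem* $\mathsf P=\langle\mathcal U,\mathcal I,\mathcal S,\mathcal E\rangle$ consists of finite sets $\mathcal U,\mathcal I$ of closed first-order formulae, $\mathcal S$ of step clauses $l\to\bigcirc m$ or $L(x)\to\bigcirc M(x)$, and $\mathcal E$ of eventualities $\Diamond l$ or $\Diamond L(x)$, with propositional literals $l,m$ and unary literals $L(x),M(x)$; it stands for $\mathcal I\wedge\Box\,\mathcal U\wedge\Box\forall x\,\mathcal S\wedge\Box\forall x\,\mathcal E$. The *normal form* of a monodic $\phi$ in negation normal form has $\mathcal I=\{\exists\vec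 x\,\overline\phi\}$ ($\vec x$ the free variables of $\phi$) and, for each subformula $\chi$ of $\phi$ whose main connective is temporal, the following clauses. They are stated with the variable $x$ of $\chi$ (implicitly universally quantified in $\mathcal U$), or without it if $\chi$ is closed; $N_\psi$ then stands for $n_\psi$, and all other letters are predicates new for $\chi$. * $N_\psi\to\overline\psi$ for each argument $\psi$ of $\chi$. * $\chi=\bigcirc\psi$: $P_\chi\to\bigcirc N_\psi$. * $\chi=\Diamond\psi$: the clauses for $P_\chi\to\Diamond N_\psi$. * $\chi=\Box\psi$: the clauses for $P_\chi\to\Box N_\psi$. * $\chi=\psi_1\mathrm U\psi_2$: the clauses for $P_\chi\to N_{\psi_1}\mathrm U N_{\psi_2}$. * $\chi=\psi_1\mathrm W\psi_2$: $P_\chi\to A\vee A'$ and the clauses for $A\to N_{\psi_1}\mathrm UN_{\psi_2}$ and $A'\to\Box N_{\psi_1}$. The clauses for $Q\to\Diamond T$ are $Q\wedge\neg T\to W$, $W\to\bigcirc V$, $V\to T\vee W$, $\Diamond\neg W$. Those for $Q\to\Box T$ are $Q\to R$, $R\to\bigcirc R$, $R\to T$. Those for $Q\to S\,\mathrm U\,T$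 are the clauses for $Q\to\Diamond T$ together with $Q\to S\vee T$, $Q\to Z\vee T$, $Z\to\bigcirc Y$, $Y\to S\vee T$, $Y\to Z\vee T$. The *constant flooded form* $\mathsf P^c$ adds, for each $\Diamond L(x)\in\mathcal E$ and each constant $c$ of $\mathsf P$, an eventuality $\Diamond l$ and a universal clause $l\to L(c)$ with a new proposition $l$. *Temporal resolution.* For a nonempty set of non-ground step clauses $P_i(x)\to\bigcirc M_i(x)$ of $\mathsf P$, the derived step clauses are $\forall x\bigvee_iP_i(x)\to\bigcirc\forall x\bigvee_iM_i(x)$, $\exists x\bigwedge_iP_i(x)\to\bigcirc\exists x\bigwedge_iM_i(x)$ and $P_i(c)\to\bigcirc M_i(c)$ for constants $c$ of $\mathsf P$. A merged clause $\mathcal A\to\bigcirc\mathcal B$ is obtained by conjoining the left-hand sides and the right-hand sides of finitely many derived and ground step clauses. A full merged clause $\forall x(\mathcal A\wedge A(x)\to\bigcirc(\mathcal B\wedge B(x)))$ is obtained by conjoining moreover those of finitely many (possibly no) non-ground step clauses. A derivation extends $\mathcal U$ step by step by conclusions of the rules, with respect to the current $\mathcal U$: * infer $\neg\mathcal A$ if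 $\mathcal A\to\bigcirc\mathcal B$ is merged and $\mathcal U\cup\{\mathcal B\}\models\bot$; * infer $\forall x\bigwedge_i(\neg\mathcal A_i\vee\neg A_i(x))$ if $\Diamond L(x)\in\mathcal E$ and the $\forall x(\mathcal A_i\wedge A_i(x)\to\bigcirc(\mathcal B_i\wedge B_i(x)))$ are finitely many full merged clauses such that, for all $i$, $\mathcal U\models\forall x(\mathcal B_i\wedge B_i(x)\to\neg L(x))$ and $\mathcal U\models\forall x(\mathcal B_i\wedge B_i(x)\to\bigvee_j(\mathcal A_j\wedge A_j(x)))$; * infer $\bigwedge_i\neg\mathcal A_i$ if $\Diamond l\in\mathcal E$ and the $\mathcal A_i\to\bigcirc\mathcal B_i$ are finitely many merged clauses such that, for all $i$, $\mathcal U\models\mathcal B_i\to\neg l$ and $\mathcal U\models\mathcal B_i\to\bigvee_j\mathcal A_j$. It terminates successfully if $\mathcal U\cup\mathcal I\models\bot$, or $\mathcal U\models\forall x\neg L(x)$ for some $\Diamond L(x)\in\mathcal E$, or $\mathcal U\models\neg l$ for some $\Diamond l\in\mathcal E$. **Theorem (Decidability by Temporal Resolution).** Let $\mathfrak C$ be a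 decidable class of first-order formulae without equality and function symbols, but possibly with constants, such that $\mathfrak C$ is closed under conjunction and contains every closed monadic formula (all predicate symbols unary or nullary, constants allowed). Then $\mathcal T_{ren}\mathfrak C$ is decidable. Moreover, temporal resolution decides it: a formula $\phi\in\mathcal T_{ren}\mathfrak C$ is unsatisfiable if and only if there is a successfully terminating temporal resolution derivation from the constant flooded form of the normal form of $\phi$. -/

import Mathlib

/-! First-order linear temporal logic without equality and function symbols, surrogates, the
temporalisation of a class of first-order formulae by renaming, the divided separated normal form,
and the temporal resolution calculus. -/

namespace FOTL

/-! ### Syntax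

A predicate symbol is a name together with an arity, so there are infinitely many predicate symbols
of every arity; in an atom the arity is the number of arguments.  Predicate symbols of arity `0` are
the propositions. -/

/-- Terms: individual variables and individual constants. -/
inductive Term : Type
  | var (x : ℕ)
  | const (c : ℕ)

/-- Formulae of first-order temporal logic. -/
inductive TFormula : Type
  | verum
  | falsum
  | atom (p : ℕ) (ts : List Term)
  | neg (φ : TFormula)
  | and (φ ψ : TFormula)
  | or (φ ψ : TFormula)
  | imp (φ ψ : TFormula)
  | iff (φ ψ : TFormula)
  | all (x : ℕ) (φ : TFormula)
  | ex (x : ℕ) (φ : TFormula)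
  | next (φ : TFormula)
  | always (φ : TFormula)
  | sometime (φ : TFormula)
  | until (φ ψ : TFormula)
  | wuntil (φ ψ : TFormula)

/-- Names of predicate symbols of the first-order language: the ordinary names of the temporal
language, and names that are reserved.  `surr χ` is the surrogate of `χ`, `name ψ` is the new
predicate symbol that renames `ψ`, `aux k χ` are the further new predicate symbols of the normal
form, and `flood b p c` is the proposition that renames the (positive if `b`, else negative)
literal with predicate name `p` at the constant `c`. -/
inductive Sym : Type
  | base (p : ℕ)
  | surr (χ : TFormula)
  | name (ψ : TFormula)
  | aux (k : ℕ) (χ : TFormula)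
  | flood (b : Bool) (p : Sym) (c : ℕ)

/-- First-order formulae without equality and function symbols. -/
inductive FO : Type
  | verum
  | falsum
  | atom (p : Sym) (ts : List Term)
  | neg (φ : FO)
  | and (φ ψ : FO)
  | or (φ ψ : FO)
  | imp (φ ψ : FO)
  | iff (φ ψ : FO)
  | all (x : ℕ) (φ : FO)
  | ex (x : ℕ) (φ : FO)

/-- The variables of a term. -/
def Term.fv : Term → Finset ℕ
  | .var x => {x}
  | .const _ => ∅

/-- The constants of a term. -/
def Term.consts : Term → Finset ℕ
  | .var _ => ∅
  | .const c => {c}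

/-- Free variables of a temporal formula. -/
def TFormula.fv : TFormula → Finset ℕ
  | .verum => ∅
  | .falsum => ∅
  | .atom _ ts => ts.foldr (fun t s => t.fv ∪ s) ∅
  | .neg φ => φ.fv
  | .and φ ψ => φ.fv ∪ ψ.fv
  | .or φ ψ => φ.fv ∪ ψ.fv
  | .imp φ ψ => φ.fv ∪ ψ.fv
  | .iff φ ψ => φ.fv ∪ ψ.fv
  | .all x φ => φ.fv.erase x
  | .ex x φ => φ.fv.erase x
  | .next φ => φ.fv
  | .always φ => φ.fv
  | .sometime φ => φ.fv
  | .until φ ψ => φ.fv ∪ ψ.fv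
  | .wuntil φ ψ => φ.fv ∪ ψ.fv

/-- Free variables of a first-order formula. -/
def FO.fv : FO → Finset ℕ
  | .verum => ∅
  | .falsum => ∅
  | .atom _ ts => ts.foldr (fun t s => t.fv ∪ s) ∅
  | .neg φ => φ.fv
  | .and φ ψ => φ.fv ∪ ψ.fv
  | .or φ ψ => φ.fv ∪ ψ.fv
  | .imp φ ψ => φ.fv ∪ ψ.fv
  | .iff φ ψ => φ.fv ∪ ψ.fv
  | .all x φ => φ.fv.erase x
  | .ex x φ => φ.fv.erase x

/-- A closed formula. -/
def FO.Closed (φ : FO) : Prop := φ.fv = ∅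

/-- The constants that occur in a first-order formula. -/
def FO.consts : FO → Finset ℕ
  | .verum => ∅
  | .falsum => ∅
  | .atom _ ts => ts.foldr (fun t s => t.consts ∪ s) ∅
  | .neg φ => φ.consts
  | .and φ ψ => φ.consts ∪ ψ.consts
  | .or φ ψ => φ.consts ∪ ψ.consts
  | .imp φ ψ => φ.consts ∪ ψ.consts
  | .iff φ ψ => φ.consts ∪ ψ.consts
  | .all _ φ => φ.consts
  | .ex _ φ => φ.consts

/-- Monadic formulae: all predicate symbols are unary or propositions. Constants are allowed. -/
def FO.Monadic : FO → Prop
  | .verum => True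
  | .falsum => True
  | .atom _ ts => ts.length ≤ 1
  | .neg φ => φ.Monadic
  | .and φ ψ => φ.Monadic ∧ ψ.Monadic
  | .or φ ψ => φ.Monadic ∧ ψ.Monadic
  | .imp φ ψ => φ.Monadic ∧ ψ.Monadic
  | .iff φ ψ => φ.Monadic ∧ ψ.Monadic
  | .all _ φ => φ.Monadic
  | .ex _ φ => φ.Monadic

/-! ### Semantics -/

/-- A first-order structure with domain `D`. -/
structure FOStructure (D : Type) where
  pred : Sym → List D → Prop
  const : ℕ → D

/-- A first-order temporal structure with constant domain `D` : at every moment an interpretation of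
the predicate symbols (flexible), and an interpretation of the constants (rigid). -/
structure TStructure (D : Type) where
  pred : ℕ → ℕ → List D → Prop
  const : ℕ → D

/-- Value of a term. -/
def Term.eval {D : Type} (I : ℕ → D) (a : ℕ → D) : Term → D
  | .var x => a x
  | .const c => I c

/-- Truth of a first-order formula in a structure under an assignment. -/
def FO.Realize {D : Type} (M : FOStructure D) : FO → (ℕ → D) → Prop
  | .verum, _ => True
  | .falsum, _ => False
  | .atom p ts, a => M.pred p (ts.map (Term.eval M.const a))
  | .neg φ, a => ¬ φ.Realize M a
  | .and φ ψ, a => φ.Realize M a ∧ ψ.Realize M a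
  | .or φ ψ, a => φ.Realize M a ∨ ψ.Realize M a
  | .imp φ ψ, a => φ.Realize M a → ψ.Realize M a
  | .iff φ ψ, a => (φ.Realize M a ↔ ψ.Realize M a)
  | .all x φ, a => ∀ d : D, φ.Realize M (Function.update a x d)
  | .ex x φ, a => ∃ d : D, φ.Realize M (Function.update a x d)

/-- Truth of a temporal formula in a temporal structure at moment `n` under an assignment. -/
def TFormula.Realize {D : Type} (M : TStructure D) : TFormula → ℕ → (ℕ → D) → Prop
  | .verum, _, _ => True
  | .falsum, _, _ => False
  | .atom p ts, n, a => M.pred n p (ts.map (Term.eval M.const a))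
  | .neg φ, n, a => ¬ φ.Realize M n a
  | .and φ ψ, n, a => φ.Realize M n a ∧ ψ.Realize M n a
  | .or φ ψ, n, a => φ.Realize M n a ∨ ψ.Realize M n a
  | .imp φ ψ, n, a => φ.Realize M n a → ψ.Realize M n a
  | .iff φ ψ, n, a => (φ.Realize M n a ↔ ψ.Realize M n a)
  | .all x φ, n, a => ∀ d : D, φ.Realize M n (Function.update a x d)
  | .ex x φ, n, a => ∃ d : D, φ.Realize M n (Function.update a x d)
  | .next φ, n, a => φ.Realize M (n + 1) a
  | .always φ, n, a => ∀ m, n ≤ m → φ.Realize M m a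
  | .sometime φ, n, a => ∃ m, n ≤ m ∧ φ.Realize M m a
  | .until φ ψ, n, a =>
      ∃ m, n ≤ m ∧ ψ.Realize M m a ∧ ∀ i, n ≤ i → i < m → φ.Realize M i a
  | .wuntil φ ψ, n, a =>
      (∃ m, n ≤ m ∧ ψ.Realize M m a ∧ ∀ i, n ≤ i → i < m → φ.Realize M i a) ∨
        ∀ m, n ≤ m → φ.Realize M m a

/-- Satisfiability of a first-order formula. The domain is nonempty, as it carries an assignment. -/
def FO.Satisfiable (φ : FO) : Prop :=
  ∃ (D : Type) (M : FOStructure D) (a : ℕ → D), φ.Realize M a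

/-- Satisfiability of a temporal formula: truth at moment `0` of some temporal structure. -/
def TFormula.Satisfiable (φ : TFormula) : Prop :=
  ∃ (D : Type) (M : TStructure D) (a : ℕ → D), φ.Realize M 0 a

/-- `φ` is a logical consequence of the first-order formulae `U`. -/
def Entails (U : List FO) (φ : FO) : Prop :=
  ∀ (D : Type) (M : FOStructure D) (a : ℕ → D), (∀ ψ ∈ U, ψ.Realize M a) → φ.Realize M a

/-! ### Codes of formulae, and decidable classes of formulae -/

/-- Code of a term. -/
def Term.code : Term → ℕ
  | .var x => Nat.pair 0 x
  | .const c => Nat.pair 1 c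

/-- Code of a temporal formula. -/
def TFormula.code : TFormula → ℕ
  | .verum => Nat.pair 0 0
  | .falsum => Nat.pair 1 0
  | .atom p ts => Nat.pair 2 (Nat.pair p (Encodable.encode (ts.map Term.code)))
  | .neg φ => Nat.pair 3 φ.code
  | .and φ ψ => Nat.pair 4 (Nat.pair φ.code ψ.code)
  | .or φ ψ => Nat.pair 5 (Nat.pair φ.code ψ.code)
  | .imp φ ψ => Nat.pair 6 (Nat.pair φ.code ψ.code)
  | .iff φ ψ => Nat.pair 7 (Nat.pair φ.code ψ.code)
  | .all x φ => Nat.pair 8 (Nat.pair x φ.code)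
  | .ex x φ => Nat.pair 9 (Nat.pair x φ.code)
  | .next φ => Nat.pair 10 φ.code
  | .always φ => Nat.pair 11 φ.code
  | .sometime φ => Nat.pair 12 φ.code
  | .until φ ψ => Nat.pair 13 (Nat.pair φ.code ψ.code)
  | .wuntil φ ψ => Nat.pair 14 (Nat.pair φ.code ψ.code)

/-- Code of a predicate name. -/
def Sym.code : Sym → ℕ
  | .base p => Nat.pair 0 p
  | .surr χ => Nat.pair 1 χ.code
  | .name ψ => Nat.pair 2 ψ.code
  | .aux k χ => Nat.pair 3 (Nat.pair k χ.code)
  | .flood b p c => Nat.pair 4 (Nat.pair b.toNat (Nat.pair p.code c))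

/-- Code of a first-order formula. -/
def FO.code : FO → ℕ
  | .verum => Nat.pair 0 0
  | .falsum => Nat.pair 1 0
  | .atom p ts => Nat.pair 2 (Nat.pair p.code (Encodable.encode (ts.map Term.code)))
  | .neg φ => Nat.pair 3 φ.code
  | .and φ ψ => Nat.pair 4 (Nat.pair φ.code ψ.code)
  | .or φ ψ => Nat.pair 5 (Nat.pair φ.code ψ.code)
  | .imp φ ψ => Nat.pair 6 (Nat.pair φ.code ψ.code)
  | .iff φ ψ => Nat.pair 7 (Nat.pair φ.code ψ.code)
  | .all x φ => Nat.pair 8 (Nat.pair x φ.code)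
  | .ex x φ => Nat.pair 9 (Nat.pair x φ.code)

theorem Term.code_injective : Function.Injective Term.code := by
  intro s t h
  cases s <;> cases t <;> simp_all [Term.code, Nat.pair_eq_pair]

theorem TFormula.code_injective : Function.Injective TFormula.code := by
  intro φ
  induction φ <;> intro χ h <;> cases χ <;>
    simp_all [TFormula.code, Nat.pair_eq_pair, Term.code_injective.list_map.eq_iff]
  all_goals first | (constructor <;> apply_assumption <;> simp_all) | (apply_assumption; simp_all)

theorem Sym.code_injective : Function.Injective Sym.code := by
  intro p
  induction p with
  | flood b p c ih =>
    intro q h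
    cases q <;> simp only [Sym.code, Nat.pair_eq_pair] at h
    case flood b' p' c' =>
      obtain ⟨-, h1, h2, h3⟩ := h
      have := ih h2
      cases b <;> cases b' <;> simp_all
    all_goals omega
  | _ =>
    intro q h
    cases q <;> simp_all [Sym.code, Nat.pair_eq_pair, TFormula.code_injective.eq_iff]

theorem FO.code_injective : Function.Injective FO.code := by
  intro φ
  induction φ <;> intro χ h <;> cases χ <;>
    simp_all [FO.code, Nat.pair_eq_pair, Term.code_injective.list_map.eq_iff,
      Sym.code_injective.eq_iff]
  all_goals first | (constructor <;> apply_assumption <;> simp_all) | (apply_assumption; simp_all)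

/-- A class `K` of formulae (with the given coding and notion of satisfiability) is decidable: an
algorithm determines of every formula whether it belongs to the class, and of every formula of the
class whether it is satisfiable. -/
def IsDecidableClass {α : Type} (code : α → ℕ) (Sat : α → Prop) (K : Set α) : Prop :=
  ComputablePred (fun n : ℕ => ∃ φ ∈ K, code φ = n) ∧
    ComputablePred (fun n : ℕ => ∃ φ ∈ K, code φ = n ∧ Sat φ)

/-! ### Monodic formulae, negation normal form, surrogates, temporalisation by renaming -/

/-- Monodic formulae: every subformula whose main connective is a temporal operator has at most one
free variable. -/
def TFormula.Monodic : TFormula → Prop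
  | .verum => True
  | .falsum => True
  | .atom _ _ => True
  | .neg φ => φ.Monodic
  | .and φ ψ => φ.Monodic ∧ ψ.Monodic
  | .or φ ψ => φ.Monodic ∧ ψ.Monodic
  | .imp φ ψ => φ.Monodic ∧ ψ.Monodic
  | .iff φ ψ => φ.Monodic ∧ ψ.Monodic
  | .all _ φ => φ.Monodic
  | .ex _ φ => φ.Monodic
  | .next φ => φ.fv.card ≤ 1 ∧ φ.Monodic
  | .always φ => φ.fv.card ≤ 1 ∧ φ.Monodic
  | .sometime φ => φ.fv.card ≤ 1 ∧ φ.Monodic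
  | .until φ ψ => (φ.fv ∪ ψ.fv).card ≤ 1 ∧ φ.Monodic ∧ ψ.Monodic
  | .wuntil φ ψ => (φ.fv ∪ ψ.fv).card ≤ 1 ∧ φ.Monodic ∧ ψ.Monodic

/-- Negation normal form: conjunction, disjunction and negation are the only Boolean connectives,
and negation is applied to atoms only. -/
def TFormula.NNF : TFormula → Prop
  | .verum => True
  | .falsum => True
  | .atom _ _ => True
  | .neg φ => ∃ p ts, φ = .atom p ts
  | .and φ ψ => φ.NNF ∧ ψ.NNF
  | .or φ ψ => φ.NNF ∧ ψ.NNF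
  | .imp _ _ => False
  | .iff _ _ => False
  | .all _ φ => φ.NNF
  | .ex _ φ => φ.NNF
  | .next φ => φ.NNF
  | .always φ => φ.NNF
  | .sometime φ => φ.NNF
  | .until φ ψ => φ.NNF ∧ ψ.NNF
  | .wuntil φ ψ => φ.NNF ∧ ψ.NNF

/-- The free variable of a formula that has exactly one (and `0` if it is closed). -/
def TFormula.fvar (φ : TFormula) : ℕ := φ.fv.sup id

/-- The argument list `(x)` if `x` is the only free variable of `χ`, and the empty one if `χ` is
closed. -/
def TFormula.params (χ : TFormula) : List Term :=
  if χ.fv = ∅ then [] else [.var χ.fvar]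

/-- The surrogate atom of `χ` : `P_χ(x)` with a unary predicate symbol if `χ` has the free variable
`x`, and the proposition `p_χ` if `χ` is closed. -/
def TFormula.surrogate (χ : TFormula) : FO := .atom (.surr χ) χ.params

/-- Replace all subformulae whose main connective is a temporal operator, and which are not in the
scope of another temporal operator, by their surrogates. -/
def TFormula.bar : TFormula → FO
  | .verum => .verum
  | .falsum => .falsum
  | .atom p ts => .atom (.base p) ts
  | .neg φ => .neg φ.bar
  | .and φ ψ => .and φ.bar ψ.bar
  | .or φ ψ => .or φ.bar ψ.bar
  | .imp φ ψ => .imp φ.bar ψ.bar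
  | .iff φ ψ => .iff φ.bar ψ.bar
  | .all x φ => .all x φ.bar
  | .ex x φ => .ex x φ.bar
  | .next φ => (TFormula.next φ).surrogate
  | .always φ => (TFormula.always φ).surrogate
  | .sometime φ => (TFormula.sometime φ).surrogate
  | .until φ ψ => (TFormula.until φ ψ).surrogate
  | .wuntil φ ψ => (TFormula.wuntil φ ψ).surrogate

/-- All subformulae whose main connective is a temporal operator. -/
def TFormula.temporalSubs : TFormula → List TFormula
  | .verum => []
  | .falsum => []
  | .atom _ _ => []
  | .neg φ => φ.temporalSubs
  | .and φ ψ => φ.temporalSubs ++ ψ.temporalSubs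
  | .or φ ψ => φ.temporalSubs ++ ψ.temporalSubs
  | .imp φ ψ => φ.temporalSubs ++ ψ.temporalSubs
  | .iff φ ψ => φ.temporalSubs ++ ψ.temporalSubs
  | .all _ φ => φ.temporalSubs
  | .ex _ φ => φ.temporalSubs
  | .next φ => .next φ :: φ.temporalSubs
  | .always φ => .always φ :: φ.temporalSubs
  | .sometime φ => .sometime φ :: φ.temporalSubs
  | .until φ ψ => .until φ ψ :: (φ.temporalSubs ++ ψ.temporalSubs)
  | .wuntil φ ψ => .wuntil φ ψ :: (φ.temporalSubs ++ ψ.temporalSubs)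

/-- The arguments of the main connective if that is a temporal operator. -/
def TFormula.temporalArgs : TFormula → List TFormula
  | .next φ => [φ]
  | .always φ => [φ]
  | .sometime φ => [φ]
  | .until φ ψ => [φ, ψ]
  | .wuntil φ ψ => [φ, ψ]
  | _ => []

/-- The formula `∀ x (P(x) → ψ')`, where `ψ'` is `ψ.bar` and `P` is the new unary predicate symbol
that is reserved for `ψ`. -/
def TFormula.renaming (ψ : TFormula) : FO :=
  .all ψ.fvar (.imp (.atom (.name ψ) [.var ψ.fvar]) ψ.bar)

/-- Temporalisation by renaming of the class `C`. -/
def Tren (C : Set FO) : Set TFormula :=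
  {φ | φ.Monodic ∧ φ.NNF ∧ φ.bar ∈ C ∧
    ∀ χ ∈ φ.temporalSubs, ∀ ψ ∈ χ.temporalArgs,
      (ψ.bar.Closed ∧ ψ.bar ∈ C) ∨ ψ.renaming ∈ C}

/-! ### Temporal problems in divided separated normal form -/

/-- A literal without its argument: a sign and a predicate name. -/
structure Lit where
  pos : Bool
  sym : Sym

/-- The literal with the given arguments: none (propositional literal) or one (unary literal). -/
def Lit.app (l : Lit) (ts : List Term) : FO :=
  if l.pos then .atom l.sym ts else .neg (.atom l.sym ts)

/-- Conjunction of a list of formulae. -/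
def conj (l : List FO) : FO := l.foldr FO.and FO.verum

/-- Disjunction of a list of formulae. -/
def disj (l : List FO) : FO := l.foldr FO.or FO.falsum

/-- A temporal problem: the universal part and the initial part (closed first-order formulae), the
ground step clauses `l → ○ m` (propositional literals) and the non-ground ones `L(x) → ○ M(x)` (unary
literals), the ground eventualities `◇ l` and the non-ground ones `◇ L(x)`. -/
structure Problem where
  univ : List FO
  init : List FO
  stepG : List (Lit × Lit)
  stepN : List (Lit × Lit)
  evG : List Lit
  evN : List Lit

/-- The constants that occur in a problem. -/
def Problem.consts (P : Problem) : Finset ℕ :=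
  (P.univ ++ P.init).foldr (fun φ s => φ.consts ∪ s) ∅

/-- The problem without any clause. -/
def Problem.empty : Problem := ⟨[], [], [], [], [], []⟩

/-- The union of two problems. -/
def Problem.append (P Q : Problem) : Problem :=
  ⟨P.univ ++ Q.univ, P.init ++ Q.init, P.stepG ++ Q.stepG, P.stepN ++ Q.stepN, P.evG ++ Q.evG,
    P.evN ++ Q.evN⟩

/-- Constant flooding: for every non-ground eventuality `◇ L(x)` and every constant `c` of the
problem the eventuality `◇ L(c)` is added, renamed by a new proposition `l` as `◇ l` together with
the universal clause `l → L(c)`. -/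
def Problem.flooded (P : Problem) : Problem :=
  let pairs : List (Lit × ℕ) := P.evN.flatMap fun L => (P.consts.sort (· ≤ ·)).map fun c => (L, c)
  { P with
    univ := P.univ ++ pairs.map fun q =>
      .imp (.atom (.flood q.1.pos q.1.sym q.2) []) (q.1.app [.const q.2])
    evG := P.evG ++ pairs.map fun q => ⟨true, .flood q.1.pos q.1.sym q.2⟩ }

/-! ### Reduction of a monodic formula in negation normal form to a temporal problem

In the following definitions `χ` is a formula with at most one free variable `x`; the clauses about
`χ` are non-ground, with the variable `x`, if `x` is free in `χ`, and ground if `χ` is closed. -/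

/-- The atom with predicate name `s` and the argument `x`, or without argument if `χ` is closed. -/
def TFormula.at (χ : TFormula) (s : Sym) : FO := .atom s χ.params

/-- The universal clause `∀ x θ`, or `θ` if `χ` is closed. -/
def TFormula.univClause (χ : TFormula) (θ : FO) : Problem :=
  { Problem.empty with univ := [if χ.fv = ∅ then θ else .all χ.fvar θ] }

/-- The step clause `s(x) → ○ t(x)`. -/
def TFormula.stepClause (χ : TFormula) (s t : Sym) : Problem :=
  if χ.fv = ∅ then { Problem.empty with stepG := [(⟨true, s⟩, ⟨true, t⟩)] }
  else { Problem.empty with stepN := [(⟨true, s⟩, ⟨true, t⟩)] }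

/-- The eventuality `◇ ¬ s(x)`. -/
def TFormula.evNeg (χ : TFormula) (s : Sym) : Problem :=
  if χ.fv = ∅ then { Problem.empty with evG := [⟨false, s⟩] }
  else { Problem.empty with evN := [⟨false, s⟩] }

/-- Union of a list of problems. -/
def Problem.union (l : List Problem) : Problem := l.foldr Problem.append Problem.empty

/-- The definition `N(x) → ψ.bar` of the name `N` of an argument `ψ` of `χ`. -/
def TFormula.nameClause (χ ψ : TFormula) : Problem :=
  χ.univClause (.imp (χ.at (.name ψ)) ψ.bar)

/-- Clauses for `q(x) → ◇ t(x)`, made unconditional by means of the new predicate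
`wait = aux 0 χ`:
`q ∧ ¬ t → wait`, `wait → ○ (t ∨ wait)` (with `t ∨ wait` renamed by `aux 1 χ`), `◇ ¬ wait`. -/
def TFormula.sometimeClauses (χ : TFormula) (q t : Sym) : Problem :=
  Problem.union
    [χ.univClause (.imp (.and (χ.at q) (.neg (χ.at t))) (χ.at (.aux 0 χ))),
     χ.stepClause (.aux 0 χ) (.aux 1 χ),
     χ.univClause (.imp (χ.at (.aux 1 χ)) (.or (χ.at t) (χ.at (.aux 0 χ)))),
     χ.evNeg (.aux 0 χ)]

/-- Clauses for `q(x) → □ t(x)`, with the new predicate `r = aux 2 χ`: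
`q → r`, `r → ○ r`, `r → t`. -/
def TFormula.alwaysClauses (χ : TFormula) (q t : Sym) : Problem :=
  Problem.union
    [χ.univClause (.imp (χ.at q) (χ.at (.aux 2 χ))),
     χ.stepClause (.aux 2 χ) (.aux 2 χ),
     χ.univClause (.imp (χ.at (.aux 2 χ)) (χ.at t))]

/-- Clauses for `q(x) → s(x) U t(x)`, with the new predicate `w = aux 3 χ`:
`q → ◇ t`, `q → s ∨ t`, `q → w ∨ t`, `w → ○ ((s ∨ t) ∧ (w ∨ t))` (with the right-hand side renamed by
`aux 4 χ`). -/
def TFormula.untilClauses (χ : TFormula) (q s t : Sym) : Problem :=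
  Problem.union
    [χ.sometimeClauses q t,
     χ.univClause (.imp (χ.at q) (.or (χ.at s) (χ.at t))),
     χ.univClause (.imp (χ.at q) (.or (χ.at (.aux 3 χ)) (χ.at t))),
     χ.stepClause (.aux 3 χ) (.aux 4 χ),
     χ.univClause (.imp (χ.at (.aux 4 χ)) (.or (χ.at s) (χ.at t))),
     χ.univClause (.imp (χ.at (.aux 4 χ)) (.or (χ.at (.aux 3 χ)) (χ.at t)))]

/-- The clauses that define the surrogate of a formula whose main connective is a temporal operator.
For weak until the surrogate implies `aux 5 χ` or `aux 6 χ`, which imply the until formula and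
the always formula, respectively. -/
def TFormula.clauses : TFormula → Problem
  | .next ψ =>
      let χ := TFormula.next ψ
      Problem.union [χ.nameClause ψ, χ.stepClause (.surr χ) (.name ψ)]
  | .always ψ =>
      let χ := TFormula.always ψ
      Problem.union [χ.nameClause ψ, χ.alwaysClauses (.surr χ) (.name ψ)]
  | .sometime ψ =>
      let χ := TFormula.sometime ψ
      Problem.union [χ.nameClause ψ, χ.sometimeClauses (.surr χ) (.name ψ)]
  | .until ψ₁ ψ₂ =>
      let χ := TFormula.until ψ₁ ψ₂
      Problem.union [χ.nameClause ψ₁, χ.nameClause ψ₂,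
        χ.untilClauses (.surr χ) (.name ψ₁) (.name ψ₂)]
  | .wuntil ψ₁ ψ₂ =>
      let χ := TFormula.wuntil ψ₁ ψ₂
      Problem.union [χ.nameClause ψ₁, χ.nameClause ψ₂,
        χ.univClause (.imp (χ.at (.surr χ)) (.or (χ.at (.aux 5 χ)) (χ.at (.aux 6 χ)))),
        χ.untilClauses (.aux 5 χ) (.name ψ₁) (.name ψ₂),
        χ.alwaysClauses (.aux 6 χ) (.name ψ₁)]
  | _ => Problem.empty

/-- The existential closure of a formula. -/
def FO.exClosure (φ : FO) : FO := (φ.fv.sort (· ≤ ·)).foldr FO.ex φ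

/-- The temporal problem in divided separated normal form of a monodic formula in negation normal
form. -/
def TFormula.dsnf (φ : TFormula) : Problem :=
  Problem.append { Problem.empty with init := [φ.bar.exClosure] }
    (Problem.union (φ.temporalSubs.map TFormula.clauses))

/-! ### Temporal resolution -/

/-- Derived step clauses `A → ○ B`, and the original ground step clauses. -/
inductive DerivedStep (P : Problem) : FO → FO → Prop
  | all (s : List (Lit × Lit)) (hs : s ⊆ P.stepN) (hne : s ≠ []) :
      DerivedStep P (.all 0 (disj (s.map fun c => c.1.app [.var 0])))
        (.all 0 (disj (s.map fun c => c.2.app [.var 0])))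
  | ex (s : List (Lit × Lit)) (hs : s ⊆ P.stepN) (hne : s ≠ []) :
      DerivedStep P (.ex 0 (conj (s.map fun c => c.1.app [.var 0])))
        (.ex 0 (conj (s.map fun c => c.2.app [.var 0])))
  | const (cl : Lit × Lit) (hcl : cl ∈ P.stepN) (c : ℕ) (hc : c ∈ P.consts) :
      DerivedStep P (cl.1.app [.const c]) (cl.2.app [.const c])
  | ground (cl : Lit × Lit) (hcl : cl ∈ P.stepG) :
      DerivedStep P (cl.1.app []) (cl.2.app [])

/-- Merged derived step clauses `A → ○ B`. -/
def MergedStep (P : Problem) (A B : FO) : Prop :=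
  ∃ m : List (FO × FO), (∀ c ∈ m, DerivedStep P c.1 c.2) ∧
    A = conj (m.map Prod.fst) ∧ B = conj (m.map Prod.snd)

/-- The data of a full merged step clause `∀ x (A ∧ A'(x) → ○ (B ∧ B'(x)))`, where `x` is the
variable `0`. -/
structure FullClause where
  A : FO
  A' : FO
  B : FO
  B' : FO

/-- Full merged step clauses. -/
def FullMergedStep (P : Problem) (c : FullClause) : Prop :=
  MergedStep P c.A c.B ∧
    ∃ s : List (Lit × Lit), s ⊆ P.stepN ∧
      c.A' = conj (s.map fun d => d.1.app [.var 0]) ∧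
      c.B' = conj (s.map fun d => d.2.app [.var 0])

/-- `Infers P U ψ` : the formula `ψ` is the conclusion of the step resolution rule, of the eventuality
resolution rule, or of the ground eventuality resolution rule, with respect to the universal
part `U`. -/
inductive Infers (P : Problem) (U : List FO) : FO → Prop
  | step (A B : FO) (h : MergedStep P A B) (hB : Entails (B :: U) .falsum) : Infers P U (.neg A)
  | eventuality (L : Lit) (hL : L ∈ P.evN) (cs : List FullClause)
      (hcs : ∀ c ∈ cs, FullMergedStep P c)
      (h₁ : ∀ c ∈ cs, Entails U (.all 0 (.imp (.and c.B c.B') (.neg (L.app [.var 0])))))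
      (h₂ : ∀ c ∈ cs, Entails U
        (.all 0 (.imp (.and c.B c.B') (disj (cs.map fun d => .and d.A d.A'))))) :
      Infers P U (.all 0 (conj (cs.map fun d => .or (.neg d.A) (.neg d.A'))))
  | groundEventuality (l : Lit) (hl : l ∈ P.evG) (cs : List (FO × FO))
      (hcs : ∀ c ∈ cs, MergedStep P c.1 c.2)
      (h₁ : ∀ c ∈ cs, Entails U (.imp c.2 (.neg (l.app []))))
      (h₂ : ∀ c ∈ cs, Entails U (.imp c.2 (disj (cs.map Prod.fst)))) :
      Infers P U (conj (cs.map fun d => .neg d.1))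

/-- The initial, the eventuality or the ground eventuality termination rule applies. -/
def Terminates (P : Problem) (U : List FO) : Prop :=
  Entails (U ++ P.init) .falsum ∨
    (∃ L ∈ P.evN, Entails U (.all 0 (.neg (L.app [.var 0])))) ∨
    (∃ l ∈ P.evG, Entails U (.neg (l.app [])))

/-- `U` is the last universal part of a derivation from `P`. -/
inductive Derivation (P : Problem) : List FO → Prop
  | start : Derivation P P.univ
  | extend (U : List FO) (ψ : FO) (h : Derivation P U) (hψ : Infers P U ψ) :
      Derivation P (ψ :: U)

/-- There is a successfully terminating derivation from `P`. -/
def Problem.Refutable (P : Problem) : Prop := ∃ U, Derivation P U ∧ Terminates P U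

end FOTL

namespace FOTL

/-! ### Basic semantics -/

/-! Both claims reduce to sequences of first-order structures with a common domain, in which
consecutive structures are linked only through unary predicates and propositions. In negation normal
form the surrogates occur positively in `φ.bar`. Hence a model of the normal form, where surrogates
imply what they stand for, yields a model of `φ` (`TFormula.satisfiable_of_holds`). Conversely a
model of `φ` is expanded by giving every reserved symbol its intended meaning
(`TFormula.holds_of_satisfiable`).

What one moment has to tell the next is finite: the type of an element records which of the relevant
unary atoms it satisfies, and a category records which types are realised, together with the data
about constants and propositions. Suppose there is an infinite path of categories in which every
type has successors and predecessors and every eventuality can be fulfilled again and again. Choose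
a first-order model of each category. A run picks one element at every moment, with linked types and
all eventualities fulfilled; runs pass through every element, so the set of runs can serve as common
domain. Each structure is pulled back along evaluation of runs, and without equality this does not
change truth (`FO.realize_pullback`, `exists_glued`). The path itself is a generic one: there are
countably many requirements, and every finite path can be extended so as to meet any one of them
(`exists_fair_path`, `exists_run`).

Soundness of resolution: every conclusion is true at all moments of a model. The premises of the
eventuality rules describe an invariant that, once entered, is never left and excludes the
eventuality at all later moments.

Completeness: only finitely many conclusions matter, so some derivation is saturated for them. Its
universal part `U` has a class of categories. If a category had no successor, the step rule would
apply; if an eventuality were unreachable from some category or type, the merged clauses of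
everything reachable would be the premises of an eventuality rule. In both cases the conclusion lies
in `U` and is false in the model that one started from. So a problem that is not refutable has a
fair path of categories, hence a model (`Problem.exists_model`). Flooding makes the values of a
constant form a run.

Decidability does not execute the calculus. Types are taken over the surrogates and names at a
variable and at the constants of `φ`, so there are finitely many categories. Whether a category has
a model with the right definitions of the names is one satisfiability question about a formula in
the class: a closed monadic description, in conjunction with renamings or closed definitions. What
remains is a finite search for a set of categories that is closed under successors and in which all
eventualities are reachable (`decideB`). It is correct by the same construction from runs, and
primitive recursive on codes of formulae. -/

theorem mem_foldr_union {α β : Type*} [DecidableEq β] (f : α → Finset β) (l : List α) (x : β) :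
    x ∈ l.foldr (fun t s => f t ∪ s) ∅ ↔ ∃ t ∈ l, x ∈ f t := by
  induction l with
  | nil => simp
  | cons t l ih => simp [ih]

theorem Term.map_eval_congr {D : Type} (I a b : ℕ → D) (ts : List Term)
    (h : ∀ x ∈ ts.foldr (fun t s => t.fv ∪ s) ∅, a x = b x) :
    ts.map (Term.eval I a) = ts.map (Term.eval I b) := by
  refine List.map_congr_left fun t ht => ?_
  cases t with
  | const c => rfl
  | var x => exact h x ((mem_foldr_union _ _ _).2 ⟨_, ht, by simp [Term.fv]⟩)

theorem update_congr {D : Type} {a b : ℕ → D} {s : Finset ℕ} {x : ℕ} (d : D)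
    (h : ∀ y ∈ s.erase x, a y = b y) : ∀ y ∈ s, Function.update a x d y = Function.update b x d y := by
  intro y hy
  by_cases hyx : y = x
  · subst hyx; simp
  · simp [hyx, h y (by simp [hyx, hy])]

theorem FO.realize_congr {D : Type} (M : FOStructure D) (φ : FO) :
    ∀ a b : ℕ → D, (∀ x ∈ φ.fv, a x = b x) → (φ.Realize M a ↔ φ.Realize M b) := by
  induction φ with
  | verum => intros; rfl
  | falsum => intros; rfl
  | atom p ts =>
    intro a b h
    simp only [FO.Realize]
    rw [Term.map_eval_congr _ a b ts h]
  | neg φ ih => intro a b h; simp only [FO.Realize]; rw [ih a b h]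
  | and φ ψ ih₁ ih₂ =>
    intro a b h
    simp only [FO.Realize]
    rw [ih₁ a b fun x hx => h x (by simp [FO.fv, hx]), ih₂ a b fun x hx => h x (by simp [FO.fv, hx])]
  | or φ ψ ih₁ ih₂ =>
    intro a b h
    simp only [FO.Realize]
    rw [ih₁ a b fun x hx => h x (by simp [FO.fv, hx]), ih₂ a b fun x hx => h x (by simp [FO.fv, hx])]
  | imp φ ψ ih₁ ih₂ =>
    intro a b h
    simp only [FO.Realize]
    rw [ih₁ a b fun x hx => h x (by simp [FO.fv, hx]), ih₂ a b fun x hx => h x (by simp [FO.fv, hx])]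
  | iff φ ψ ih₁ ih₂ =>
    intro a b h
    simp only [FO.Realize]
    rw [ih₁ a b fun x hx => h x (by simp [FO.fv, hx]), ih₂ a b fun x hx => h x (by simp [FO.fv, hx])]
  | all x φ ih =>
    intro a b h
    exact forall_congr' fun d => ih _ _ (update_congr d h)
  | ex x φ ih =>
    intro a b h
    exact exists_congr fun d => ih _ _ (update_congr d h)

theorem FO.Closed.realize_iff {D : Type} {φ : FO} (h : φ.Closed) (M : FOStructure D) (a b : ℕ → D) :
    φ.Realize M a ↔ φ.Realize M b :=
  φ.realize_congr M a b fun x hx => by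
    rw [FO.Closed] at h
    simp [h] at hx

theorem TFormula.realize_congr {D : Type} (M : TStructure D) (φ : TFormula) :
    ∀ (n : ℕ) (a b : ℕ → D), (∀ x ∈ φ.fv, a x = b x) → (φ.Realize M n a ↔ φ.Realize M n b) := by
  induction φ with
  | verum => intros; rfl
  | falsum => intros; rfl
  | atom p ts =>
    intro n a b h
    simp only [TFormula.Realize]
    rw [Term.map_eval_congr _ a b ts h]
  | neg φ ih | next φ ih | always φ ih | sometime φ ih =>
    intro n a b h
    have h' := fun n => ih n a b h
    simp only [TFormula.Realize, h']
  | all x φ ih =>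
    intro n a b h
    exact forall_congr' fun d => ih _ _ _ (update_congr d h)
  | ex x φ ih =>
    intro n a b h
    exact exists_congr fun d => ih _ _ _ (update_congr d h)
  | _ φ ψ ih₁ ih₂ =>
    intro n a b h
    have h₁ := fun n => ih₁ n a b fun x hx => h x (by simp [TFormula.fv, hx])
    have h₂ := fun n => ih₂ n a b fun x hx => h x (by simp [TFormula.fv, hx])
    simp only [TFormula.Realize, h₁, h₂]

/-- In a language without equality, truth is invariant under pulling a structure back along a
surjection. -/
theorem FO.realize_pullback {D E : Type} (f : D → E) (hf : Function.Surjective f)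
    (M : FOStructure D) (N : FOStructure E) (hp : ∀ p ds, M.pred p ds ↔ N.pred p (ds.map f))
    (φ : FO) (hc : ∀ c ∈ φ.consts, f (M.const c) = N.const c) :
    ∀ a : ℕ → D, φ.Realize M a ↔ φ.Realize N (f ∘ a) := by
  have hu : ∀ (a : ℕ → D) x d, f ∘ Function.update a x d = Function.update (f ∘ a) x (f d) :=
    fun a x d => Function.comp_update f a x d
  induction φ with
  | verum => intros; rfl
  | falsum => intros; rfl
  | atom p ts =>
    intro a
    have : (ts.map (Term.eval M.const a)).map f = ts.map (Term.eval N.const (f ∘ a)) := by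
      rw [List.map_map]
      refine List.map_congr_left fun t ht => ?_
      cases t with
      | var x => rfl
      | const c => exact hc c ((mem_foldr_union _ _ _).2 ⟨_, ht, by simp [Term.consts]⟩)
    simp only [FO.Realize, hp, this]
  | neg φ ih => intro a; simp only [FO.Realize, ih hc]
  | and φ ψ ih₁ ih₂ | or φ ψ ih₁ ih₂ | imp φ ψ ih₁ ih₂ | iff φ ψ ih₁ ih₂ =>
    intro a
    have h₁ := ih₁ fun c h => hc c (by simp [FO.consts, h])
    have h₂ := ih₂ fun c h => hc c (by simp [FO.consts, h])
    simp only [FO.Realize, h₁, h₂]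
  | all x φ ih =>
    intro a
    simp only [FO.Realize, ih hc, hu]
    exact (hf.forall (p := fun e => φ.Realize N (Function.update (f ∘ a) x e))).symm
  | ex x φ ih =>
    intro a
    simp only [FO.Realize, ih hc, hu]
    exact (hf.exists (p := fun e => φ.Realize N (Function.update (f ∘ a) x e))).symm

theorem realize_conj {D : Type} (M : FOStructure D) (l : List FO) (a : ℕ → D) :
    (conj l).Realize M a ↔ ∀ φ ∈ l, φ.Realize M a := by
  induction l with
  | nil => simp [conj, FO.Realize]
  | cons φ l ih =>
    change φ.Realize M a ∧ (conj l).Realize M a ↔ _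
    simp [ih]

theorem realize_disj {D : Type} (M : FOStructure D) (l : List FO) (a : ℕ → D) :
    (disj l).Realize M a ↔ ∃ φ ∈ l, φ.Realize M a := by
  induction l with
  | nil => simp [disj, FO.Realize]
  | cons φ l ih =>
    change φ.Realize M a ∨ (disj l).Realize M a ↔ _
    simp [ih]

/-- Truth of a literal at given arguments. -/
def Lit.Holds {D : Type} (M : FOStructure D) (l : Lit) (ds : List D) : Prop :=
  if l.pos then M.pred l.sym ds else ¬ M.pred l.sym ds

theorem Lit.realize_app {D : Type} (M : FOStructure D) (l : Lit) (ts : List Term) (a : ℕ → D) :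
    (l.app ts).Realize M a ↔ l.Holds M (ts.map (Term.eval M.const a)) := by
  rcases l with ⟨_ | _, s⟩ <;> simp [Lit.app, Lit.Holds, FO.Realize]

theorem FO.realize_foldr_ex {D : Type} (M : FOStructure D) (φ : FO) (l : List ℕ) (a : ℕ → D) :
    (l.foldr FO.ex φ).Realize M a ↔ ∃ b : ℕ → D, (∀ x, x ∉ l → b x = a x) ∧ φ.Realize M b := by
  induction l generalizing a with
  | nil =>
    constructor
    · intro h; exact ⟨a, by simp, h⟩
    · rintro ⟨b, hb, h⟩
      have : b = a := funext fun x => hb x (by simp)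
      exact this ▸ h
  | cons x l ih =>
    simp only [List.foldr_cons, FO.Realize, ih]
    constructor
    · rintro ⟨d, b, hb, h⟩
      refine ⟨b, fun y hy => ?_, h⟩
      simp only [List.mem_cons, not_or] at hy
      rw [hb y hy.2, Function.update_of_ne hy.1]
    · rintro ⟨b, hb, h⟩
      refine ⟨b x, b, fun y hy => ?_, h⟩
      by_cases hyx : y = x
      · subst hyx; simp
      · rw [Function.update_of_ne hyx]
        exact hb y (by simp [hyx, hy])

theorem FO.realize_exClosure {D : Type} (M : FOStructure D) (φ : FO) (a : ℕ → D) :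
    φ.exClosure.Realize M a ↔ ∃ b, φ.Realize M b := by
  rw [FO.exClosure, FO.realize_foldr_ex]
  constructor
  · rintro ⟨b, -, h⟩; exact ⟨b, h⟩
  · rintro ⟨b, h⟩
    refine ⟨fun x => if x ∈ φ.fv then b x else a x, fun x hx => ?_, ?_⟩
    · simp only [Finset.mem_sort] at hx; simp [hx]
    · refine (φ.realize_congr M _ _ fun x hx => ?_).2 h
      simp [hx]

/-! ### Monodic formulae and their surrogates -/

theorem TFormula.fv_params (χ : TFormula) (h : χ.fv.card ≤ 1) :
    χ.params.foldr (fun t s => t.fv ∪ s) ∅ = χ.fv := by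
  unfold TFormula.params TFormula.fvar
  split_ifs with h0
  · simp [h0]
  · have : χ.fv.card = 1 := le_antisymm h (Finset.card_pos.2 (Finset.nonempty_iff_ne_empty.2 h0))
    obtain ⟨x, hx⟩ := Finset.card_eq_one.1 this
    simp [hx, Term.fv]

theorem TFormula.fv_bar (φ : TFormula) (h : φ.Monodic) : φ.bar.fv = φ.fv := by
  induction φ with
  | verum | falsum | atom p ts => rfl
  | neg φ ih => exact ih h
  | and φ ψ ih₁ ih₂ | or φ ψ ih₁ ih₂ | imp φ ψ ih₁ ih₂ | iff φ ψ ih₁ ih₂ =>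
    simp only [TFormula.bar, FO.fv, TFormula.fv, ih₁ h.1, ih₂ h.2]
  | all x φ ih | ex x φ ih => simp only [TFormula.bar, FO.fv, TFormula.fv, ih h]
  | next φ ih | always φ ih | sometime φ ih => exact TFormula.fv_params _ h.1
  | _ φ ψ ih₁ ih₂ => exact TFormula.fv_params _ h.1

/-- The main connective is temporal, and there is at most one free variable. -/
def TFormula.IsTemporal : TFormula → Prop
  | .next _ | .always _ | .sometime _ | .until _ _ | .wuntil _ _ => True
  | _ => False

theorem TFormula.monodic_of_mem_temporalSubs {φ χ : TFormula} (h : φ.Monodic)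
    (hχ : χ ∈ φ.temporalSubs) : χ.IsTemporal ∧ χ.fv.card ≤ 1 ∧ χ.Monodic := by
  induction φ with
  | verum | falsum | atom p ts => simp [TFormula.temporalSubs] at hχ
  | neg φ ih | all x φ ih | ex x φ ih => exact ih h hχ
  | and φ ψ ih₁ ih₂ | or φ ψ ih₁ ih₂ | imp φ ψ ih₁ ih₂ | iff φ ψ ih₁ ih₂ =>
    rcases List.mem_append.1 hχ with h' | h'
    · exact ih₁ h.1 h'
    · exact ih₂ h.2 h'
  | next φ ih | always φ ih | sometime φ ih =>
    rcases List.mem_cons.1 hχ with h' | h'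
    · subst h'; exact ⟨trivial, h.1, h⟩
    · exact ih h.2 h'
  | _ φ ψ ih₁ ih₂ =>
    rcases List.mem_cons.1 hχ with h' | h'
    · subst h'; exact ⟨trivial, h.1, h⟩
    · rcases List.mem_append.1 h' with h' | h'
      · exact ih₁ h.2.1 h'
      · exact ih₂ h.2.2 h'

theorem TFormula.fv_temporalArgs {χ ψ : TFormula} (hψ : ψ ∈ χ.temporalArgs) : ψ.fv ⊆ χ.fv := by
  cases χ <;> simp_all [TFormula.temporalArgs, TFormula.fv]
  all_goals rcases hψ with rfl | rfl <;> simp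

theorem TFormula.monodic_temporalArgs {χ ψ : TFormula} (h : χ.Monodic) (hψ : ψ ∈ χ.temporalArgs) :
    ψ.Monodic := by
  cases χ <;> simp_all [TFormula.temporalArgs, TFormula.Monodic]
  all_goals rcases hψ with rfl | rfl <;> simp_all

/-- The values of the arguments of the surrogate of `χ`. -/
def TFormula.vals {D : Type} (χ : TFormula) (I a : ℕ → D) : List D := χ.params.map (Term.eval I a)

theorem TFormula.vals_of_closed {D : Type} {χ : TFormula} (h : χ.fv = ∅) (I a : ℕ → D) :
    χ.vals I a = [] := by simp [TFormula.vals, TFormula.params, h]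

theorem TFormula.vals_of_open {D : Type} {χ : TFormula} (h : χ.fv ≠ ∅) (I a : ℕ → D) :
    χ.vals I a = [a χ.fvar] := by simp [TFormula.vals, TFormula.params, h, Term.eval]

theorem TFormula.fvar_eq {χ : TFormula} (h : χ.fv.card ≤ 1) {x : ℕ} (hx : x ∈ χ.fv) :
    χ.fvar = x := by
  have : χ.fv = {x} := by
    obtain ⟨y, hy⟩ := Finset.card_eq_one.1 (le_antisymm h (Finset.card_pos.2 ⟨x, hx⟩))
    rw [hy] at hx ⊢
    rw [Finset.mem_singleton.1 hx]
  simp [TFormula.fvar, this]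

/-- The surrogates of the main subformulae of `χ` describe its truth, in one direction. -/
def TFormula.SurrogateSound {D : Type} (N : ℕ → FOStructure D) : TFormula → Prop
  | .next ψ => ∀ n a, (TFormula.next ψ).surrogate.Realize (N n) a → ψ.bar.Realize (N (n + 1)) a
  | .always ψ => ∀ n a, (TFormula.always ψ).surrogate.Realize (N n) a →
      ∀ m, n ≤ m → ψ.bar.Realize (N m) a
  | .sometime ψ => ∀ n a, (TFormula.sometime ψ).surrogate.Realize (N n) a →
      ∃ m, n ≤ m ∧ ψ.bar.Realize (N m) a
  | .until ψ₁ ψ₂ => ∀ n a, (TFormula.until ψ₁ ψ₂).surrogate.Realize (N n) a →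
      ∃ m, n ≤ m ∧ ψ₂.bar.Realize (N m) a ∧ ∀ i, n ≤ i → i < m → ψ₁.bar.Realize (N i) a
  | .wuntil ψ₁ ψ₂ => ∀ n a, (TFormula.wuntil ψ₁ ψ₂).surrogate.Realize (N n) a →
      (∃ m, n ≤ m ∧ ψ₂.bar.Realize (N m) a ∧ ∀ i, n ≤ i → i < m → ψ₁.bar.Realize (N i) a) ∨
        ∀ m, n ≤ m → ψ₁.bar.Realize (N m) a
  | _ => True

/-- Negation stands only in front of atoms, and these keep their interpretation, so every surrogate
occurs positively. That is why one direction, from the surrogate to the subformula, is enough. -/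
theorem TFormula.realize_of_bar {D : Type} (M : TStructure D) (N : ℕ → FOStructure D)
    (hI : ∀ n, (N n).const = M.const) (hN : ∀ n p ds, (N n).pred (.base p) ds ↔ M.pred n p ds)
    (φ : TFormula) (hφ : φ.NNF) (h : ∀ χ ∈ φ.temporalSubs, χ.SurrogateSound N) :
    ∀ n a, φ.bar.Realize (N n) a → φ.Realize M n a := by
  induction φ with
  | verum => intros; trivial
  | falsum => intro n a h; exact h
  | atom p ts =>
    intro n a h
    simpa [TFormula.bar, FO.Realize, TFormula.Realize, hI, hN] using h
  | neg φ ih =>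
    obtain ⟨p, ts, rfl⟩ := hφ
    intro n a h
    simpa [TFormula.bar, FO.Realize, TFormula.Realize, hI, hN] using h
  | and φ ψ ih₁ ih₂ =>
    intro n a h'
    exact ⟨ih₁ hφ.1 (fun χ hχ => h χ (List.mem_append_left _ hχ)) n a h'.1,
      ih₂ hφ.2 (fun χ hχ => h χ (List.mem_append_right _ hχ)) n a h'.2⟩
  | or φ ψ ih₁ ih₂ =>
    intro n a h'
    exact h'.imp (ih₁ hφ.1 (fun χ hχ => h χ (List.mem_append_left _ hχ)) n a)
      (ih₂ hφ.2 (fun χ hχ => h χ (List.mem_append_right _ hχ)) n a)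
  | imp φ ψ ih₁ ih₂ => exact hφ.elim
  | iff φ ψ ih₁ ih₂ => exact hφ.elim
  | all x φ ih => intro n a h' d; exact ih hφ h n _ (h' d)
  | ex x φ ih => rintro n a ⟨d, h'⟩; exact ⟨d, ih hφ h n _ h'⟩
  | next φ ih =>
    intro n a h'
    exact ih hφ (fun χ hχ => h χ (List.mem_cons_of_mem _ hχ)) _ _
      (h _ List.mem_cons_self n a h')
  | always φ ih =>
    intro n a h' m hm
    exact ih hφ (fun χ hχ => h χ (List.mem_cons_of_mem _ hχ)) _ _
      (h _ List.mem_cons_self n a h' m hm)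
  | sometime φ ih =>
    intro n a h'
    obtain ⟨m, hm, h''⟩ := h _ List.mem_cons_self n a h'
    exact ⟨m, hm, ih hφ (fun χ hχ => h χ (List.mem_cons_of_mem _ hχ)) _ _ h''⟩
  | wuntil φ ψ ih₁ ih₂ =>
    intro n a h'
    have h₁ := ih₁ hφ.1 fun χ hχ => h χ (List.mem_cons_of_mem _ (List.mem_append_left _ hχ))
    have h₂ := ih₂ hφ.2 fun χ hχ => h χ (List.mem_cons_of_mem _ (List.mem_append_right _ hχ))
    rcases h _ List.mem_cons_self n a h' with ⟨m, hm, h3, h4⟩ | h3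
    · exact Or.inl ⟨m, hm, h₂ _ _ h3, fun i hi him => h₁ _ _ (h4 i hi him)⟩
    · exact Or.inr fun m hm => h₁ _ _ (h3 m hm)
  | _ φ ψ ih₁ ih₂ =>
    intro n a h'
    have h₁ := ih₁ hφ.1 fun χ hχ => h χ (List.mem_cons_of_mem _ (List.mem_append_left _ hχ))
    have h₂ := ih₂ hφ.2 fun χ hχ => h χ (List.mem_cons_of_mem _ (List.mem_append_right _ hχ))
    obtain ⟨m, hm, h3, h4⟩ := h _ List.mem_cons_self n a h'
    exact ⟨m, hm, h₂ _ _ h3, fun i hi him => h₁ _ _ (h4 i hi him)⟩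

end FOTL

namespace FOTL

/-! ### Models of temporal problems -/

/-- All clauses of a problem, except the initial ones, hold in a sequence of structures. -/
def Problem.Holds {D : Type} (N : ℕ → FOStructure D) (P : Problem) : Prop :=
  (∀ φ ∈ P.univ, ∀ n a, φ.Realize (N n) a) ∧
  (∀ c ∈ P.stepG, ∀ n, c.1.Holds (N n) [] → c.2.Holds (N (n + 1)) []) ∧
  (∀ c ∈ P.stepN, ∀ n d, c.1.Holds (N n) [d] → c.2.Holds (N (n + 1)) [d]) ∧
  (∀ l ∈ P.evG, ∀ n, ∃ m ≥ n, l.Holds (N m) []) ∧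
  (∀ L ∈ P.evN, ∀ n d, ∃ m ≥ n, L.Holds (N m) [d])

section
variable {D : Type} (N : ℕ → FOStructure D)

theorem Problem.holds_empty : Problem.empty.Holds N := by
  simp [Problem.Holds, Problem.empty]

theorem Problem.holds_append (P Q : Problem) : (P.append Q).Holds N ↔ P.Holds N ∧ Q.Holds N := by
  simp only [Problem.Holds, Problem.append, List.forall_mem_append]
  tauto

theorem Problem.holds_union (l : List Problem) :
    (Problem.union l).Holds N ↔ ∀ P ∈ l, P.Holds N := by
  induction l with
  | nil => simp [Problem.union, Problem.holds_empty]
  | cons P l ih =>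
    change (P.append (Problem.union l)).Holds N ↔ _
    rw [Problem.holds_append, ih]
    simp

/-- Clauses are required under all assignments, so the universal quantifier of a non-ground clause
is redundant and the ground and non-ground cases get the same description. -/
theorem TFormula.holds_univClause (χ : TFormula) (θ : FO) :
    (χ.univClause θ).Holds N ↔ ∀ n a, θ.Realize (N n) a := by
  unfold TFormula.univClause Problem.Holds Problem.empty
  split_ifs with h
  · simp
  · simp only [List.mem_singleton, forall_eq, FO.Realize]
    simp only [List.not_mem_nil, false_imp_iff, implies_true, and_true]
    constructor
    · intro h' n a
      simpa using h' n a (a χ.fvar)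
    · intro h' n a d
      exact h' n _

variable [Nonempty D] {I : ℕ → D}

theorem TFormula.holds_stepClause (χ : TFormula) (s t : Sym) :
    (χ.stepClause s t).Holds N ↔
      ∀ n a, (N n).pred s (χ.vals I a) → (N (n + 1)).pred t (χ.vals I a) := by
  unfold TFormula.stepClause Problem.Holds Problem.empty
  split_ifs with h
  -- For closed `χ` the argument list is empty whatever the assignment is; some assignment must
  -- exist for the quantifier over it to be dropped.
  · have : Nonempty (ℕ → D) := inferInstance
    simp [TFormula.vals_of_closed h, Lit.Holds]
  · simp only [List.mem_singleton, forall_eq, Lit.Holds, if_true, TFormula.vals_of_open h]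
    simp only [List.not_mem_nil, false_imp_iff, implies_true, and_true, true_and]
    exact ⟨fun h' n a => h' n _, fun h' n d => h' n fun _ => d⟩

theorem TFormula.holds_evNeg (χ : TFormula) (s : Sym) :
    (χ.evNeg s).Holds N ↔ ∀ n a, ∃ m ≥ n, ¬ (N m).pred s (χ.vals I a) := by
  unfold TFormula.evNeg Problem.Holds Problem.empty
  split_ifs with h
  · have : Nonempty (ℕ → D) := inferInstance
    simp [TFormula.vals_of_closed h, Lit.Holds]
  · simp only [List.mem_singleton, forall_eq, Lit.Holds, TFormula.vals_of_open h]
    simp only [List.not_mem_nil, false_imp_iff, implies_true, true_and]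
    exact ⟨fun h' n a => h' n _, fun h' n d => h' n fun _ => d⟩

end

theorem TFormula.realize_at {D : Type} (M : FOStructure D) {I : ℕ → D} (hI : M.const = I)
    (χ : TFormula) (s : Sym) (a : ℕ → D) :
    (χ.at s).Realize M a ↔ M.pred s (χ.vals I a) := by
  subst hI; rfl

/-! ### The clauses describe the truth of the surrogates -/

/-- If `T` failed from `n` on, then `W`, once started by `Q`, would be passed on through `V`
forever, against the eventuality `¬ W`. -/
theorem sometime_of_clauses {Q T W V : ℕ → Prop} (h₁ : ∀ n, Q n ∧ ¬ T n → W n)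
    (h₂ : ∀ n, W n → V (n + 1)) (h₃ : ∀ n, V n → T n ∨ W n) (h₄ : ∀ n, ∃ m ≥ n, ¬ W m)
    (n : ℕ) (hn : Q n) : ∃ m, n ≤ m ∧ T m := by
  by_contra! hT
  have hW : ∀ m, n ≤ m → W m := by
    intro m hm
    induction m, hm using Nat.le_induction with
    | base => exact h₁ n ⟨hn, hT n le_rfl⟩
    | succ m hm ih => exact (h₃ _ (h₂ m ih)).resolve_left (hT _ (by omega))
  obtain ⟨m, hm, h⟩ := h₄ n
  exact h (hW m hm)

theorem always_of_clauses {Q T R : ℕ → Prop} (h₁ : ∀ n, Q n → R n) (h₂ : ∀ n, R n → R (n + 1))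
    (h₃ : ∀ n, R n → T n) (n : ℕ) (hn : Q n) (m : ℕ) (hm : n ≤ m) : T m := by
  refine h₃ m ?_
  induction m, hm using Nat.le_induction with
  | base => exact h₁ n hn
  | succ m hm ih => exact h₂ m ih

/-- Up to the first `T` after `Q`, the marker `Z` is passed on from moment to moment through `Y`,
and the absence of `T` forces `S` each time. -/
theorem until_of_clauses {Q S T Z Y : ℕ → Prop} (h₀ : ∀ n, Q n → ∃ m, n ≤ m ∧ T m)
    (h₁ : ∀ n, Q n → S n ∨ T n) (h₂ : ∀ n, Q n → Z n ∨ T n) (h₃ : ∀ n, Z n → Y (n + 1))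
    (h₄ : ∀ n, Y n → S n ∨ T n) (h₅ : ∀ n, Y n → Z n ∨ T n) (n : ℕ) (hn : Q n) :
    ∃ m, n ≤ m ∧ T m ∧ ∀ i, n ≤ i → i < m → S i := by
  classical
  have hex := h₀ n hn
  refine ⟨Nat.find hex, (Nat.find_spec hex).1, (Nat.find_spec hex).2, fun i hi him => ?_⟩
  have hnot : ∀ i, n ≤ i → i < Nat.find hex → ¬ T i := fun i hi him hT =>
    Nat.find_min hex him ⟨hi, hT⟩
  have key : ∀ i, n ≤ i → i < Nat.find hex → S i ∧ Z i := by
    intro i hi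
    induction i, hi using Nat.le_induction with
    | base =>
      intro him
      exact ⟨(h₁ n hn).resolve_right (hnot n le_rfl him), (h₂ n hn).resolve_right (hnot n le_rfl him)⟩
    | succ i hi ih =>
      intro him
      have hY := h₃ i (ih (by omega)).2
      exact ⟨(h₄ _ hY).resolve_right (hnot _ (by omega) him),
        (h₅ _ hY).resolve_right (hnot _ (by omega) him)⟩
  exact (key i hi him).1

theorem TFormula.holds_nameClause {D : Type} {N : ℕ → FOStructure D} {I : ℕ → D}
    (hI : ∀ n, (N n).const = I) (χ ψ : TFormula) :
    (χ.nameClause ψ).Holds N ↔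
      ∀ n a, (N n).pred (.name ψ) (χ.vals I a) → ψ.bar.Realize (N n) a := by
  simp only [TFormula.nameClause, TFormula.holds_univClause, FO.Realize,
    TFormula.realize_at (N _) (hI _)]

section
variable {D : Type} {N : ℕ → FOStructure D} {I : ℕ → D} [Nonempty D]

theorem TFormula.holds_sometimeClauses (hI : ∀ n, (N n).const = I) (χ : TFormula) (q t : Sym) :
    (χ.sometimeClauses q t).Holds N ↔ ∀ a,
      (∀ n, (N n).pred q (χ.vals I a) ∧ ¬ (N n).pred t (χ.vals I a) →
        (N n).pred (.aux 0 χ) (χ.vals I a)) ∧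
      (∀ n, (N n).pred (.aux 0 χ) (χ.vals I a) → (N (n + 1)).pred (.aux 1 χ) (χ.vals I a)) ∧
      (∀ n, (N n).pred (.aux 1 χ) (χ.vals I a) →
        (N n).pred t (χ.vals I a) ∨ (N n).pred (.aux 0 χ) (χ.vals I a)) ∧
      (∀ n, ∃ m ≥ n, ¬ (N m).pred (.aux 0 χ) (χ.vals I a)) := by
  simp only [TFormula.sometimeClauses, Problem.holds_union, List.forall_mem_cons,
    TFormula.holds_univClause, TFormula.holds_stepClause (I := I), TFormula.holds_evNeg (I := I),
    FO.Realize, TFormula.realize_at (N _) (hI _), List.not_mem_nil, false_imp_iff, implies_true,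
    and_true, forall_and, forall_comm (α := ℕ → D)]

theorem TFormula.holds_alwaysClauses (hI : ∀ n, (N n).const = I) (χ : TFormula) (q t : Sym) :
    (χ.alwaysClauses q t).Holds N ↔ ∀ a,
      (∀ n, (N n).pred q (χ.vals I a) → (N n).pred (.aux 2 χ) (χ.vals I a)) ∧
      (∀ n, (N n).pred (.aux 2 χ) (χ.vals I a) → (N (n + 1)).pred (.aux 2 χ) (χ.vals I a)) ∧
      (∀ n, (N n).pred (.aux 2 χ) (χ.vals I a) → (N n).pred t (χ.vals I a)) := by
  simp only [TFormula.alwaysClauses, Problem.holds_union, List.forall_mem_cons,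
    TFormula.holds_univClause, TFormula.holds_stepClause (I := I),
    FO.Realize, TFormula.realize_at (N _) (hI _), List.not_mem_nil, false_imp_iff, implies_true,
    and_true, forall_and, forall_comm (α := ℕ → D)]

theorem TFormula.holds_untilClauses (hI : ∀ n, (N n).const = I) (χ : TFormula) (q s t : Sym) :
    (χ.untilClauses q s t).Holds N ↔ (χ.sometimeClauses q t).Holds N ∧ ∀ a,
      (∀ n, (N n).pred q (χ.vals I a) →
        (N n).pred s (χ.vals I a) ∨ (N n).pred t (χ.vals I a)) ∧
      (∀ n, (N n).pred q (χ.vals I a) →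
        (N n).pred (.aux 3 χ) (χ.vals I a) ∨ (N n).pred t (χ.vals I a)) ∧
      (∀ n, (N n).pred (.aux 3 χ) (χ.vals I a) → (N (n + 1)).pred (.aux 4 χ) (χ.vals I a)) ∧
      (∀ n, (N n).pred (.aux 4 χ) (χ.vals I a) →
        (N n).pred s (χ.vals I a) ∨ (N n).pred t (χ.vals I a)) ∧
      (∀ n, (N n).pred (.aux 4 χ) (χ.vals I a) →
        (N n).pred (.aux 3 χ) (χ.vals I a) ∨ (N n).pred t (χ.vals I a)) := by
  simp only [TFormula.untilClauses, Problem.holds_union, List.forall_mem_cons,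
    TFormula.holds_univClause, TFormula.holds_stepClause (I := I),
    FO.Realize, TFormula.realize_at (N _) (hI _), List.not_mem_nil, false_imp_iff, implies_true,
    and_true, forall_and, forall_comm (α := ℕ → D)]

theorem TFormula.sometime_of_holds (hI : ∀ n, (N n).const = I) {χ : TFormula} {q t : Sym}
    (h : (χ.sometimeClauses q t).Holds N) (a : ℕ → D) (n : ℕ) (hq : (N n).pred q (χ.vals I a)) :
    ∃ m, n ≤ m ∧ (N m).pred t (χ.vals I a) := by
  obtain ⟨h₁, h₂, h₃, h₄⟩ := (χ.holds_sometimeClauses hI q t).1 h a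
  exact sometime_of_clauses (Q := fun n => (N n).pred q (χ.vals I a))
    (T := fun n => (N n).pred t (χ.vals I a)) h₁ h₂ h₃ h₄ n hq

theorem TFormula.always_of_holds (hI : ∀ n, (N n).const = I) {χ : TFormula} {q t : Sym}
    (h : (χ.alwaysClauses q t).Holds N) (a : ℕ → D) (n : ℕ) (hq : (N n).pred q (χ.vals I a))
    (m : ℕ) (hm : n ≤ m) : (N m).pred t (χ.vals I a) := by
  obtain ⟨h₁, h₂, h₃⟩ := (χ.holds_alwaysClauses hI q t).1 h a
  exact always_of_clauses (Q := fun n => (N n).pred q (χ.vals I a))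
    (T := fun n => (N n).pred t (χ.vals I a)) h₁ h₂ h₃ n hq m hm

theorem TFormula.until_of_holds (hI : ∀ n, (N n).const = I) {χ : TFormula} {q s t : Sym}
    (h : (χ.untilClauses q s t).Holds N) (a : ℕ → D) (n : ℕ) (hq : (N n).pred q (χ.vals I a)) :
    ∃ m, n ≤ m ∧ (N m).pred t (χ.vals I a) ∧
      ∀ i, n ≤ i → i < m → (N i).pred s (χ.vals I a) := by
  obtain ⟨h₀, h'⟩ := (χ.holds_untilClauses hI q s t).1 h
  obtain ⟨h₁, h₂, h₃, h₄, h₅⟩ := h' a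
  exact until_of_clauses (Q := fun n => (N n).pred q (χ.vals I a))
    (T := fun n => (N n).pred t (χ.vals I a)) (S := fun n => (N n).pred s (χ.vals I a))
    (fun n hn => TFormula.sometime_of_holds hI h₀ a n hn) h₁ h₂ h₃ h₄ h₅ n hq

theorem TFormula.surrogateSound_of_holds (hI : ∀ n, (N n).const = I) (χ : TFormula)
    (h : χ.clauses.Holds N) : χ.SurrogateSound N := by
  have hs : ∀ n a, χ.surrogate.Realize (N n) a ↔ (N n).pred (.surr χ) (χ.vals I a) :=
    fun n a => TFormula.realize_at (N n) (hI n) χ (.surr χ) a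
  cases χ with
  | verum | falsum | atom | neg | and | or | imp | iff | all | ex => trivial
  | next ψ =>
    simp only [TFormula.clauses, Problem.holds_union, List.forall_mem_cons,
      TFormula.holds_nameClause hI, TFormula.holds_stepClause (I := I)] at h
    intro n a hn
    exact h.1 _ _ (h.2.1 _ _ ((hs n a).1 hn))
  | always ψ =>
    simp only [TFormula.clauses, Problem.holds_union, List.forall_mem_cons,
      TFormula.holds_nameClause hI] at h
    intro n a hn m hm
    exact h.1 _ _ (TFormula.always_of_holds hI h.2.1 a n ((hs n a).1 hn) m hm)
  | sometime ψ =>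
    simp only [TFormula.clauses, Problem.holds_union, List.forall_mem_cons,
      TFormula.holds_nameClause hI] at h
    intro n a hn
    obtain ⟨m, hm, h'⟩ := TFormula.sometime_of_holds hI h.2.1 a n ((hs n a).1 hn)
    exact ⟨m, hm, h.1 _ _ h'⟩
  | wuntil ψ₁ ψ₂ =>
    simp only [TFormula.clauses, Problem.holds_union, List.forall_mem_cons,
      TFormula.holds_nameClause hI, TFormula.holds_univClause, FO.Realize,
      TFormula.realize_at (N _) (hI _)] at h
    obtain ⟨h₁, h₂, h₃, h₄, h₅, -⟩ := h
    intro n a hn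
    refine (h₃ n a ((hs n a).1 hn)).imp (fun h => ?_) fun h m hm =>
      h₁ _ _ (TFormula.always_of_holds hI h₅ a n h m hm)
    obtain ⟨m, hm, h', h''⟩ := TFormula.until_of_holds hI h₄ a n h
    exact ⟨m, hm, h₂ _ _ h', fun i hi him => h₁ _ _ (h'' i hi him)⟩
  | _ ψ₁ ψ₂ =>
    simp only [TFormula.clauses, Problem.holds_union, List.forall_mem_cons,
      TFormula.holds_nameClause hI] at h
    obtain ⟨h₁, h₂, h₃, -⟩ := h
    intro n a hn
    obtain ⟨m, hm, h', h''⟩ := TFormula.until_of_holds hI h₃ a n ((hs n a).1 hn)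
    exact ⟨m, hm, h₂ _ _ h', fun i hi him => h₁ _ _ (h'' i hi him)⟩

/-- A formula is satisfiable if its normal form is. -/
theorem TFormula.satisfiable_of_holds (hI : ∀ n, (N n).const = I) {φ : TFormula} (hφ : φ.NNF)
    (h : φ.dsnf.Holds N) {a : ℕ → D} (h0 : ∀ ψ ∈ φ.dsnf.init, ψ.Realize (N 0) a) :
    φ.Satisfiable := by
  have hinit : φ.bar.exClosure ∈ φ.dsnf.init := by simp [TFormula.dsnf, Problem.append]
  obtain ⟨b, hb⟩ := (FO.realize_exClosure _ _ _).1 (h0 _ hinit)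
  rw [TFormula.dsnf, Problem.holds_append, Problem.holds_union, List.forall_mem_map] at h
  refine ⟨D, ⟨fun n p ds => (N n).pred (.base p) ds, I⟩, b, ?_⟩
  exact TFormula.realize_of_bar _ N hI (fun _ _ _ => Iff.rfl) φ hφ
    (fun χ hχ => TFormula.surrogateSound_of_holds hI χ (h.2 χ hχ)) 0 b hb

end

/-! ### The expansion of a temporal structure by the reserved predicate symbols -/

/-- Truth of `θ`, whose free variables are free in `χ`, at the arguments `ds` of the surrogate
of `χ`. -/
def TFormula.TruthAt {D : Type} (M : TStructure D) (χ θ : TFormula) (n : ℕ) (ds : List D) : Prop :=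
  ∀ a : ℕ → D, (∀ d ∈ ds, a χ.fvar = d) → θ.Realize M n a

/-- A name `ψ` is used with the arguments of the formula `χ'` that contains it. If `ψ` is closed and
`χ'` is open, the surplus argument does no harm, because truth depends on the free variables only;
if `ψ` is open, its variable is that of `χ'`. -/
theorem TFormula.truthAt_iff {D : Type} (M : TStructure D) {χ θ χ' : TFormula}
    (hχ' : χ'.fv.card ≤ 1) (h : χ.fv ⊆ χ'.fv) (hθ : θ.fv ⊆ χ.fv) (n : ℕ) (I a : ℕ → D) :
    TFormula.TruthAt M χ θ n (χ'.vals I a) ↔ θ.Realize M n a := by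
  have key : ∀ b : ℕ → D, (∀ d ∈ χ'.vals I a, b χ.fvar = d) → (∀ x ∈ θ.fv, b x = a x) := by
    intro b hb x hx
    have hx' := h (hθ hx)
    rw [TFormula.vals_of_open (Finset.ne_empty_of_mem hx')] at hb
    have := hb _ (List.mem_singleton_self _)
    rwa [TFormula.fvar_eq hχ' hx',
      TFormula.fvar_eq (le_trans (Finset.card_le_card h) hχ') (hθ hx)] at this
  constructor
  · intro h'
    by_cases h0 : χ'.fv = ∅
    · exact h' a (by simp [TFormula.vals_of_closed h0])
    · rw [TFormula.vals_of_open h0] at h' key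
      have hb : ∀ d ∈ [a χ'.fvar], (fun _ => a χ'.fvar : ℕ → D) χ.fvar = d := by simp
      exact (θ.realize_congr M n _ _ (key _ hb)).1 (h' (fun _ => a χ'.fvar) hb)
  · intro h' b hb
    exact (θ.realize_congr M n _ _ (key b hb)).2 h'

/-- The formulae that the auxiliary predicate symbols of the normal form stand for. -/
def TFormula.auxFormula : ℕ → TFormula → TFormula
  | 0, .sometime ψ => .and (.sometime ψ) (.neg ψ)
  | _, .sometime ψ => .sometime ψ
  | 0, .until _ ψ => .and (.sometime ψ) (.neg ψ)
  | 1, .until _ ψ => .sometime ψ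
  | 3, .until φ ψ => .and (.until φ ψ) (.neg ψ)
  | 0, .wuntil _ ψ => .and (.sometime ψ) (.neg ψ)
  | 1, .wuntil _ ψ => .sometime ψ
  | 2, .wuntil φ _ => .always φ
  | 3, .wuntil φ ψ => .and (.until φ ψ) (.neg ψ)
  | 4, .wuntil φ ψ => .until φ ψ
  | 5, .wuntil φ ψ => .until φ ψ
  | 6, .wuntil φ _ => .always φ
  | _, χ => χ

theorem TFormula.fv_auxFormula (k : ℕ) (χ : TFormula) : (TFormula.auxFormula k χ).fv ⊆ χ.fv := by
  unfold TFormula.auxFormula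
  split <;> simp [TFormula.fv, Finset.subset_iff] <;> tauto

/-- The interpretation of the predicate symbols in the expansion. -/
def TStructure.expandPred {D : Type} (M : TStructure D) (n : ℕ) : Sym → List D → Prop
  | .base p, ds => M.pred n p ds
  | .surr χ, ds => TFormula.TruthAt M χ χ n ds
  | .name ψ, ds => TFormula.TruthAt M ψ ψ n ds
  | .aux k χ, ds => TFormula.TruthAt M χ (TFormula.auxFormula k χ) n ds
  | .flood b p c, _ =>
      if b then M.expandPred n p [M.const c] else ¬ M.expandPred n p [M.const c]

/-- The expansion of a temporal structure in which the reserved predicate symbols have their intended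
meaning. -/
def TStructure.expand {D : Type} (M : TStructure D) (n : ℕ) : FOStructure D :=
  ⟨M.expandPred n, M.const⟩

section
variable {D : Type} (M : TStructure D)

theorem TFormula.realize_surrogate {χ : TFormula} (h : χ.fv.card ≤ 1) (n : ℕ) (a : ℕ → D) :
    χ.surrogate.Realize (M.expand n) a ↔ χ.Realize M n a :=
  TFormula.truthAt_iff M h (Finset.Subset.refl _) (Finset.Subset.refl _) n M.const a

/-- In the expansion a surrogate is equivalent to its formula, so negation normal form plays no role
in this direction. -/
theorem TFormula.realize_bar {φ : TFormula} (h : φ.Monodic) :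
    ∀ n a, φ.bar.Realize (M.expand n) a ↔ φ.Realize M n a := by
  induction φ with
  | verum | falsum | atom p ts => intros; rfl
  | neg φ ih | all x φ ih | ex x φ ih =>
    intro n a
    simp only [TFormula.bar, FO.Realize, TFormula.Realize, ih h]
  | and φ ψ ih₁ ih₂ | or φ ψ ih₁ ih₂ | imp φ ψ ih₁ ih₂ | iff φ ψ ih₁ ih₂ =>
    intro n a
    simp only [TFormula.bar, FO.Realize, TFormula.Realize, ih₁ h.1, ih₂ h.2]
  | next φ ih | always φ ih | sometime φ ih => exact TFormula.realize_surrogate M h.1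
  | _ φ ψ ih₁ ih₂ => exact TFormula.realize_surrogate M h.1

theorem TFormula.expand_name {χ ψ : TFormula} (h : χ.fv.card ≤ 1) (hψ : ψ.fv ⊆ χ.fv) (n : ℕ)
    (a : ℕ → D) :
    (M.expand n).pred (.name ψ) (χ.vals M.const a) ↔ ψ.Realize M n a :=
  TFormula.truthAt_iff M h hψ (Finset.Subset.refl _) n M.const a

theorem TFormula.expand_surr {χ : TFormula} (h : χ.fv.card ≤ 1) (n : ℕ) (a : ℕ → D) :
    (M.expand n).pred (.surr χ) (χ.vals M.const a) ↔ χ.Realize M n a :=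
  TFormula.truthAt_iff M h (Finset.Subset.refl _) (Finset.Subset.refl _) n M.const a

theorem TFormula.expand_aux {χ : TFormula} (h : χ.fv.card ≤ 1) (k n : ℕ) (a : ℕ → D) :
    (M.expand n).pred (.aux k χ) (χ.vals M.const a) ↔ (TFormula.auxFormula k χ).Realize M n a :=
  TFormula.truthAt_iff M h (Finset.Subset.refl _) (TFormula.fv_auxFormula k χ) n M.const a

theorem TFormula.realize_sometime_step {ψ : TFormula} {n : ℕ} {a : ℕ → D}
    (h : (TFormula.sometime ψ).Realize M n a) (h' : ¬ ψ.Realize M n a) :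
    (TFormula.sometime ψ).Realize M (n + 1) a := by
  obtain ⟨m, hm, h⟩ := h
  refine ⟨m, Nat.lt_of_le_of_ne hm fun e => ?_, h⟩
  subst e; exact h' h

theorem TFormula.realize_until_step {φ ψ : TFormula} {n : ℕ} {a : ℕ → D}
    (h : (TFormula.until φ ψ).Realize M n a) (h' : ¬ ψ.Realize M n a) :
    φ.Realize M n a ∧ (TFormula.until φ ψ).Realize M (n + 1) a := by
  obtain ⟨m, hm, h, h''⟩ := h
  have : n < m := Nat.lt_of_le_of_ne hm fun e => by subst e; exact h' h
  exact ⟨h'' n le_rfl this, m, this, h, fun i hi => h'' i (by omega)⟩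

/-- The waiting predicate is read as "`ψ` will come, but is not true now", and its successor as "`ψ`
will come". -/
theorem TFormula.holds_sometimeClauses_expand [Nonempty D] {χ ψ : TFormula} (hχ : χ.fv.card ≤ 1)
    (hψ : ψ.fv ⊆ χ.fv) (q : Sym) (h0 : TFormula.auxFormula 0 χ = .and (.sometime ψ) (.neg ψ))
    (h1 : TFormula.auxFormula 1 χ = .sometime ψ)
    (hq : ∀ n a, (M.expand n).pred q (χ.vals M.const a) → (TFormula.sometime ψ).Realize M n a) :
    (χ.sometimeClauses q (.name ψ)).Holds M.expand := by
  rw [TFormula.holds_sometimeClauses (N := M.expand) (I := M.const) (fun _ => rfl)]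
  intro a
  simp only [TFormula.expand_aux M hχ, h0, h1, TFormula.expand_name M hχ hψ]
  refine ⟨fun n h => ⟨hq n a h.1, h.2⟩, fun n h => TFormula.realize_sometime_step M h.1 h.2,
    fun n h => ?_, fun n => ?_⟩
  · by_cases h' : ψ.Realize M n a
    · exact Or.inl h'
    · exact Or.inr ⟨h, h'⟩
  -- If one waited at all moments from `n` on, then `ψ`, promised at `n`, could not be true at any
  -- of them.
  · by_contra! hall
    obtain ⟨m, hm, h⟩ := (hall n le_rfl).1
    exact (hall m hm).2 h

theorem TFormula.holds_alwaysClauses_expand [Nonempty D] {χ ψ : TFormula} (hχ : χ.fv.card ≤ 1)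
    (hψ : ψ.fv ⊆ χ.fv) (q : Sym) (h2 : TFormula.auxFormula 2 χ = .always ψ)
    (hq : ∀ n a, (M.expand n).pred q (χ.vals M.const a) → (TFormula.always ψ).Realize M n a) :
    (χ.alwaysClauses q (.name ψ)).Holds M.expand := by
  rw [TFormula.holds_alwaysClauses (N := M.expand) (I := M.const) (fun _ => rfl)]
  intro a
  simp only [TFormula.expand_aux M hχ, h2, TFormula.expand_name M hχ hψ]
  exact ⟨fun n h => hq n a h, fun n h m hm => h m (by omega), fun n h => h n le_rfl⟩

/-- Predicate `3` is read as "the until formula is true, its second argument is not", predicate `4`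
as the until formula itself. -/
theorem TFormula.holds_untilClauses_expand [Nonempty D] {χ φ ψ : TFormula} (hχ : χ.fv.card ≤ 1)
    (hφ : φ.fv ⊆ χ.fv) (hψ : ψ.fv ⊆ χ.fv) (q : Sym)
    (h0 : TFormula.auxFormula 0 χ = .and (.sometime ψ) (.neg ψ))
    (h1 : TFormula.auxFormula 1 χ = .sometime ψ)
    (h3 : TFormula.auxFormula 3 χ = .and (.until φ ψ) (.neg ψ))
    (h4 : TFormula.auxFormula 4 χ = .until φ ψ)
    (hq : ∀ n a, (M.expand n).pred q (χ.vals M.const a) → (TFormula.until φ ψ).Realize M n a) :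
    (χ.untilClauses q (.name φ) (.name ψ)).Holds M.expand := by
  rw [TFormula.holds_untilClauses (N := M.expand) (I := M.const) (fun _ => rfl)]
  refine ⟨TFormula.holds_sometimeClauses_expand M hχ hψ q h0 h1 fun n a h => ?_, fun a => ?_⟩
  · obtain ⟨m, hm, h, -⟩ := hq n a h
    exact ⟨m, hm, h⟩
  · simp only [TFormula.expand_aux M hχ, h3, h4, TFormula.expand_name M hχ hψ,
      TFormula.expand_name M hχ hφ]
    have key : ∀ n, (TFormula.until φ ψ).Realize M n a → φ.Realize M n a ∨ ψ.Realize M n a :=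
      fun n h => by
        by_cases h' : ψ.Realize M n a
        · exact Or.inr h'
        · exact Or.inl (TFormula.realize_until_step M h h').1
    have key' : ∀ n, (TFormula.until φ ψ).Realize M n a →
        (TFormula.and (.until φ ψ) (.neg ψ)).Realize M n a ∨ ψ.Realize M n a := fun n h => by
      by_cases h' : ψ.Realize M n a
      · exact Or.inr h'
      · exact Or.inl ⟨h, h'⟩
    exact ⟨fun n h => key n (hq n a h), fun n h => key' n (hq n a h),
      fun n h => (TFormula.realize_until_step M h.1 h.2).2, key, key'⟩

theorem TFormula.holds_clauses_expand [Nonempty D] {χ : TFormula} (ht : χ.IsTemporal)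
    (hχ : χ.fv.card ≤ 1) (hm : χ.Monodic) : χ.clauses.Holds M.expand := by
  have hname : ∀ ψ ∈ χ.temporalArgs, (χ.nameClause ψ).Holds M.expand := fun ψ hψ => by
    rw [TFormula.holds_nameClause (N := M.expand) (I := M.const) (fun _ => rfl)]
    intro n a h
    exact (TFormula.realize_bar M (TFormula.monodic_temporalArgs hm hψ) n a).2
      ((TFormula.expand_name M hχ (TFormula.fv_temporalArgs hψ) n a).1 h)
  have hsurr := TFormula.expand_surr M hχ
  cases χ with
  | verum | falsum | atom | neg | and | or | imp | iff | all | ex => exact ht.elim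
  | next ψ =>
    simp only [TFormula.clauses, Problem.holds_union, List.forall_mem_cons]
    refine ⟨hname ψ (by simp [TFormula.temporalArgs]), ?_, by simp⟩
    rw [TFormula.holds_stepClause (N := M.expand) (I := M.const)]
    intro n a h
    exact (TFormula.expand_name M (ψ := ψ) hχ (Finset.Subset.refl _) (n + 1) a).2 ((hsurr n a).1 h)
  | always ψ =>
    simp only [TFormula.clauses, Problem.holds_union, List.forall_mem_cons]
    exact ⟨hname ψ (by simp [TFormula.temporalArgs]), TFormula.holds_alwaysClauses_expand M (ψ := ψ) hχ
      (Finset.Subset.refl _) _ rfl (fun n a => (hsurr n a).1), by simp⟩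
  | sometime ψ =>
    simp only [TFormula.clauses, Problem.holds_union, List.forall_mem_cons]
    exact ⟨hname ψ (by simp [TFormula.temporalArgs]), TFormula.holds_sometimeClauses_expand M (ψ := ψ) hχ
      (Finset.Subset.refl _) _ rfl rfl (fun n a => (hsurr n a).1), by simp⟩
  | wuntil φ ψ =>
    simp only [TFormula.clauses, Problem.holds_union, List.forall_mem_cons]
    refine ⟨hname φ (by simp [TFormula.temporalArgs]), hname ψ (by simp [TFormula.temporalArgs]),
      ?_, TFormula.holds_untilClauses_expand M hχ Finset.subset_union_left
        Finset.subset_union_right _ rfl rfl rfl rfl (fun n a => (TFormula.expand_aux M hχ 5 n a).1),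
      TFormula.holds_alwaysClauses_expand M hχ Finset.subset_union_left _ rfl
        (fun n a => (TFormula.expand_aux M hχ 6 n a).1), by simp⟩
    rw [TFormula.holds_univClause]
    intro n a h
    exact ((hsurr n a).1 h).imp (TFormula.expand_aux M hχ 5 n a).2
      (TFormula.expand_aux M hχ 6 n a).2
  | _ φ ψ =>
    simp only [TFormula.clauses, Problem.holds_union, List.forall_mem_cons]
    exact ⟨hname φ (by simp [TFormula.temporalArgs]), hname ψ (by simp [TFormula.temporalArgs]),
      TFormula.holds_untilClauses_expand M hχ Finset.subset_union_left
        Finset.subset_union_right _ rfl rfl rfl rfl (fun n a => (hsurr n a).1), by simp⟩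

theorem TFormula.holds_dsnf_expand [Nonempty D] {φ : TFormula} (hφ : φ.Monodic) :
    φ.dsnf.Holds M.expand := by
  rw [TFormula.dsnf, Problem.holds_append, Problem.holds_union, List.forall_mem_map]
  refine ⟨by simp [Problem.Holds, Problem.empty], fun χ hχ => ?_⟩
  obtain ⟨h₁, h₂, h₃⟩ := TFormula.monodic_of_mem_temporalSubs hφ hχ
  exact TFormula.holds_clauses_expand M h₁ h₂ h₃

end

/-! ### Constant flooding -/

theorem Problem.mem_flooded_univ (P : Problem) (φ : FO) : φ ∈ P.flooded.univ ↔ φ ∈ P.univ ∨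
    ∃ L ∈ P.evN, ∃ c ∈ P.consts, φ = .imp (.atom (.flood L.pos L.sym c) []) (L.app [.const c]) := by
  simp only [Problem.flooded, List.mem_append, List.mem_map, List.mem_flatMap, Finset.mem_sort]
  refine or_congr Iff.rfl ⟨?_, ?_⟩
  · rintro ⟨_, ⟨L, hL, c, hc, rfl⟩, rfl⟩; exact ⟨L, hL, c, hc, rfl⟩
  · rintro ⟨L, hL, c, hc, rfl⟩; exact ⟨_, ⟨L, hL, c, hc, rfl⟩, rfl⟩

theorem Problem.mem_flooded_evG (P : Problem) (l : Lit) : l ∈ P.flooded.evG ↔ l ∈ P.evG ∨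
    ∃ L ∈ P.evN, ∃ c ∈ P.consts, l = ⟨true, .flood L.pos L.sym c⟩ := by
  simp only [Problem.flooded, List.mem_append, List.mem_map, List.mem_flatMap, Finset.mem_sort]
  refine or_congr Iff.rfl ⟨?_, ?_⟩
  · rintro ⟨_, ⟨L, hL, c, hc, rfl⟩, rfl⟩; exact ⟨L, hL, c, hc, rfl⟩
  · rintro ⟨L, hL, c, hc, rfl⟩; exact ⟨_, ⟨L, hL, c, hc, rfl⟩, rfl⟩

theorem Problem.mem_consts (P : Problem) (c : ℕ) :
    c ∈ P.consts ↔ ∃ φ, (φ ∈ P.univ ∨ φ ∈ P.init) ∧ c ∈ φ.consts := by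
  rw [Problem.consts, mem_foldr_union]
  simp only [List.mem_append]

/-- Flooding mentions only constants that are already there, so a single round of it covers all
constants of the resulting problem. -/
theorem Problem.consts_flooded (P : Problem) : P.flooded.consts = P.consts := by
  ext c
  rw [Problem.mem_consts, Problem.mem_consts]
  constructor
  · rintro ⟨φ, hφ | hφ, hc⟩
    · rcases (P.mem_flooded_univ φ).1 hφ with h | ⟨L, hL, c', hc', rfl⟩
      · exact ⟨φ, Or.inl h, hc⟩
      · have : c = c' := by
          rcases L with ⟨_ | _, s⟩ <;> simpa [FO.consts, Lit.app, Term.consts] using hc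
        subst this
        exact (P.mem_consts c).1 hc'
    · exact ⟨φ, Or.inr hφ, hc⟩
  · rintro ⟨φ, hφ | hφ, hc⟩
    · exact ⟨φ, Or.inl ((P.mem_flooded_univ φ).2 (Or.inl hφ)), hc⟩
    · exact ⟨φ, Or.inr hφ, hc⟩

theorem Problem.holds_of_flooded {D : Type} {N : ℕ → FOStructure D} {P : Problem}
    (h : P.flooded.Holds N) : P.Holds N :=
  ⟨fun φ hφ => h.1 φ ((P.mem_flooded_univ φ).2 (Or.inl hφ)), h.2.1, h.2.2.1,
    fun l hl => h.2.2.2.1 l ((P.mem_flooded_evG l).2 (Or.inl hl)), h.2.2.2.2⟩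

/-- The expansion interprets the flooding proposition as the literal at the constant. Its definition
is then trivially true, and its eventuality is an instance of the non-ground one. -/
theorem Problem.holds_flooded_expand {D : Type} (M : TStructure D) {P : Problem}
    (h : P.Holds M.expand) : P.flooded.Holds M.expand := by
  have key : ∀ (L : Lit) c n, (M.expand n).pred (.flood L.pos L.sym c) [] ↔
      L.Holds (M.expand n) [M.const c] := fun L c n => Iff.rfl
  refine ⟨fun φ hφ n a => ?_, h.2.1, h.2.2.1, fun l hl n => ?_, h.2.2.2.2⟩
  · rcases (P.mem_flooded_univ φ).1 hφ with hφ | ⟨L, hL, c, hc, rfl⟩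
    · exact h.1 φ hφ n a
    · intro h'
      rw [Lit.realize_app]
      exact (key L c n).1 h'
  · rcases (P.mem_flooded_evG l).1 hl with hl | ⟨L, hL, c, hc, rfl⟩
    · exact h.2.2.2.1 l hl n
    · obtain ⟨m, hm, h'⟩ := h.2.2.2.2 L hL n (M.const c)
      exact ⟨m, hm, (key L c m).2 h'⟩

theorem TFormula.holds_of_satisfiable {φ : TFormula} (hφ : φ.Monodic) (h : φ.Satisfiable) :
    ∃ (D : Type) (I : ℕ → D) (N : ℕ → FOStructure D), (∀ n, (N n).const = I) ∧
      φ.dsnf.flooded.Holds N ∧ ∀ ψ ∈ φ.dsnf.flooded.init, ∀ a, ψ.Realize (N 0) a := by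
  obtain ⟨D, M, a, h⟩ := h
  have : Nonempty D := ⟨a 0⟩
  refine ⟨D, M.const, M.expand, fun _ => rfl,
    Problem.holds_flooded_expand M (TFormula.holds_dsnf_expand M hφ), ?_⟩
  -- The clauses of the temporal subformulae contribute nothing initial, so the closure of `φ.bar`
  -- is the only formula to be checked at moment `0`.
  have hi : ∀ l : List TFormula, (Problem.union (l.map TFormula.clauses)).init = [] := by
    intro l
    induction l with
    | nil => rfl
    | cons χ l ih =>
      change χ.clauses.init ++ (Problem.union (l.map TFormula.clauses)).init = []
      have hu : ∀ (χ : TFormula) θ, (χ.univClause θ).init = [] := fun _ _ => rfl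
      have hs : ∀ (χ : TFormula) s t, (χ.stepClause s t).init = [] := fun χ s t => by
        unfold TFormula.stepClause; split_ifs <;> rfl
      have he : ∀ (χ : TFormula) s, (χ.evNeg s).init = [] := fun χ s => by
        unfold TFormula.evNeg; split_ifs <;> rfl
      rw [ih]
      cases χ <;> simp [TFormula.clauses, Problem.union, Problem.append, Problem.empty, hu, hs, he,
        TFormula.nameClause, TFormula.alwaysClauses, TFormula.sometimeClauses,
        TFormula.untilClauses]
  intro ψ hψ b
  have : ψ = φ.bar.exClosure := by
    simpa [Problem.flooded, TFormula.dsnf, Problem.append, hi] using hψ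
  subst this
  exact (FO.realize_exClosure _ _ _).2 ⟨a, (TFormula.realize_bar M hφ 0 a).2 h⟩

end FOTL

namespace FOTL

/-! ### Soundness of temporal resolution -/

section
variable {D : Type} {N : ℕ → FOStructure D} {I : ℕ → D} {P : Problem}

theorem DerivedStep.sound (hI : ∀ n, (N n).const = I) (h : P.Holds N) {A B : FO}
    (hAB : DerivedStep P A B) (n : ℕ) (a : ℕ → D) (hA : A.Realize (N n) a) :
    B.Realize (N (n + 1)) a := by
  obtain ⟨-, hG, hN, -, -⟩ := h
  cases hAB with
  | all s hs hne =>
    intro d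
    obtain ⟨φ, hφ, h'⟩ := (realize_disj _ _ _).1 (hA d)
    obtain ⟨c, hc, rfl⟩ := List.mem_map.1 hφ
    refine (realize_disj _ _ _).2 ⟨_, List.mem_map.2 ⟨c, hc, rfl⟩, ?_⟩
    rw [Lit.realize_app] at h' ⊢
    simpa [Term.eval] using hN c (hs hc) n d (by simpa [Term.eval] using h')
  | ex s hs hne =>
    obtain ⟨d, hA⟩ := hA
    refine ⟨d, (realize_conj _ _ _).2 fun φ hφ => ?_⟩
    obtain ⟨c, hc, rfl⟩ := List.mem_map.1 hφ
    have h' := (realize_conj _ _ _).1 hA _ (List.mem_map.2 ⟨c, hc, rfl⟩)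
    rw [Lit.realize_app] at h' ⊢
    simpa [Term.eval] using hN c (hs hc) n d (by simpa [Term.eval] using h')
  | const cl hcl c hc =>
    rw [Lit.realize_app] at hA ⊢
    have := hN cl hcl n (I c) (by simpa [Term.eval, hI] using hA)
    simpa [Term.eval, hI] using this
  | ground cl hcl =>
    rw [Lit.realize_app] at hA ⊢
    exact hG cl hcl n hA

theorem MergedStep.sound (hI : ∀ n, (N n).const = I) (h : P.Holds N) {A B : FO}
    (hAB : MergedStep P A B) (n : ℕ) (a : ℕ → D) (hA : A.Realize (N n) a) :
    B.Realize (N (n + 1)) a := by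
  obtain ⟨m, hm, rfl, rfl⟩ := hAB
  rw [realize_conj, List.forall_mem_map] at hA ⊢
  exact fun c hc => (hm c hc).sound hI h n a (hA c hc)

theorem FullMergedStep.sound (hI : ∀ n, (N n).const = I) (h : P.Holds N) {c : FullClause}
    (hc : FullMergedStep P c) (n : ℕ) (a : ℕ → D) (hA : c.A.Realize (N n) a ∧ c.A'.Realize (N n) a) :
    c.B.Realize (N (n + 1)) a ∧ c.B'.Realize (N (n + 1)) a := by
  obtain ⟨hm, s, hs, hA', hB'⟩ := hc
  refine ⟨hm.sound hI h n a hA.1, ?_⟩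
  have hA2 := hA.2
  rw [hA', realize_conj, List.forall_mem_map] at hA2
  rw [hB', realize_conj, List.forall_mem_map]
  intro cl hcl
  have h' := hA2 cl hcl
  rw [Lit.realize_app] at h' ⊢
  exact h.2.2.1 cl (hs hcl) n _ h'

/-- For the eventuality rules, suppose a left-hand side is true at `n`. By the second side condition
some left-hand side is then true at every later moment, and by the first one the eventuality fails
at every moment after `n`. -/
theorem Infers.sound (hI : ∀ n, (N n).const = I) (h : P.Holds N) {U : List FO}
    (hU : ∀ φ ∈ U, ∀ n a, φ.Realize (N n) a) {ψ : FO} (hψ : Infers P U ψ) (n : ℕ) (a : ℕ → D) :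
    ψ.Realize (N n) a := by
  cases hψ with
  | step A B hAB hB =>
    intro hA
    refine hB D (N (n + 1)) a fun φ hφ => ?_
    rcases List.mem_cons.1 hφ with rfl | hφ
    · exact hAB.sound hI h n a hA
    · exact hU φ hφ _ _
  | eventuality L hL cs hcs h₁ h₂ =>
    intro d
    generalize hb : Function.update a 0 d = b
    -- The full merged clauses are followed at the single element `b 0`; universally quantified
    -- consequences of `U` are instantiated with it.
    have hself : ∀ m (φ : FO), (FO.all 0 φ).Realize (N m) b → φ.Realize (N m) b := fun m φ h' => by
      simpa using h' (b 0)
    rw [realize_conj, List.forall_mem_map]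
    intro c hc
    by_contra hcon
    have hcon : c.A.Realize (N n) b ∧ c.A'.Realize (N n) b := by
      simpa [FO.Realize, not_or] using hcon
    have key : ∀ m, n ≤ m → ∃ c ∈ cs, c.A.Realize (N m) b ∧ c.A'.Realize (N m) b := by
      intro m hm
      induction m, hm using Nat.le_induction with
      | base => exact ⟨c, hc, hcon⟩
      | succ m hm ih =>
        obtain ⟨c', hc', h'⟩ := ih
        have hB := (hcs c' hc').sound hI h m b h'
        have := hself _ _ (h₂ c' hc' D (N (m + 1)) b fun φ hφ => hU φ hφ _ _) hB
        obtain ⟨φ, hφ, h''⟩ := (realize_disj _ _ _).1 this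
        obtain ⟨c'', hc'', rfl⟩ := List.mem_map.1 hφ
        exact ⟨c'', hc'', h''⟩
    -- The literal is excluded only by right-hand sides, that is, after `n`; therefore the
    -- eventuality is evaluated from `n + 1` on.
    obtain ⟨m, hm, hL'⟩ := h.2.2.2.2 L hL (n + 1) (b 0)
    obtain ⟨k, rfl⟩ : ∃ k, m = k + 1 := ⟨m - 1, by omega⟩
    obtain ⟨c', hc', h'⟩ := key k (by omega)
    have hB := (hcs c' hc').sound hI h k b h'
    refine hself _ _ (h₁ c' hc' D (N (k + 1)) b fun φ hφ => hU φ hφ _ _) hB ?_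
    rw [Lit.realize_app]
    exact hL'
  | groundEventuality l hl cs hcs h₁ h₂ =>
    rw [realize_conj, List.forall_mem_map]
    intro c hc hcon
    have key : ∀ m, n ≤ m → ∃ c ∈ cs, c.1.Realize (N m) a := by
      intro m hm
      induction m, hm using Nat.le_induction with
      | base => exact ⟨c, hc, hcon⟩
      | succ m hm ih =>
        obtain ⟨c', hc', h'⟩ := ih
        have hB := (hcs c' hc').sound hI h m a h'
        have := h₂ c' hc' D (N (m + 1)) a (fun φ hφ => hU φ hφ _ _) hB
        obtain ⟨φ, hφ, h''⟩ := (realize_disj _ _ _).1 this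
        obtain ⟨c'', hc'', rfl⟩ := List.mem_map.1 hφ
        exact ⟨c'', hc'', h''⟩
    obtain ⟨m, hm, hL'⟩ := h.2.2.2.1 l hl (n + 1)
    obtain ⟨k, rfl⟩ : ∃ k, m = k + 1 := ⟨m - 1, by omega⟩
    obtain ⟨c', hc', h'⟩ := key k (by omega)
    refine h₁ c' hc' D (N (k + 1)) a (fun φ hφ => hU φ hφ _ _) ((hcs c' hc').sound hI h k a h') ?_
    rw [Lit.realize_app]
    exact hL'

theorem Derivation.sound (hI : ∀ n, (N n).const = I) (h : P.Holds N) {U : List FO}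
    (hU : Derivation P U) : ∀ φ ∈ U, ∀ n a, φ.Realize (N n) a := by
  induction hU with
  | start => exact h.1
  | extend U ψ _ hψ ih =>
    intro φ hφ
    rcases List.mem_cons.1 hφ with rfl | hφ
    · exact hψ.sound hI h ih
    · exact ih φ hφ

/-- A temporal problem that has a model is not refutable. -/
theorem Problem.not_refutable (hI : ∀ n, (N n).const = I) (h : P.Holds N)
    (h0 : ∀ ψ ∈ P.init, ∀ a, ψ.Realize (N 0) a) : ¬ P.Refutable := by
  rintro ⟨U, hU, hT⟩
  have hU' := hU.sound hI h
  rcases hT with hT | ⟨L, hL, hT⟩ | ⟨l, hl, hT⟩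
  · refine hT D (N 0) I fun φ hφ => ?_
    rcases List.mem_append.1 hφ with hφ | hφ
    · exact hU' φ hφ _ _
    · exact h0 φ hφ _
  · obtain ⟨m, -, h'⟩ := h.2.2.2.2 L hL 0 (I 0)
    refine hT D (N m) I (fun φ hφ => hU' φ hφ _ _) (I 0) ?_
    rw [Lit.realize_app]
    simpa [Term.eval] using h'
  · obtain ⟨m, -, h'⟩ := h.2.2.2.1 l hl 0
    refine hT D (N m) I (fun φ hφ => hU' φ hφ _ _) ?_
    rw [Lit.realize_app]
    exact h'

end

end FOTL

namespace FOTL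

/-! ### Fair paths

States `s` carry sets `Γ s` of element types.  `Edge` is the transition relation between states, `E`
the one between element types.  -/

section FairPath
open Relation
variable {S T : Type} (Γ : S → Set T) (Edge : S → S → Prop) (E : T → T → Prop) (K : Set S)

/-- Transitions between states inside `K`. -/
def StateStep (s s' : S) : Prop := s' ∈ K ∧ Edge s s'

/-- Transitions between pairs of a state inside `K` and an element type. -/
def PairStep (x y : S × T) : Prop := y.1 ∈ K ∧ Edge x.1 y.1 ∧ y.2 ∈ Γ y.1 ∧ E x.2 y.2

/-- `g` is a track from `n` to `m` along `f`. -/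
def Track (f : ℕ → S) (n m : ℕ) (g : ℕ → T) : Prop :=
  (∀ i, n ≤ i → i ≤ m → g i ∈ Γ (f i)) ∧ ∀ i, n ≤ i → i < m → E (g i) (g (i + 1))

/-- Finite paths from `s₀`. -/
structure FinPath (s₀ : S) where
  len : ℕ
  f : ℕ → S
  zero : f 0 = s₀
  mem : ∀ i ≤ len, f i ∈ K
  edge : ∀ i < len, Edge (f i) (f (i + 1))

variable {Γ Edge E K} {s₀ : S}

/-- Paths are ordered by extension. Values of `f` beyond `len` are ignored, so this is a preorder
only. -/
instance : Preorder (FinPath Edge K s₀) where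
  le p q := p.len ≤ q.len ∧ ∀ i ≤ p.len, p.f i = q.f i
  le_refl p := ⟨le_rfl, fun _ _ => rfl⟩
  le_trans p q r h h' := ⟨h.1.trans h'.1, fun i hi => (h.2 i hi).trans (h'.2 i (hi.trans h.1))⟩

theorem Track.congr {f f' : ℕ → S} {n m : ℕ} {g g' : ℕ → T} (h : Track Γ E f n m g)
    (hf : ∀ i ≤ m, f i = f' i) (hg : ∀ i ≤ m, g i = g' i) : Track Γ E f' n m g' :=
  ⟨fun i hi him => hf i him ▸ hg i him ▸ h.1 i hi him,
    fun i hi him => hg i (by omega) ▸ hg (i + 1) (by omega) ▸ h.2 i hi him⟩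

theorem Track.snoc {f : ℕ → S} {n m : ℕ} {g : ℕ → T} (h : Track Γ E f n m g) (hnm : n ≤ m) {γ : T}
    (hγ : γ ∈ Γ (f (m + 1))) (hE : E (g m) γ) :
    Track Γ E f n (m + 1) (Function.update g (m + 1) γ) := by
  refine ⟨fun i hi him => ?_, fun i hi him => ?_⟩
  · rcases eq_or_ne i (m + 1) with rfl | hne
    · simpa using hγ
    · rw [Function.update_of_ne hne]; exact h.1 i hi (by omega)
  · rw [Function.update_of_ne (by omega : i ≠ m + 1)]
    rcases eq_or_ne i m with rfl | hne
    · simpa using hE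
    · rw [Function.update_of_ne (by omega : i + 1 ≠ m + 1)]
      exact h.2 i hi (by omega)

theorem FinPath.exists_snoc (p : FinPath Edge K s₀) {s : S} (h : StateStep Edge K (p.f p.len) s) :
    ∃ q : FinPath Edge K s₀, p ≤ q ∧ q.len = p.len + 1 ∧ q.f (p.len + 1) = s := by
  refine ⟨⟨p.len + 1, Function.update p.f (p.len + 1) s, ?_, fun i hi => ?_, fun i hi => ?_⟩,
    ⟨Nat.le_succ _, fun i hi => ?_⟩, rfl, by simp⟩
  · rw [Function.update_of_ne (by omega)]; exact p.zero
  · rcases eq_or_ne i (p.len + 1) with rfl | hne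
    · simpa using h.1
    · rw [Function.update_of_ne hne]; exact p.mem i (by omega)
  · rw [Function.update_of_ne (by omega : i ≠ p.len + 1)]
    rcases eq_or_ne i p.len with rfl | hne
    · simpa using h.2
    · rw [Function.update_of_ne (by omega : i + 1 ≠ p.len + 1)]
      exact p.edge i (by omega)
  · exact (Function.update_of_ne (by omega : i ≠ p.len + 1) _ _).symm

theorem FinPath.exists_extend (p : FinPath Edge K s₀) {s : S}
    (h : ReflTransGen (StateStep Edge K) (p.f p.len) s) :
    ∃ q : FinPath Edge K s₀, p ≤ q ∧ q.f q.len = s := by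
  induction h with
  | refl => exact ⟨p, le_rfl, rfl⟩
  | tail _ h ih =>
    obtain ⟨q, hq, rfl⟩ := ih
    obtain ⟨r, hr, hl, h'⟩ := q.exists_snoc h
    exact ⟨r, hq.trans hr, hl ▸ h'⟩

/-- Reachability of pairs does two things at once: the states prolong the path, and the element
types prolong a given track along it. -/
theorem FinPath.exists_extend_track (p : FinPath Edge K s₀) {n : ℕ} (hn : n ≤ p.len) {g : ℕ → T}
    (hg : Track Γ E p.f n p.len g) {y : S × T}
    (h : ReflTransGen (PairStep Γ Edge E K) (p.f p.len, g p.len) y) :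
    ∃ q : FinPath Edge K s₀, p ≤ q ∧ ∃ g' : ℕ → T, g' n = g n ∧ Track Γ E q.f n q.len g' ∧
      (q.f q.len, g' q.len) = y := by
  induction h with
  | refl => exact ⟨p, le_rfl, g, rfl, hg, rfl⟩
  | @tail y z _ h ih =>
    obtain ⟨q, hq, g', hg', ht, rfl⟩ := ih
    obtain ⟨r, hr, hl, h'⟩ := q.exists_snoc (s := z.1) ⟨h.1, h.2.1⟩
    have hnq : n ≤ q.len := hn.trans hq.1
    refine ⟨r, hq.trans hr, Function.update g' (q.len + 1) z.2, ?_, ?_, ?_⟩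
    · rw [Function.update_of_ne (by omega), hg']
    · rw [hl]
      refine Track.snoc (ht.congr hr.2 fun _ _ => rfl) hnq ?_ h.2.2.2
      rw [h']; exact h.2.2.1
    · rw [hl, h']; simp

theorem exists_track (f : ℕ → S) (hfwd : ∀ s s', Edge s s' → ∀ γ ∈ Γ s, ∃ γ' ∈ Γ s', E γ γ')
    {n m : ℕ} (hnm : n ≤ m) (hf : ∀ i < m, Edge (f i) (f (i + 1))) {γ : T} (hγ : γ ∈ Γ (f n)) :
    ∃ g : ℕ → T, g n = γ ∧ Track Γ E f n m g := by
  induction m, hnm using Nat.le_induction with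
  | base =>
    refine ⟨fun _ => γ, rfl, fun i hi him => ?_, fun i hi him => by omega⟩
    rwa [le_antisymm him hi]
  | succ m hm ih =>
    obtain ⟨g, hg, ht⟩ := ih fun i hi => hf i (by omega)
    obtain ⟨γ', hγ', hE⟩ := hfwd _ _ (hf m (by omega)) _ (ht.1 m hm le_rfl)
    exact ⟨_, by rw [Function.update_of_ne (by omega), hg], ht.snoc hm hγ' hE⟩

/-- If all goals can be reached from everywhere in `K`, then there is an infinite path in `K` along
which all goals of states and all goals of elements are reachable again and again. -/
theorem exists_fair_path [Countable T] {J J' : Type} [Countable J] [Countable J']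
    (G : J' → S → Prop) (L : J → T → Prop) (hs₀ : s₀ ∈ K)
    (hsucc : ∀ s ∈ K, ∃ s', StateStep Edge K s s')
    (hfwd : ∀ s s', Edge s s' → ∀ γ ∈ Γ s, ∃ γ' ∈ Γ s', E γ γ')
    (hG : ∀ s ∈ K, ∀ j, ∃ s', ReflTransGen (StateStep Edge K) s s' ∧ G j s')
    (hL : ∀ s ∈ K, ∀ γ ∈ Γ s, ∀ j, ∃ y, ReflTransGen (PairStep Γ Edge E K) (s, γ) y ∧ L j y.2) :
    ∃ f : ℕ → S, f 0 = s₀ ∧ (∀ n, f n ∈ K) ∧ (∀ n, Edge (f n) (f (n + 1))) ∧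
      (∀ j n, ∃ m, n ≤ m ∧ G j (f m)) ∧
      ∀ j n, ∀ γ ∈ Γ (f n), ∃ m, n ≤ m ∧ ∃ g : ℕ → T, g n = γ ∧ Track Γ E f n m g ∧ L j (g m) := by
  have hlen : ∀ n, ∀ p : FinPath Edge K s₀, ∃ q, p ≤ q ∧ n ≤ q.len := by
    intro n
    induction n with
    | zero => exact fun p => ⟨p, le_rfl, Nat.zero_le _⟩
    | succ n ih =>
      intro p
      obtain ⟨q, hq, hn⟩ := ih p
      obtain ⟨s', hs'⟩ := hsucc _ (q.mem _ le_rfl)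
      obtain ⟨r, hr, hl, -⟩ := q.exists_snoc hs'
      exact ⟨r, hq.trans hr, by omega⟩
  -- Three kinds of requirements on a finite path: to have length at least `n`, to fulfil a state
  -- goal at or after `n`, and to carry a track from type `γ` at `n` to an element goal. There are
  -- countably many, since there are countably many types and goals.
  let carrier : ℕ ⊕ (ℕ × J') ⊕ (ℕ × T × J) → Set (FinPath Edge K s₀)
    | .inl n => {p | n ≤ p.len}
    | .inr (.inl x) => {p | ∃ m, x.1 ≤ m ∧ m ≤ p.len ∧ G x.2 (p.f m)}
    | .inr (.inr x) => {p | x.1 ≤ p.len ∧ (x.2.1 ∈ Γ (p.f x.1) → ∃ m, x.1 ≤ m ∧ m ≤ p.len ∧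
        ∃ g : ℕ → T, g x.1 = x.2.1 ∧ Track Γ E p.f x.1 m g ∧ L x.2.2 (g m))}
  have hcof : ∀ x, IsCofinal (carrier x) := by
    rintro (n | ⟨n, j⟩ | ⟨n, γ, j⟩) p <;> obtain ⟨q, hq, hn⟩ := hlen n p
    · exact ⟨q, hn, hq⟩
    · obtain ⟨s', hs', hj⟩ := hG _ (q.mem _ le_rfl) j
      obtain ⟨r, hr, rfl⟩ := q.exists_extend hs'
      exact ⟨r, ⟨r.len, hn.trans hr.1, le_rfl, hj⟩, hq.trans hr⟩
    · by_cases hγ : γ ∈ Γ (q.f n)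
      -- First `γ` is carried from `n` to the end of the path already built, then both are prolonged
      -- to the goal.
      · obtain ⟨g, rfl, ht⟩ := exists_track (E := E) q.f hfwd hn q.edge hγ
        obtain ⟨y, hy, hj⟩ := hL _ (q.mem _ le_rfl) _ (ht.1 _ hn le_rfl) j
        obtain ⟨r, hr, g', hg', ht', rfl⟩ := q.exists_extend_track hn ht hy
        exact ⟨r, ⟨hn.trans hr.1, fun _ => ⟨r.len, hn.trans hr.1, le_rfl, g', hg', ht', hj⟩⟩,
          hq.trans hr⟩
      · exact ⟨q, ⟨hn, fun h => (hγ h).elim⟩, hq⟩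
  let _ : Encodable (ℕ ⊕ (ℕ × J') ⊕ (ℕ × T × J)) := Encodable.ofCountable _
  let p₀ : FinPath Edge K s₀ := ⟨0, fun _ => s₀, rfl, fun _ _ => hs₀, fun i hi => by omega⟩
  let 𝒟 : ℕ ⊕ (ℕ × J') ⊕ (ℕ × T × J) → Order.Cofinal (FinPath Edge K s₀) :=
    fun x => ⟨carrier x, hcof x⟩
  let σ := Order.sequenceOfCofinals p₀ 𝒟
  have hmono : Monotone σ := Order.sequenceOfCofinals.monotone p₀ 𝒟
  have hmem : ∀ x, σ (Encodable.encode x + 1) ∈ carrier x :=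
    Order.sequenceOfCofinals.encode_mem p₀ 𝒟
  let k : ℕ → ℕ := fun n => Encodable.encode (Sum.inl n : ℕ ⊕ (ℕ × J') ⊕ (ℕ × T × J)) + 1
  have hk : ∀ n, n ≤ (σ (k n)).len := fun n => hmem (.inl n)
  -- The members of the sequence extend one another; `f n` is read off from a member known to have
  -- length at least `n`.
  let f : ℕ → S := fun n => (σ (k n)).f n
  have hf : ∀ i n, n ≤ (σ i).len → (σ i).f n = f n := by
    intro i n hn
    rcases le_total i (k n) with h | h
    · exact (hmono h).2 n hn
    · exact ((hmono h).2 n (hk n)).symm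
  refine ⟨f, (σ (k 0)).zero, fun n => (σ (k n)).mem n (hk n), fun n => ?_, fun j n => ?_,
    fun j n γ hγ => ?_⟩
  · have h := (σ (k (n + 1))).edge n (hk (n + 1))
    rwa [hf _ _ (hk (n + 1)), hf _ _ ((Nat.le_succ n).trans (hk (n + 1)))] at h
  · obtain ⟨m, hm, hm', h⟩ := hmem (.inr (.inl (n, j)))
    rw [hf _ _ hm'] at h
    exact ⟨m, hm, h⟩
  · obtain ⟨hn, h⟩ := hmem (.inr (.inr (n, γ, j)))
    simp only [hf _ _ hn] at h
    obtain ⟨m, hm, hm', g, hg, ht, hj⟩ := h hγ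
    exact ⟨m, hm, g, hg, ht.congr (fun i hi => hf _ _ (hi.trans hm')) fun _ _ => rfl, hj⟩

/-- Along a fair path every element type at every moment lies on a run that fulfils all goals again
and again. -/
theorem exists_run {J : Type} [Countable J] (L : J → T → Prop) (f : ℕ → S)
    (hfwd : ∀ s s', Edge s s' → ∀ γ ∈ Γ s, ∃ γ' ∈ Γ s', E γ γ')
    (hbwd : ∀ s s', Edge s s' → ∀ γ' ∈ Γ s', ∃ γ ∈ Γ s, E γ γ')
    (hf : ∀ n, Edge (f n) (f (n + 1)))
    (hL : ∀ j n, ∀ γ ∈ Γ (f n), ∃ m, n ≤ m ∧ ∃ g : ℕ → T, g n = γ ∧ Track Γ E f n m g ∧ L j (g m))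
    (n : ℕ) (γ : T) (hγ : γ ∈ Γ (f n)) :
    ∃ g : ℕ → T, g n = γ ∧ (∀ i, g i ∈ Γ (f i)) ∧ (∀ i, E (g i) (g (i + 1))) ∧
      ∀ j i, ∃ m, i ≤ m ∧ L j (g m) := by
  -- the past
  have hpast : ∀ n, ∀ γ ∈ Γ (f n), ∃ g : ℕ → T, g n = γ ∧ Track Γ E f 0 n g := by
    intro n
    induction n with
    | zero =>
      intro γ hγ
      refine ⟨fun _ => γ, rfl, fun i _ hi => ?_, fun i _ hi => by omega⟩
      rwa [Nat.le_zero.1 hi]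
    | succ n ih =>
      intro γ' hγ'
      obtain ⟨γ, hγ, hE⟩ := hbwd _ _ (hf n) γ' hγ'
      obtain ⟨g, rfl, ht⟩ := ih γ hγ
      exact ⟨_, by simp, ht.snoc (Nat.zero_le _) hγ' hE⟩
  -- the future, as a fair path through pairs
  let K' : Set (ℕ × T) := {x | x.2 ∈ Γ (f x.1)}
  let Edge' : ℕ × T → ℕ × T → Prop := fun x y => y.1 = x.1 + 1 ∧ E x.2 y.2
  have htrack : ∀ n m g, n ≤ m → Track Γ E f n m g →
      ReflTransGen (StateStep Edge' K') (n, g n) (m, g m) := by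
    intro n m g hnm
    induction m, hnm using Nat.le_induction with
    | base => intro _; exact ReflTransGen.refl
    | succ m hm ih =>
      intro ht
      refine (ih ⟨fun i hi him => ht.1 i hi (by omega), fun i hi him => ht.2 i hi (by omega)⟩).tail
        ⟨ht.1 _ (by omega) le_rfl, rfl, ht.2 m hm (by omega)⟩
  -- The pairs of a moment and an element type now serve as states, and the element goals as state
  -- goals. The element types of this second application are empty, so its requirements on tracks
  -- are void.
  obtain ⟨p, hp0, hpK, hpE, hpG, -⟩ := exists_fair_path (Γ := fun _ => (∅ : Set Empty))
    (E := fun _ _ => True) (Edge := Edge') (K := K') (J := Empty) (s₀ := (n, γ))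
    (fun (j : J) x => L j x.2) (fun _ _ => True) hγ
    (fun x hx => by
      obtain ⟨γ', hγ', hE⟩ := hfwd _ _ (hf x.1) x.2 hx
      exact ⟨(x.1 + 1, γ'), hγ', rfl, hE⟩)
    (fun _ _ _ γ => γ.elim)
    (fun x hx j => by
      obtain ⟨m, hm, g, hg, ht, hj⟩ := hL j x.1 x.2 hx
      refine ⟨(m, g m), ?_, hj⟩
      have := htrack x.1 m g hm ht
      rwa [hg] at this)
    (fun _ _ γ => γ.elim)
  have hp1 : ∀ i, (p i).1 = n + i := by
    intro i
    induction i with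
    | zero => rw [hp0]; rfl
    | succ i ih => rw [(hpE i).1, ih]; rfl
  obtain ⟨h, hh, ht⟩ := hpast n γ hγ
  refine ⟨fun i => if i ≤ n then h i else (p (i - n)).2, by simpa using hh, fun i => ?_, fun i => ?_,
    fun j i => ?_⟩
  · dsimp only
    split_ifs with hi
    · exact ht.1 i (Nat.zero_le _) hi
    · have : (p (i - n)).2 ∈ Γ (f (p (i - n)).1) := hpK (i - n)
      rwa [hp1, (by omega : n + (i - n) = i)] at this
  · dsimp only
    rcases lt_trichotomy i n with hi | rfl | hi
    · rw [if_pos hi.le, if_pos (by omega)]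
      exact ht.2 i (Nat.zero_le _) hi
    · rw [if_pos le_rfl, if_neg (by omega), hh]
      have := (hpE 0).2
      rw [hp0] at this
      simpa using this
    · rw [if_neg (by omega), if_neg (by omega), (by omega : i + 1 - n = (i - n) + 1)]
      exact (hpE (i - n)).2
  -- From `m ≥ i + 1` it follows that `n + m > n`, so the goal is met in the future part of the run.
  · obtain ⟨m, hm, hj⟩ := hpG j (i + 1)
    refine ⟨n + m, by omega, ?_⟩
    dsimp only
    rw [if_neg (by omega), (by omega : n + m - n = m)]
    exact hj

end FairPath

end FOTL

namespace FOTL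

/-! ### Gluing structures along runs -/

/-- Structures that are linked by a set of runs are quotients of structures with a common domain, the
set of runs. -/
theorem exists_glued {D : ℕ → Type} (M : ∀ n, FOStructure (D n)) (R : Set (∀ n, D n))
    (cs : Finset ℕ) (hsurj : ∀ n (e : D n), ∃ r ∈ R, r n = e)
    (hc : ∀ c ∈ cs, (fun n => (M n).const c) ∈ R) (hne : R.Nonempty) :
    ∃ (X : Type) (I : ℕ → X) (N : ℕ → FOStructure X) (π : ∀ n, X → D n), Nonempty X ∧
      (∀ n, (N n).const = I) ∧ (∀ n, Function.Surjective (π n)) ∧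
      (∀ n p ds, (N n).pred p ds ↔ (M n).pred p (ds.map (π n))) ∧
      (∀ n (φ : FO), φ.consts ⊆ cs → ∀ a, φ.Realize (N n) a ↔ φ.Realize (M n) (π n ∘ a)) ∧
      ∀ x, (fun n => π n x) ∈ R := by
  classical
  obtain ⟨r₀, hr₀⟩ := hne
  -- A constant in `cs` denotes the run of its values; all others may denote the arbitrary run `r₀`,
  -- since only formulae with constants in `cs` are compared.
  let I : ℕ → R := fun c => if h : c ∈ cs then ⟨_, hc c h⟩ else ⟨r₀, hr₀⟩
  have hπ : ∀ n, Function.Surjective (fun x : R => x.1 n) := fun n e => by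
    obtain ⟨r, hr, h⟩ := hsurj n e
    exact ⟨⟨r, hr⟩, h⟩
  refine ⟨R, I, fun n => ⟨fun p ds => (M n).pred p (ds.map fun x => x.1 n), I⟩, fun n x => x.1 n,
    ⟨⟨r₀, hr₀⟩⟩, fun _ => rfl, hπ, fun _ _ _ => Iff.rfl, fun n φ hφ a => ?_, fun x => x.2⟩
  refine FO.realize_pullback _ (hπ n) _ _ (fun _ _ => Iff.rfl) φ (fun c hc' => ?_) a
  simp [I, hφ hc']

/-! ### Completeness of temporal resolution -/

section Complete
open Relation Classical
variable (P : Problem)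

/-- The derived step clauses whose sets of step clauses are sublists, and the ground step clauses. -/
noncomputable def Problem.derivedSteps : List (FO × FO) :=
  ((P.stepN.sublists'.filter (· ≠ [])).map fun s =>
    (.all 0 (disj (s.map fun c => c.1.app [.var 0])), .all 0 (disj (s.map fun c => c.2.app [.var 0])))) ++
  ((P.stepN.sublists'.filter (· ≠ [])).map fun s =>
    (.ex 0 (conj (s.map fun c => c.1.app [.var 0])), .ex 0 (conj (s.map fun c => c.2.app [.var 0])))) ++
  (P.stepN.flatMap fun cl => P.consts.toList.map fun c => (cl.1.app [.const c], cl.2.app [.const c])) ++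
  P.stepG.map fun cl => (cl.1.app [], cl.2.app [])

theorem Problem.derivedStep_of_mem {c : FO × FO} (h : c ∈ P.derivedSteps) :
    DerivedStep P c.1 c.2 := by
  simp only [Problem.derivedSteps, List.mem_append, List.mem_map, List.mem_filter,
    List.mem_sublists', List.mem_flatMap, Finset.mem_toList, decide_eq_true_eq, or_assoc] at h
  rcases h with ⟨s, ⟨hs, h0⟩, rfl⟩ | ⟨s, ⟨hs, h0⟩, rfl⟩ | ⟨cl, hcl, c, hc, rfl⟩ | ⟨cl, hcl, rfl⟩
  · exact .all s hs.subset h0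
  · exact .ex s hs.subset h0
  · exact .const cl hcl c hc
  · exact .ground cl hcl

/-- The merged clause of a list of derived step clauses. -/
def mergeSteps (m : List (FO × FO)) : FO × FO := (conj (m.map Prod.fst), conj (m.map Prod.snd))

/-- The merged clauses of sublists of the derived step clauses. -/
noncomputable def Problem.mergedSteps : List (FO × FO) := P.derivedSteps.sublists'.map mergeSteps

/-- The full merged clause of a list of derived step clauses and a list of step clauses. -/
def mergeFull (m : List (FO × FO)) (s : List (Lit × Lit)) : FullClause :=
  ⟨(mergeSteps m).1, conj (s.map fun d => d.1.app [.var 0]), (mergeSteps m).2,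
    conj (s.map fun d => d.2.app [.var 0])⟩

/-- The full merged clauses of sublists. -/
noncomputable def Problem.fullMergedSteps : List FullClause :=
  P.derivedSteps.sublists'.flatMap fun m => P.stepN.sublists'.map fun s => mergeFull m s

theorem Problem.mergedStep_of_sublist {m : List (FO × FO)} (h : m ⊆ P.derivedSteps) :
    MergedStep P (mergeSteps m).1 (mergeSteps m).2 :=
  ⟨m, fun _ hc => P.derivedStep_of_mem (h hc), rfl, rfl⟩

theorem Problem.mergedStep_of_mem {c : FO × FO} (h : c ∈ P.mergedSteps) :
    MergedStep P c.1 c.2 := by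
  obtain ⟨m, hm, rfl⟩ := List.mem_map.1 h
  exact P.mergedStep_of_sublist (List.mem_sublists'.1 hm).subset

theorem Problem.fullMergedStep_of_mem {c : FullClause} (h : c ∈ P.fullMergedSteps) :
    FullMergedStep P c := by
  obtain ⟨m, hm, h⟩ := List.mem_flatMap.1 h
  obtain ⟨s, hs, rfl⟩ := List.mem_map.1 h
  exact ⟨P.mergedStep_of_sublist (List.mem_sublists'.1 hm).subset, s,
    (List.mem_sublists'.1 hs).subset, rfl, rfl⟩

/-- The conclusions of inferences with the clauses above: a finite set. -/
def Problem.conclusions : Set FO :=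
  {ψ | ψ ∈ P.mergedSteps.map fun c => FO.neg c.1} ∪
  {ψ | ψ ∈ P.fullMergedSteps.sublists'.map fun cs =>
    FO.all 0 (conj (cs.map fun d => .or (.neg d.A) (.neg d.A')))} ∪
  {ψ | ψ ∈ P.mergedSteps.sublists'.map fun cs => conj (cs.map fun d => .neg d.1)}

/-- A derivation that cannot be extended by new conclusions. -/
theorem Problem.exists_saturated :
    ∃ U, Derivation P U ∧ ∀ ψ ∈ P.conclusions, Infers P U ψ → ψ ∈ U := by
  have hfin : P.conclusions.Finite :=
    ((List.finite_toSet _).union (List.finite_toSet _)).union (List.finite_toSet _)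
  -- Take a derivation with the least number of missing conclusions: adding an inferable one that is
  -- missing would lower this number.
  have hex : ∃ k, ∃ U, Derivation P U ∧ (P.conclusions \ {ψ | ψ ∈ U}).ncard = k :=
    ⟨_, _, .start, rfl⟩
  obtain ⟨U, hU, hk⟩ := Nat.find_spec hex
  refine ⟨U, hU, fun ψ hψ hinf => ?_⟩
  by_contra hnot
  have hlt : (P.conclusions \ {χ | χ ∈ ψ :: U}).ncard < Nat.find hex := by
    rw [← hk]
    refine Set.ncard_lt_ncard ⟨fun χ hχ => ⟨hχ.1, fun h => hχ.2 (List.mem_cons_of_mem _ h)⟩,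
      fun h => ?_⟩ (hfin.subset Set.sdiff_subset)
    exact (h ⟨hψ, hnot⟩).2 List.mem_cons_self
  exact Nat.find_min hex hlt ⟨ψ :: U, .extend U ψ hU hinf, rfl⟩

theorem Derivation.subset {P : Problem} {U : List FO} (h : Derivation P U) : P.univ ⊆ U := by
  induction h with
  | start => exact List.Subset.refl _
  | extend U ψ _ _ ih => exact fun φ hφ => List.mem_cons_of_mem _ (ih hφ)

/-- Truth of a literal in a set of predicate names. -/
def Lit.HoldsIn (l : Lit) (t : Set Sym) : Prop := if l.pos then l.sym ∈ t else l.sym ∉ t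

/-- The names of the unary predicates in the step clauses and the eventualities. -/
noncomputable def Problem.unarySyms : Finset Sym :=
  (P.stepN.map (·.1.sym) ++ P.stepN.map (·.2.sym) ++ P.evN.map (·.sym)).toFinset

/-- The type of an element. -/
noncomputable def Problem.typ {D : Type} (M : FOStructure D) (d : D) : Finset Sym :=
  P.unarySyms.filter fun p => M.pred p [d]

/-- Categories: the types that are realised, the types of the constants, the true propositions. -/
structure Cat where
  types : Set (Finset Sym)
  const : ℕ → Finset Sym
  props : Set Sym

/-- The category of a structure. -/
noncomputable def Problem.cat {D : Type} (M : FOStructure D) : Cat :=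
  ⟨Set.range (P.typ M), fun c => P.typ M (M.const c), {p | M.pred p []}⟩

/-- Transitions of types. -/
def Problem.TypeStep (t t' : Finset Sym) : Prop :=
  ∀ c ∈ P.stepN, c.1.HoldsIn ↑t → c.2.HoldsIn ↑t'

/-- Transitions of categories. -/
def Problem.CatStep (s s' : Cat) : Prop :=
  (∀ t ∈ s.types, ∃ t' ∈ s'.types, P.TypeStep t t') ∧
  (∀ t' ∈ s'.types, ∃ t ∈ s.types, P.TypeStep t t') ∧
  (∀ c ∈ P.consts, P.TypeStep (s.const c) (s'.const c)) ∧
  ∀ c ∈ P.stepG, c.1.HoldsIn s.props → c.2.HoldsIn s'.props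

variable {P}

theorem Problem.holdsIn_typ {l : Lit} (hl : l.sym ∈ P.unarySyms) {D : Type} (M : FOStructure D)
    (d : D) : l.HoldsIn ↑(P.typ M d) ↔ l.Holds M [d] := by
  simp [Lit.HoldsIn, Lit.Holds, Problem.typ, hl]

theorem Problem.sym_mem_left {c : Lit × Lit} (hc : c ∈ P.stepN) : c.1.sym ∈ P.unarySyms := by
  simp only [Problem.unarySyms, List.mem_toFinset, List.mem_append, List.mem_map]
  exact Or.inl (Or.inl ⟨c, hc, rfl⟩)

theorem Problem.sym_mem_right {c : Lit × Lit} (hc : c ∈ P.stepN) : c.2.sym ∈ P.unarySyms := by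
  simp only [Problem.unarySyms, List.mem_toFinset, List.mem_append, List.mem_map]
  exact Or.inl (Or.inr ⟨c, hc, rfl⟩)

theorem Problem.sym_mem_ev {L : Lit} (hL : L ∈ P.evN) : L.sym ∈ P.unarySyms := by
  simp only [Problem.unarySyms, List.mem_toFinset, List.mem_append, List.mem_map]
  exact Or.inr ⟨L, hL, rfl⟩

theorem Problem.typeStep_iff {D D' : Type} (M : FOStructure D) (M' : FOStructure D') (d : D)
    (d' : D') : P.TypeStep (P.typ M d) (P.typ M' d') ↔
      ∀ c ∈ P.stepN, c.1.Holds M [d] → c.2.Holds M' [d'] :=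
  forall₂_congr fun c hc => by
    rw [Problem.holdsIn_typ (Problem.sym_mem_left hc), Problem.holdsIn_typ (Problem.sym_mem_right hc)]

variable (P) in
/-- The derived step clauses whose left-hand sides are true. -/
noncomputable def Problem.trueSteps {D : Type} (M : FOStructure D) (a : ℕ → D) : List (FO × FO) :=
  P.derivedSteps.filter fun c => c.1.Realize M a

variable (P) in
/-- The step clauses whose left-hand sides are true of an element. -/
noncomputable def Problem.trueStepsAt {D : Type} (M : FOStructure D) (d : D) : List (Lit × Lit) :=
  P.stepN.filter fun c => c.1.Holds M [d]

theorem Problem.realize_trueSteps {D : Type} (M : FOStructure D) (a : ℕ → D) :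
    (mergeSteps (P.trueSteps M a)).1.Realize M a := by
  simp only [mergeSteps, realize_conj, List.forall_mem_map, Problem.trueSteps, List.mem_filter,
    decide_eq_true_eq]
  exact fun c hc => hc.2

/-- The merged clause of all derived clauses with true left-hand sides controls the successor
category completely. Existential clauses provide successors of types, universal ones predecessors,
and the instances at constants and the ground clauses do the rest. -/
theorem Problem.catStep_of_realize {D D' : Type} {M : FOStructure D} {M' : FOStructure D'}
    {a : ℕ → D} {a' : ℕ → D'} (h : (mergeSteps (P.trueSteps M a)).2.Realize M' a') :
    P.CatStep (P.cat M) (P.cat M') := by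
  have key : ∀ c ∈ P.derivedSteps, c.1.Realize M a → c.2.Realize M' a' := by
    simp only [mergeSteps, realize_conj, List.forall_mem_map, Problem.trueSteps, List.mem_filter,
      decide_eq_true_eq] at h
    exact fun c hc hc' => h c ⟨hc, hc'⟩
  simp only [Problem.derivedSteps, List.forall_mem_append, List.mem_filter, List.mem_sublists',
    decide_eq_true_eq, List.mem_flatMap, List.mem_map, Finset.mem_toList] at key
  obtain ⟨⟨⟨hall, hex⟩, hconst⟩, hground⟩ := key
  refine ⟨?_, ?_, fun c hc => ?_, fun cl hcl h => ?_⟩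
  · rintro _ ⟨d, rfl⟩
    -- Derived clauses come from nonempty sets. If no step clause applies to `d`, any element is a
    -- successor; otherwise the existential clause for exactly the applicable step clauses provides
    -- one.
    rcases eq_or_ne (P.trueStepsAt M d) [] with h0 | h0
    · refine ⟨_, ⟨a' 0, rfl⟩, (Problem.typeStep_iff _ _ _ _).2 fun c hc hd => ?_⟩
      have : c ∈ P.trueStepsAt M d := List.mem_filter.2 ⟨hc, by simpa using hd⟩
      simp [h0] at this
    · obtain ⟨d', hd'⟩ := hex _ ⟨P.trueStepsAt M d, ⟨List.filter_sublist, h0⟩, rfl⟩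
        ⟨d, (realize_conj _ _ _).2 (List.forall_mem_map.2 fun c hc => by
          rw [Lit.realize_app]
          simpa [Term.eval] using (List.mem_filter.1 hc).2)⟩
      refine ⟨_, ⟨d', rfl⟩, (Problem.typeStep_iff _ _ _ _).2 fun c hc hd => ?_⟩
      have := (realize_conj _ _ _).1 hd' _
        (List.mem_map.2 ⟨c, List.mem_filter.2 ⟨hc, by simpa using hd⟩, rfl⟩)
      rw [Lit.realize_app] at this
      simpa [Term.eval] using this
  · rintro _ ⟨d', rfl⟩
    by_contra! hno
    have hno' : ∀ d, ∃ c ∈ P.stepN, c.1.Holds M [d] ∧ ¬ c.2.Holds M' [d'] := by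
      intro d
      have := hno _ ⟨d, rfl⟩
      rw [Problem.typeStep_iff] at this
      push Not at this
      exact this
    -- If `d'` has no predecessor, every `d` satisfies the left-hand side of a step clause whose
    -- right-hand side fails at `d'`. The universal clause for all clauses that fail at `d'` then
    -- says that one of them does not fail there.
    let s := P.stepN.filter fun c => ¬ c.2.Holds M' [d']
    have hs0 : s ≠ [] := by
      obtain ⟨c, hc, -, h⟩ := hno' (a 0)
      exact List.ne_nil_of_mem (List.mem_filter.2 ⟨hc, by simpa using h⟩)
    have := hall _ ⟨s, ⟨List.filter_sublist, hs0⟩, rfl⟩ (fun d => by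
      obtain ⟨c, hc, h, h'⟩ := hno' d
      refine (realize_disj _ _ _).2 ⟨_, List.mem_map.2 ⟨c, List.mem_filter.2 ⟨hc, by simpa using h'⟩,
        rfl⟩, ?_⟩
      rw [Lit.realize_app]
      simpa [Term.eval] using h) d'
    obtain ⟨φ, hφ, h⟩ := (realize_disj _ _ _).1 this
    obtain ⟨c, hc, rfl⟩ := List.mem_map.1 hφ
    rw [Lit.realize_app] at h
    have h' := (List.mem_filter.1 hc).2
    simp only [decide_eq_true_eq] at h'
    exact h' (by simpa [Term.eval] using h)
  · refine (Problem.typeStep_iff _ _ _ _).2 fun cl hcl h => ?_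
    have := hconst _ ⟨cl, hcl, c, hc, rfl⟩
    simp only [Lit.realize_app] at this
    exact this h
  · have := hground _ ⟨cl, hcl, rfl⟩
    simp only [Lit.realize_app] at this
    exact this h

variable (P) in
/-- The categories of the models of `U`. -/
def Problem.cats (U : List FO) : Set Cat :=
  {s | ∃ (D : Type) (M : FOStructure D) (a : ℕ → D), (∀ φ ∈ U, φ.Realize M a) ∧ P.cat M = s}

/-! ### Consequences of saturation: successors and reachable eventualities -/

section
variable {U : List FO} (hU : ∀ ψ ∈ P.conclusions, Infers P U ψ → ψ ∈ U)

theorem Problem.mem_mergedSteps {D : Type} (M : FOStructure D) (a : ℕ → D) :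
    mergeSteps (P.trueSteps M a) ∈ P.mergedSteps :=
  List.mem_map.2 ⟨_, List.mem_sublists'.2 List.filter_sublist, rfl⟩

theorem Problem.mem_fullMergedSteps {D : Type} (M : FOStructure D) (a : ℕ → D) (d : D) :
    mergeFull (P.trueSteps M a) (P.trueStepsAt M d) ∈ P.fullMergedSteps :=
  List.mem_flatMap.2 ⟨_, List.mem_sublists'.2 List.filter_sublist,
    List.mem_map.2 ⟨_, List.mem_sublists'.2 List.filter_sublist, rfl⟩⟩

include hU in
-- If the merged clause of the true derived clauses had an inconsistent right-hand side, the step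
-- rule would put the negation of its left-hand side into `U`, although that side is true in the
-- given model of `U`.
theorem Problem.exists_stateStep {s : Cat} (hs : s ∈ P.cats U) :
    ∃ s', StateStep P.CatStep (P.cats U) s s' := by
  obtain ⟨D, M, a, hM, rfl⟩ := hs
  have hmem := P.mem_mergedSteps M a
  by_cases hB : Entails ((mergeSteps (P.trueSteps M a)).2 :: U) .falsum
  · have := hM _ (hU _ (Or.inl (Or.inl (List.mem_map.2 ⟨_, hmem, rfl⟩)))
      (.step _ _ (P.mergedStep_of_mem hmem) hB))
    exact (this (Problem.realize_trueSteps M a)).elim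
  · simp only [Entails, not_forall] at hB
    obtain ⟨D', M', a', hM', -⟩ := hB
    exact ⟨P.cat M', ⟨D', M', a', fun φ hφ => hM' φ (List.mem_cons_of_mem _ hφ), rfl⟩,
      Problem.catStep_of_realize (hM' _ List.mem_cons_self)⟩

include hU in
-- Suppose `l` were unreachable, and collect the merged clauses of all reachable models of `U`. A
-- model of `U` and of one of their right-hand sides is again reachable, so it falsifies `l` and
-- satisfies a left-hand side from the collection. The rule applies, and its conclusion is false in
-- the starting model.
theorem Problem.exists_reach_ground {s : Cat} (hs : s ∈ P.cats U) {l : Lit} (hl : l ∈ P.evG) :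
    ∃ s', ReflTransGen (StateStep P.CatStep (P.cats U)) s s' ∧ l.HoldsIn s'.props := by
  by_contra! hno
  let p : FO × FO → Prop := fun c => ∃ (D : Type) (M : FOStructure D) (a : ℕ → D),
    (∀ φ ∈ U, φ.Realize M a) ∧ ReflTransGen (StateStep P.CatStep (P.cats U)) s (P.cat M) ∧
      c = mergeSteps (P.trueSteps M a)
  -- There may be infinitely many reachable models, but all their merged clauses come from one
  -- finite list.
  let cs := P.mergedSteps.filter fun c => p c
  have hcs : ∀ c ∈ cs, p c := fun c hc => by simpa using (List.mem_filter.1 hc).2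
  have hnext : ∀ c ∈ cs, ∀ (D : Type) (M : FOStructure D) (a : ℕ → D), (∀ φ ∈ U, φ.Realize M a) →
      c.2.Realize M a → ReflTransGen (StateStep P.CatStep (P.cats U)) s (P.cat M) := by
    intro c hc D M a hM hB
    obtain ⟨D', M', a', hM', hr, rfl⟩ := hcs c hc
    exact hr.tail ⟨⟨D, M, a, hM, rfl⟩, Problem.catStep_of_realize hB⟩
  have hmem : ∀ (D : Type) (M : FOStructure D) (a : ℕ → D), (∀ φ ∈ U, φ.Realize M a) →
      ReflTransGen (StateStep P.CatStep (P.cats U)) s (P.cat M) →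
      mergeSteps (P.trueSteps M a) ∈ cs := fun D M a hM hr =>
    List.mem_filter.2 ⟨P.mem_mergedSteps M a, by simpa using ⟨D, M, a, hM, hr, rfl⟩⟩
  have hinf : Infers P U (conj (cs.map fun d => .neg d.1)) := by
    refine .groundEventuality l hl cs (fun c hc => P.mergedStep_of_mem (List.mem_filter.1 hc).1)
      (fun c hc D M a hM hB => ?_) fun c hc D M a hM hB => ?_
    · rw [FO.Realize, Lit.realize_app]
      exact hno _ (hnext c hc D M a hM hB)
    · exact (realize_disj _ _ _).2 ⟨_, List.mem_map.2 ⟨_, hmem D M a hM (hnext c hc D M a hM hB),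
        rfl⟩, Problem.realize_trueSteps M a⟩
  obtain ⟨D, M, a, hM, rfl⟩ := hs
  have := hM _ (hU _ (Or.inr (List.mem_map.2 ⟨cs, List.mem_sublists'.2 List.filter_sublist, rfl⟩))
    hinf)
  rw [realize_conj, List.forall_mem_map] at this
  exact this _ (hmem D M a hM .refl) (Problem.realize_trueSteps M a)

theorem Problem.realize_trueStepsAt {D : Type} (M : FOStructure D) (a : ℕ → D) :
    (conj ((P.trueStepsAt M (a 0)).map fun d => d.1.app [.var 0])).Realize M a := by
  rw [realize_conj, List.forall_mem_map]
  intro c hc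
  rw [Lit.realize_app]
  simpa [Term.eval] using (List.mem_filter.1 hc).2

theorem Problem.typeStep_of_realize {D D' : Type} {M : FOStructure D} {M' : FOStructure D'} {d : D}
    {a' : ℕ → D'}
    (h : (conj ((P.trueStepsAt M d).map fun d => d.2.app [.var 0])).Realize M' a') :
    P.TypeStep (P.typ M d) (P.typ M' (a' 0)) := by
  rw [realize_conj, List.forall_mem_map] at h
  refine (Problem.typeStep_iff _ _ _ _).2 fun c hc hd => ?_
  have := h c (List.mem_filter.2 ⟨hc, by simpa using hd⟩)
  rw [Lit.realize_app] at this
  simpa [Term.eval] using this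

/-- Left-hand sides of derived clauses are closed; this leaves variable `0` free to denote the
element followed by full merged clauses. -/
theorem DerivedStep.realize_congr {A B : FO} (h : DerivedStep P A B) {D : Type} (M : FOStructure D)
    (a b : ℕ → D) : A.Realize M a ↔ A.Realize M b := by
  cases h <;> simp only [FO.Realize, realize_conj, realize_disj, List.mem_map,
    exists_exists_and_eq_and, forall_exists_index, and_imp, forall_apply_eq_imp_iff₂, Lit.realize_app, List.map_cons, List.map_nil, Term.eval,
    Function.update_self]

theorem Problem.realize_trueSteps_congr {D : Type} (M : FOStructure D) (a b : ℕ → D) :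
    (mergeSteps (P.trueSteps M a)).1.Realize M b := by
  simp only [mergeSteps, realize_conj, List.forall_mem_map, Problem.trueSteps, List.mem_filter,
    decide_eq_true_eq]
  exact fun c hc => ((P.derivedStep_of_mem hc.1).realize_congr M a b).1 hc.2

include hU in
-- The loop argument for ground eventualities, carried out for pairs of a category and a type: the
-- full merged clauses of all reachable pairs meet the conditions of the eventuality rule.
theorem Problem.exists_reach {s : Cat} (hs : s ∈ P.cats U) {t : Finset Sym} (ht : t ∈ s.types)
    {L : Lit} (hL : L ∈ P.evN) :
    ∃ y, ReflTransGen (PairStep Cat.types P.CatStep P.TypeStep (P.cats U)) (s, t) y ∧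
      L.HoldsIn ↑y.2 := by
  by_contra! hno
  let r : ∀ {D : Type}, FOStructure D → D → Prop := fun M d =>
    ReflTransGen (PairStep Cat.types P.CatStep P.TypeStep (P.cats U)) (s, t) (P.cat M, P.typ M d)
  let p : FullClause → Prop := fun c => ∃ (D : Type) (M : FOStructure D) (a : ℕ → D) (d : D),
    (∀ φ ∈ U, φ.Realize M a) ∧ r M d ∧ c = mergeFull (P.trueSteps M a) (P.trueStepsAt M d)
  let cs := P.fullMergedSteps.filter fun c => p c
  have hcs : ∀ c ∈ cs, p c := fun c hc => by simpa using (List.mem_filter.1 hc).2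
  have hnext : ∀ c ∈ cs, ∀ (D : Type) (M : FOStructure D) (a : ℕ → D) (d : D),
      (∀ φ ∈ U, φ.Realize M a) → (FO.and c.B c.B').Realize M (Function.update a 0 d) → r M d := by
    intro c hc D M a d hM hB
    obtain ⟨D', M', a', d', hM', hr, rfl⟩ := hcs c hc
    refine hr.tail ⟨⟨D, M, a, hM, rfl⟩, Problem.catStep_of_realize hB.1, ⟨_, rfl⟩, ?_⟩
    simpa using Problem.typeStep_of_realize hB.2
  have hmem : ∀ (D : Type) (M : FOStructure D) (a : ℕ → D) (d : D), (∀ φ ∈ U, φ.Realize M a) →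
      r M d → mergeFull (P.trueSteps M a) (P.trueStepsAt M d) ∈ cs := fun D M a d hM hr =>
    List.mem_filter.2 ⟨P.mem_fullMergedSteps M a d, by simpa using ⟨D, M, a, d, hM, hr, rfl⟩⟩
  have htrue : ∀ (D : Type) (M : FOStructure D) (a : ℕ → D) (d : D),
      (mergeFull (P.trueSteps M a) (P.trueStepsAt M d)).A.Realize M (Function.update a 0 d) ∧
      (mergeFull (P.trueSteps M a) (P.trueStepsAt M d)).A'.Realize M (Function.update a 0 d) :=
    fun D M a d => ⟨Problem.realize_trueSteps_congr M _ _,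
      by simpa [mergeFull] using Problem.realize_trueStepsAt M (Function.update a 0 d)⟩
  have hinf : Infers P U (.all 0 (conj (cs.map fun d => .or (.neg d.A) (.neg d.A')))) := by
    refine .eventuality L hL cs (fun c hc => P.fullMergedStep_of_mem (List.mem_filter.1 hc).1)
      (fun c hc D M a hM d hB => ?_) fun c hc D M a hM d hB => ?_
    · rw [FO.Realize, Lit.realize_app]
      have := hno _ (hnext c hc D M a d hM hB)
      rw [Problem.holdsIn_typ (Problem.sym_mem_ev hL)] at this
      simpa [Term.eval] using this
    · exact (realize_disj _ _ _).2 ⟨_, List.mem_map.2 ⟨_, hmem D M a d hM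
        (hnext c hc D M a d hM hB), rfl⟩, htrue D M a d⟩
  obtain ⟨D, M, a, hM, rfl⟩ := hs
  obtain ⟨d, rfl⟩ := ht
  have := hM _ (hU _ (Or.inl (Or.inr (List.mem_map.2 ⟨cs, List.mem_sublists'.2 List.filter_sublist,
    rfl⟩))) hinf) d
  rw [realize_conj, List.forall_mem_map] at this
  rcases this _ (hmem D M a d hM .refl) with h | h
  · exact h (htrue D M a d).1
  · exact h (htrue D M a d).2

end

/-- This makes the finite sets of symbols, hence the types, countable, as the generic path
construction requires. -/
instance : Countable Sym := Sym.code_injective.countable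

/-- A temporal problem that is not refutable has a model, if the eventualities of the constants are
among the ground eventualities. -/
theorem Problem.exists_model (P : Problem) (hcl : ∀ φ ∈ P.univ, φ.Closed)
    (hflood : ∀ L ∈ P.evN, ∀ c ∈ P.consts, ∃ l ∈ P.evG,
      FO.imp (l.app []) (L.app [.const c]) ∈ P.univ)
    (h : ¬ P.Refutable) :
    ∃ (X : Type) (I : ℕ → X) (N : ℕ → FOStructure X), Nonempty X ∧ (∀ n, (N n).const = I) ∧
      P.Holds N ∧ ∃ a, ∀ φ ∈ P.init, φ.Realize (N 0) a := by
  obtain ⟨U, hder, hU⟩ := P.exists_saturated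
  have hsub := hder.subset
  have hsat : ¬ Entails (U ++ P.init) .falsum := fun h' => h ⟨U, hder, Or.inl h'⟩
  simp only [Entails, not_forall] at hsat
  obtain ⟨D₀, M₀, a₀, hM₀, -⟩ := hsat
  have hfwd : ∀ s s', P.CatStep s s' → ∀ t ∈ s.types, ∃ t' ∈ s'.types, P.TypeStep t t' :=
    fun s s' h => h.1
  have hbwd : ∀ s s', P.CatStep s s' → ∀ t' ∈ s'.types, ∃ t ∈ s.types, P.TypeStep t t' :=
    fun s s' h => h.2.1
  obtain ⟨f, hf0, hfK, hfE, hfG, hfL⟩ := exists_fair_path (Γ := Cat.types) (E := P.TypeStep)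
    (Edge := P.CatStep) (K := P.cats U) (s₀ := P.cat M₀)
    (fun (j : Fin P.evG.length) s => (P.evG.get j).HoldsIn s.props)
    (fun (j : Fin P.evN.length) t => (P.evN.get j).HoldsIn ↑t)
    ⟨D₀, M₀, a₀, fun φ hφ => hM₀ φ (List.mem_append_left _ hφ), rfl⟩
    (fun s hs => Problem.exists_stateStep hU hs) hfwd
    (fun s hs j => Problem.exists_reach_ground hU hs (List.get_mem _ _))
    (fun s hs t ht j => Problem.exists_reach hU hs ht (List.get_mem _ _))
  -- At moment `0` the model `M₀` itself is kept, because the initial part is not determined by the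
  -- category.
  have hmod : ∀ n, ∃ (D : Type) (M : FOStructure D) (a : ℕ → D), (∀ φ ∈ U, φ.Realize M a) ∧
      P.cat M = f n ∧ (n = 0 → ∀ φ ∈ P.init, φ.Realize M a) := by
    intro n
    rcases eq_or_ne n 0 with rfl | hn
    · exact ⟨D₀, M₀, a₀, fun φ hφ => hM₀ φ (List.mem_append_left _ hφ), hf0.symm,
        fun _ φ hφ => hM₀ φ (List.mem_append_right _ hφ)⟩
    · obtain ⟨D, M, a, hM, hc⟩ := hfK n
      exact ⟨D, M, a, hM, hc, fun h => (hn h).elim⟩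
  choose D M a hM hcat hinit using hmod
  -- The universal part is known under one chosen assignment only; as it is closed, it is true under
  -- all.
  have hM' : ∀ n, ∀ φ ∈ P.univ, ∀ b, φ.Realize (M n) b := fun n φ hφ b =>
    ((hcl φ hφ).realize_iff _ _ _).1 (hM n φ (hsub hφ))
  -- Runs are sequences of elements of the chosen models, not of types; they become the elements of
  -- the final domain.
  let R : Set (∀ n, D n) := {e | (∀ n, P.TypeStep (P.typ (M n) (e n)) (P.typ (M (n + 1)) (e (n + 1)))) ∧
    ∀ L ∈ P.evN, ∀ n, ∃ m ≥ n, L.Holds (M m) [e m]}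
  have hsurj : ∀ n (e : D n), ∃ r ∈ R, r n = e := by
    intro n e
    have he : P.typ (M n) e ∈ (f n).types := by rw [← hcat n]; exact ⟨e, rfl⟩
    obtain ⟨g, hgn, hgm, hgE, hgL⟩ := exists_run (Γ := Cat.types)
      (E := P.TypeStep) (fun (j : Fin P.evN.length) (t : Finset Sym) => (P.evN.get j).HoldsIn ↑t) f hfwd hbwd hfE hfL n _ he
    have hex : ∀ i, ∃ d : D i, P.typ (M i) d = g i := fun i => by
      have := hgm i
      rw [← hcat i] at this
      exact this
    choose r hr using hex
    -- Replacing the entry at `n` by the prescribed `e` does not disturb the run, since both have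
    -- type `g n`.
    have hr' : ∀ i, P.typ (M i) (Function.update r n e i) = g i := by
      intro i
      rcases eq_or_ne i n with rfl | hi
      · simp [hgn]
      · rw [Function.update_of_ne hi, hr]
    refine ⟨Function.update r n e, ⟨fun i => ?_, fun L hL i => ?_⟩, by simp⟩
    · rw [hr', hr']; exact hgE i
    · obtain ⟨j, rfl⟩ := List.get_of_mem hL
      obtain ⟨m, hm, h'⟩ := hgL j i
      refine ⟨m, hm, ?_⟩
      rwa [← hr' m, Problem.holdsIn_typ (Problem.sym_mem_ev hL)] at h'
  have hG : ∀ l ∈ P.evG, ∀ n, ∃ m ≥ n, l.Holds (M m) [] := by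
    intro l hl n
    obtain ⟨j, rfl⟩ := List.get_of_mem hl
    obtain ⟨m, hm, h'⟩ := hfG j n
    rw [← hcat m] at h'
    exact ⟨m, hm, h'⟩
  have hstep : ∀ n, P.CatStep (P.cat (M n)) (P.cat (M (n + 1))) := fun n => by
    rw [hcat, hcat]; exact hfE n
  -- This is where flooding is used: the ground eventuality for `L` and `c` recurs and each time
  -- forces `L` at the value of `c`, so the values of `c` form a run.
  have hconst : ∀ c ∈ P.consts, (fun n => (M n).const c) ∈ R := by
    refine fun c hc => ⟨fun n => (hstep n).2.2.1 c hc, fun L hL n => ?_⟩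
    obtain ⟨l, hl, hi⟩ := hflood L hL c hc
    obtain ⟨m, hm, h'⟩ := hG l hl n
    refine ⟨m, hm, ?_⟩
    have := hM' m _ hi (a m)
    simp only [FO.Realize, Lit.realize_app] at this
    exact this h'
  obtain ⟨r₀, hr₀, -⟩ := hsurj 0 (a 0 0)
  obtain ⟨X, I, N, π, hX, hI, hπ, hpred, hreal, hrun⟩ :=
    exists_glued M R P.consts hsurj hconst ⟨r₀, hr₀⟩
  have hlit : ∀ (l : Lit) n ds, l.Holds (N n) ds ↔ l.Holds (M n) (ds.map (π n)) := fun l n ds => by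
    simp only [Lit.Holds, hpred]
  have hcu : ∀ φ ∈ P.univ, φ.consts ⊆ P.consts := fun φ hφ c hc =>
    (P.mem_consts c).2 ⟨φ, Or.inl hφ, hc⟩
  have hci : ∀ φ ∈ P.init, φ.consts ⊆ P.consts := fun φ hφ c hc =>
    (P.mem_consts c).2 ⟨φ, Or.inr hφ, hc⟩
  refine ⟨X, I, N, hX, hI, ⟨fun φ hφ n b => ?_, fun c hc n h => ?_, fun c hc n x h => ?_,
    fun l hl n => ?_, fun L hL n x => ?_⟩, ?_⟩
  · exact (hreal n φ (hcu φ hφ) b).2 (hM' n φ hφ _)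
  · rw [hlit] at h ⊢
    exact (hstep n).2.2.2 c hc h
  · rw [hlit] at h ⊢
    exact (Problem.typeStep_iff _ _ _ _).1 ((hrun x).1 n) c hc h
  · simpa only [hlit, List.map_nil] using hG l hl n
  · simpa only [hlit, List.map_cons, List.map_nil] using (hrun x).2 L hL n
  · choose b hb using fun i => hπ 0 (a 0 i)
    refine ⟨b, fun φ hφ => (hreal 0 φ (hci φ hφ) b).2 ?_⟩
    have : π 0 ∘ b = a 0 := funext hb
    rw [this]
    exact hinit 0 rfl φ hφ

end Complete

end FOTL

namespace FOTL

/-! ### The normal form has a closed universal part -/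

/-- All formulae in the universal part are closed. -/
def Problem.UnivClosed (P : Problem) : Prop := ∀ φ ∈ P.univ, φ.Closed

theorem Problem.univClosed_union (l : List Problem) (h : ∀ P ∈ l, P.UnivClosed) :
    (Problem.union l).UnivClosed := by
  induction l with
  | nil => intro φ hφ; simp [Problem.union, Problem.empty] at hφ
  | cons P l ih =>
    intro φ hφ
    rcases List.mem_append.1 (show φ ∈ P.univ ++ (Problem.union l).univ from hφ) with hφ | hφ
    · exact h P List.mem_cons_self φ hφ
    · exact ih (fun Q hQ => h Q (List.mem_cons_of_mem _ hQ)) φ hφ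

theorem TFormula.univClosed_univClause {χ : TFormula} (hχ : χ.fv.card ≤ 1) {θ : FO}
    (hθ : θ.fv ⊆ χ.fv) : (χ.univClause θ).UnivClosed := by
  intro φ hφ
  simp only [TFormula.univClause, List.mem_singleton] at hφ
  subst hφ
  split_ifs with h
  · rw [h] at hθ; exact Finset.subset_empty.1 hθ
  · refine Finset.eq_empty_of_forall_notMem fun x hx => ?_
    obtain ⟨hne, hx⟩ := Finset.mem_erase.1 hx
    exact hne (TFormula.fvar_eq hχ (hθ hx)).symm

theorem TFormula.univClosed_stepClause (χ : TFormula) (s t : Sym) :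
    (χ.stepClause s t).UnivClosed := by
  unfold TFormula.stepClause
  split_ifs <;> intro φ hφ <;> simp [Problem.empty] at hφ

theorem TFormula.univClosed_evNeg (χ : TFormula) (s : Sym) : (χ.evNeg s).UnivClosed := by
  unfold TFormula.evNeg
  split_ifs <;> intro φ hφ <;> simp [Problem.empty] at hφ

section
variable {χ : TFormula} (hχ : χ.fv.card ≤ 1)
include hχ

theorem TFormula.fv_at (s : Sym) : (χ.at s).fv = χ.fv := TFormula.fv_params χ hχ

theorem TFormula.univClosed_nameClause {ψ : TFormula} (hψ : ψ.Monodic) (h : ψ.fv ⊆ χ.fv) :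
    (χ.nameClause ψ).UnivClosed :=
  TFormula.univClosed_univClause hχ (by
    simp only [FO.fv, TFormula.fv_at hχ, TFormula.fv_bar ψ hψ]
    exact Finset.union_subset (Finset.Subset.refl _) h)

theorem TFormula.univClosed_sometimeClauses (q t : Sym) : (χ.sometimeClauses q t).UnivClosed := by
  refine Problem.univClosed_union _ ?_
  simp only [List.forall_mem_cons]
  refine ⟨TFormula.univClosed_univClause hχ ?_, TFormula.univClosed_stepClause _ _ _,
    TFormula.univClosed_univClause hχ ?_, TFormula.univClosed_evNeg _ _, by simp⟩ <;>
  simp [FO.fv, TFormula.fv_at hχ]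

theorem TFormula.univClosed_alwaysClauses (q t : Sym) : (χ.alwaysClauses q t).UnivClosed := by
  refine Problem.univClosed_union _ ?_
  simp only [List.forall_mem_cons]
  refine ⟨TFormula.univClosed_univClause hχ ?_, TFormula.univClosed_stepClause _ _ _,
    TFormula.univClosed_univClause hχ ?_, by simp⟩ <;>
  simp [FO.fv, TFormula.fv_at hχ]

theorem TFormula.univClosed_untilClauses (q s t : Sym) : (χ.untilClauses q s t).UnivClosed := by
  refine Problem.univClosed_union _ ?_
  simp only [List.forall_mem_cons]
  refine ⟨TFormula.univClosed_sometimeClauses hχ q t, TFormula.univClosed_univClause hχ ?_,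
    TFormula.univClosed_univClause hχ ?_, TFormula.univClosed_stepClause _ _ _,
    TFormula.univClosed_univClause hχ ?_, TFormula.univClosed_univClause hχ ?_, by simp⟩ <;>
  simp [FO.fv, TFormula.fv_at hχ]

theorem TFormula.univClosed_clauses (hm : χ.Monodic) : χ.clauses.UnivClosed := by
  have hname : ∀ ψ ∈ χ.temporalArgs, (χ.nameClause ψ).UnivClosed := fun ψ hψ =>
    TFormula.univClosed_nameClause hχ (TFormula.monodic_temporalArgs hm hψ)
      (TFormula.fv_temporalArgs hψ)
  cases χ with
  | verum | falsum | atom | neg | and | or | imp | iff | all | ex =>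
    intro φ hφ; simp [TFormula.clauses, Problem.empty] at hφ
  | next ψ =>
    refine Problem.univClosed_union _ ?_
    simp only [List.forall_mem_cons]
    exact ⟨hname ψ (by simp [TFormula.temporalArgs]), TFormula.univClosed_stepClause _ _ _, by simp⟩
  | always ψ =>
    refine Problem.univClosed_union _ ?_
    simp only [List.forall_mem_cons]
    exact ⟨hname ψ (by simp [TFormula.temporalArgs]), TFormula.univClosed_alwaysClauses hχ _ _,
      by simp⟩
  | sometime ψ =>
    refine Problem.univClosed_union _ ?_
    simp only [List.forall_mem_cons]
    exact ⟨hname ψ (by simp [TFormula.temporalArgs]), TFormula.univClosed_sometimeClauses hχ _ _,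
      by simp⟩
  | wuntil ψ₁ ψ₂ =>
    refine Problem.univClosed_union _ ?_
    simp only [List.forall_mem_cons]
    refine ⟨hname ψ₁ (by simp [TFormula.temporalArgs]), hname ψ₂ (by simp [TFormula.temporalArgs]),
      TFormula.univClosed_univClause hχ (by simp [FO.fv, TFormula.fv_at hχ]),
      TFormula.univClosed_untilClauses hχ _ _ _, TFormula.univClosed_alwaysClauses hχ _ _, by simp⟩
  | _ ψ₁ ψ₂ =>
    refine Problem.univClosed_union _ ?_
    simp only [List.forall_mem_cons]
    exact ⟨hname ψ₁ (by simp [TFormula.temporalArgs]), hname ψ₂ (by simp [TFormula.temporalArgs]),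
      TFormula.univClosed_untilClauses hχ _ _ _, by simp⟩

end

theorem TFormula.univClosed_dsnf {φ : TFormula} (hφ : φ.Monodic) : φ.dsnf.UnivClosed := by
  have h : (Problem.union (φ.temporalSubs.map TFormula.clauses)).UnivClosed :=
    Problem.univClosed_union _ (List.forall_mem_map.2 fun χ hχ => by
      obtain ⟨-, h, h'⟩ := TFormula.monodic_of_mem_temporalSubs hφ hχ
      exact TFormula.univClosed_clauses h h')
  exact fun ψ hψ => h ψ (by simpa [TFormula.dsnf, Problem.append, Problem.empty] using hψ)

theorem Problem.UnivClosed.flooded {P : Problem} (h : P.UnivClosed) : P.flooded.UnivClosed := by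
  intro φ hφ
  rcases (P.mem_flooded_univ φ).1 hφ with hφ | ⟨L, -, c, -, rfl⟩
  · exact h φ hφ
  · rcases L with ⟨_ | _, s⟩ <;> simp [FO.Closed, FO.fv, Lit.app, Term.fv]

/-- Temporal resolution is sound and complete for monodic formulae in negation normal form. -/
theorem TFormula.not_satisfiable_iff_refutable {φ : TFormula} (hm : φ.Monodic) (hn : φ.NNF) :
    ¬ φ.Satisfiable ↔ φ.dsnf.flooded.Refutable := by
  constructor
  · intro h
    by_contra hr
    obtain ⟨X, I, N, hX, hI, hN, a, h0⟩ := Problem.exists_model φ.dsnf.flooded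
      (TFormula.univClosed_dsnf hm).flooded (fun L hL c hc => by
        rw [Problem.consts_flooded] at hc
        exact ⟨_, (Problem.mem_flooded_evG _ _).2 (Or.inr ⟨L, hL, c, hc, rfl⟩),
          (Problem.mem_flooded_univ _ _).2 (Or.inr ⟨L, hL, c, hc, rfl⟩)⟩) hr
    exact h (TFormula.satisfiable_of_holds hI hn (Problem.holds_of_flooded hN) h0)
  · intro hr h
    obtain ⟨D, I, N, hI, hN, h0⟩ := TFormula.holds_of_satisfiable hm h
    exact Problem.not_refutable hI hN h0 hr

end FOTL

namespace FOTL

/-! ### A combinatorial criterion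

A type is a list of codes of atoms, a category is a list of types.  A record `(b, e, q, s, t)`
stands for `q → ○ s` if `b` is true, and otherwise for `q → t ∨ (s ∧ ○ q)`, together with
`□ (q → ◇ t)` if `e` is true. -/

/-- Records. -/
abbrev Record : Type := Bool × Bool × ℕ × ℕ × ℕ

/-- Transitions of types. -/
def stepB (R : List Record) (t t' : List ℕ) : Bool :=
  R.all fun r => !t.contains r.2.2.1 || cond r.1 (t'.contains r.2.2.2.1)
    (t.contains r.2.2.2.2 || (t.contains r.2.2.2.1 && t'.contains r.2.2.1))

/-- Transitions of categories. -/
def edgeB (R : List Record) (Γ Γ' : List (List ℕ)) : Bool :=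
  (Γ.all fun t => Γ'.any fun t' => stepB R t t') && Γ'.all fun t' => Γ.any fun t => stepB R t t'

/-- The eventuality of a record is fulfilled at a type. -/
def goalB (r : Record) (t : List ℕ) : Bool :=
  !r.2.1 || (!t.contains r.2.2.1 || t.contains r.2.2.2.2)

/-- The pairs of a category in `K` and a type in it. -/
def pointed (K : List (List (List ℕ))) : List (List (List ℕ) × List ℕ) :=
  K.flatMap fun Γ => Γ.map fun t => (Γ, t)

/-- `Z` is closed under transitions of pairs. -/
def closedB (R : List Record) (K : List (List (List ℕ))) (Z : List (List (List ℕ) × List ℕ)) : Bool :=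
  Z.all fun x => K.all fun Γ => !edgeB R x.1 Γ || Γ.all fun t => !stepB R x.2 t || Z.contains (Γ, t)

/-- The eventuality of `r` can be fulfilled from the pair `x`. -/
def reachB (R : List Record) (K : List (List (List ℕ))) (x : List (List ℕ) × List ℕ) (r : Record) :
    Bool :=
  (pointed K).sublists'.all fun Z =>
    !Z.contains x || (!closedB R K Z || Z.any fun y => goalB r y.2)

/-- Every category in `K` has a successor, and from every pair all eventualities can be fulfilled. -/
def goodB (R : List Record) (K : List (List (List ℕ))) : Bool :=
  K.all fun Γ => (K.any fun Γ' => edgeB R Γ Γ') && Γ.all fun t => R.all fun r => reachB R K (Γ, t) r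

/-- There is a good set of categories in `A₁` that contains a member of `A₂`. -/
def decideB (R : List Record) (A₁ A₂ : List (List (List ℕ))) : Bool :=
  A₁.sublists'.any fun K => (K.any fun Γ => A₂.contains Γ) && goodB R K

theorem stepB_iff (R : List Record) (t t' : List ℕ) : stepB R t t' = true ↔
    ∀ r ∈ R, r.2.2.1 ∈ t → cond r.1 (r.2.2.2.1 ∈ t')
      (r.2.2.2.2 ∈ t ∨ (r.2.2.2.1 ∈ t ∧ r.2.2.1 ∈ t')) := by
  simp only [stepB, List.all_eq_true]
  refine forall₂_congr fun r _ => ?_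
  rcases r with ⟨_ | _, e, q, s, u⟩ <;> simp [imp_iff_not_or]

theorem edgeB_iff (R : List Record) (Γ Γ' : List (List ℕ)) : edgeB R Γ Γ' = true ↔
    (∀ t ∈ Γ, ∃ t' ∈ Γ', stepB R t t' = true) ∧ ∀ t' ∈ Γ', ∃ t ∈ Γ, stepB R t t' = true := by
  simp only [edgeB, Bool.and_eq_true, List.all_eq_true, List.any_eq_true]

theorem goalB_iff (r : Record) (t : List ℕ) :
    goalB r t = true ↔ (r.2.1 = true → r.2.2.1 ∈ t → r.2.2.2.2 ∈ t) := by
  simp [goalB, imp_iff_not_or]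

theorem mem_pointed (K : List (List (List ℕ))) (x : List (List ℕ) × List ℕ) :
    x ∈ pointed K ↔ x.1 ∈ K ∧ x.2 ∈ x.1 := by
  simp only [pointed, List.mem_flatMap, List.mem_map]
  constructor
  · rintro ⟨Γ, hΓ, t, ht, rfl⟩; exact ⟨hΓ, ht⟩
  · rintro ⟨h, h'⟩; exact ⟨_, h, _, h', rfl⟩

theorem closedB_iff (R : List Record) (K : List (List (List ℕ))) (Z : List (List (List ℕ) × List ℕ)) :
    closedB R K Z = true ↔ ∀ x ∈ Z, ∀ Γ ∈ K, edgeB R x.1 Γ = true → ∀ t ∈ Γ,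
      stepB R x.2 t = true → (Γ, t) ∈ Z := by
  simp only [closedB, List.all_eq_true, Bool.or_eq_true, Bool.not_eq_true', List.contains_iff_mem,
    ← Bool.not_eq_true, imp_iff_not_or]

/-- The pairs that are reachable through `K`. -/
abbrev PairReach (R : List Record) (K : List (List (List ℕ))) :
    List (List ℕ) × List ℕ → List (List ℕ) × List ℕ → Prop :=
  Relation.ReflTransGen (PairStep (fun Γ : List (List ℕ) => {t | t ∈ Γ})
    (fun Γ Γ' => edgeB R Γ Γ' = true) (fun t t' => stepB R t t' = true) {Γ | Γ ∈ K})

/-- A point is reachable if and only if it lies in every closed set that contains the start. This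
turns reachability into a finite quantification over sets; the set of reachable pairs itself gives
the forward direction. -/
theorem reachB_iff (R : List Record) (K : List (List (List ℕ))) (x : List (List ℕ) × List ℕ)
    (hx : x.1 ∈ K ∧ x.2 ∈ x.1) (r : Record) :
    reachB R K x r = true ↔ ∃ y, PairReach R K x y ∧ goalB r y.2 = true := by
  classical
  simp only [reachB, List.all_eq_true, List.mem_sublists', Bool.or_eq_true, Bool.not_eq_true',
    ← Bool.not_eq_true, List.contains_iff_mem, List.any_eq_true, closedB_iff, ← imp_iff_not_or]
  constructor
  · intro h
    obtain ⟨y, hy, hg⟩ := h ((pointed K).filter fun y => PairReach R K x y) List.filter_sublist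
      (List.mem_filter.2 ⟨(mem_pointed _ _).2 hx, by simpa using Relation.ReflTransGen.refl⟩)
      (fun y hy Γ hΓ he t ht hs => by
        have hy' : PairReach R K x y := by simpa using (List.mem_filter.1 hy).2
        have hr : PairReach R K x (Γ, t) := hy'.tail ⟨hΓ, he, ht, hs⟩
        exact List.mem_filter.2 ⟨(mem_pointed _ _).2 ⟨hΓ, ht⟩, by simpa using hr⟩)
    exact ⟨y, by simpa using (List.mem_filter.1 hy).2, hg⟩
  · rintro ⟨y, hy, hg⟩ Z - hxZ hcl
    refine ⟨y, ?_, hg⟩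
    clear hg
    induction hy with
    | refl => exact hxZ
    | tail _ h ih => exact hcl _ ih _ h.1 h.2.1 _ h.2.2.1 h.2.2.2

theorem decideB_iff (R : List Record) (A₁ A₂ : List (List (List ℕ))) : decideB R A₁ A₂ = true ↔
    ∃ K, K.Sublist A₁ ∧ (∃ Γ ∈ K, Γ ∈ A₂) ∧ ∀ Γ ∈ K, (∃ Γ' ∈ K, edgeB R Γ Γ' = true) ∧
      ∀ t ∈ Γ, ∀ r ∈ R, ∃ y, PairReach R K (Γ, t) y ∧ goalB r y.2 = true := by
  simp only [decideB, goodB, List.any_eq_true, List.mem_sublists', Bool.and_eq_true,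
    List.contains_iff_mem, List.all_eq_true]
  refine exists_congr fun K => and_congr_right fun _ => and_congr_right fun _ =>
    forall₂_congr fun Γ hΓ => and_congr_right fun _ => forall₂_congr fun t ht =>
    forall₂_congr fun r _ => reachB_iff R K _ ⟨hΓ, ht⟩ r

/-! ### The categories of a temporal formula -/

/-- The index of a constant. -/
def Term.const? : Term → Option ℕ
  | .var _ => none
  | .const c => some c

/-- The constants of a temporal formula. -/
def TFormula.constList : TFormula → List ℕ
  | .verum => []
  | .falsum => []
  | .atom _ ts => ts.filterMap Term.const?
  | .neg φ => φ.constList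
  | .and φ ψ => φ.constList ++ ψ.constList
  | .or φ ψ => φ.constList ++ ψ.constList
  | .imp φ ψ => φ.constList ++ ψ.constList
  | .iff φ ψ => φ.constList ++ ψ.constList
  | .all _ φ => φ.constList
  | .ex _ φ => φ.constList
  | .next φ => φ.constList
  | .always φ => φ.constList
  | .sometime φ => φ.constList
  | .until φ ψ => φ.constList ++ ψ.constList
  | .wuntil φ ψ => φ.constList ++ ψ.constList

theorem TFormula.consts_params (χ : TFormula) :
    χ.params.foldr (fun t s => t.consts ∪ s) ∅ = ∅ := by
  unfold TFormula.params
  split_ifs <;> simp [Term.consts]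

theorem TFormula.consts_bar (φ : TFormula) : ∀ c ∈ φ.bar.consts, c ∈ φ.constList := by
  induction φ with
  | verum | falsum => simp [TFormula.bar, FO.consts]
  | atom p ts =>
    intro c hc
    obtain ⟨t, ht, h⟩ := (mem_foldr_union _ _ _).1 hc
    refine List.mem_filterMap.2 ⟨t, ht, ?_⟩
    cases t <;> simp_all [Term.consts, Term.const?]
  | neg φ ih | all x φ ih | ex x φ ih => exact ih
  | and φ ψ ih₁ ih₂ | or φ ψ ih₁ ih₂ | imp φ ψ ih₁ ih₂ | iff φ ψ ih₁ ih₂ =>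
    intro c hc
    exact List.mem_append.2 ((Finset.mem_union.1 hc).imp (ih₁ c) (ih₂ c))
  | next φ ih | always φ ih | sometime φ ih =>
    intro c hc
    rw [TFormula.bar, TFormula.surrogate, FO.consts, TFormula.consts_params] at hc
    simp at hc
  | _ φ ψ =>
    intro c hc
    rw [TFormula.bar, TFormula.surrogate, FO.consts, TFormula.consts_params] at hc
    simp at hc

theorem TFormula.constList_temporalSubs {φ χ : TFormula} (h : χ ∈ φ.temporalSubs) :
    χ.constList ⊆ φ.constList := by
  induction φ with
  | verum | falsum | atom p ts => simp [TFormula.temporalSubs] at h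
  | neg φ ih | all x φ ih | ex x φ ih => exact ih h
  | and φ ψ ih₁ ih₂ | or φ ψ ih₁ ih₂ | imp φ ψ ih₁ ih₂ | iff φ ψ ih₁ ih₂ =>
    rcases List.mem_append.1 h with h' | h'
    · exact List.subset_append_of_subset_left _ (ih₁ h')
    · exact List.subset_append_of_subset_right _ (ih₂ h')
  | next φ ih | always φ ih | sometime φ ih =>
    rcases List.mem_cons.1 h with h' | h'
    · subst h'; exact List.Subset.refl _
    · exact ih h'
  | _ φ ψ ih₁ ih₂ =>
    rcases List.mem_cons.1 h with h' | h'
    · subst h'; exact List.Subset.refl _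
    · rcases List.mem_append.1 h' with h' | h'
      · exact List.subset_append_of_subset_left _ (ih₁ h')
      · exact List.subset_append_of_subset_right _ (ih₂ h')

theorem TFormula.constList_temporalArgs {χ ψ : TFormula} (h : ψ ∈ χ.temporalArgs) :
    ψ.constList ⊆ χ.constList := by
  cases χ <;> simp only [TFormula.temporalArgs, List.mem_cons, List.not_mem_nil, or_false] at h
  case next | always | sometime => subst h; exact List.Subset.refl _
  all_goals
    rcases h with rfl | rfl
    · exact List.subset_append_left _ _
    · exact List.subset_append_right _ _

/-- The arguments of the temporal operators in a formula. -/
def TFormula.args (φ : TFormula) : List TFormula := φ.temporalSubs.flatMap TFormula.temporalArgs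

theorem TFormula.mem_args {φ χ ψ : TFormula} (hχ : χ ∈ φ.temporalSubs) (hψ : ψ ∈ χ.temporalArgs) :
    ψ ∈ φ.args := List.mem_flatMap.2 ⟨χ, hχ, hψ⟩

/-- The surrogate of `χ` at the term `u`. -/
def TFormula.surrAt (χ : TFormula) (u : Term) : FO :=
  .atom (.surr χ) (if χ.fv = ∅ then [] else [u])

/-- The unary name of `ψ` at the term `u`. -/
def TFormula.nameAt (ψ : TFormula) (u : Term) : FO := .atom (.name ψ) [u]

/-- The variable `0` and the constants of a formula. -/
def TFormula.slots (φ : TFormula) : List Term := .var 0 :: φ.constList.map .const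

/-- The atoms of which types consist. -/
def TFormula.atoms (φ : TFormula) : List FO :=
  φ.slots.flatMap fun u => φ.temporalSubs.map (·.surrAt u) ++ φ.args.map (·.nameAt u)

/-- The record of a formula whose main connective is temporal, at the term `u`. -/
def TFormula.record (u : Term) : TFormula → Record
  | .next ψ => (true, false, ((TFormula.next ψ).surrAt u).code, (ψ.nameAt u).code, 0)
  | .always ψ => (false, false, ((TFormula.always ψ).surrAt u).code, (ψ.nameAt u).code, 0)
  | .sometime ψ => (false, true, ((TFormula.sometime ψ).surrAt u).code,
      ((TFormula.sometime ψ).surrAt u).code, (ψ.nameAt u).code)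
  | .until ψ₁ ψ₂ => (false, true, ((TFormula.until ψ₁ ψ₂).surrAt u).code, (ψ₁.nameAt u).code,
      (ψ₂.nameAt u).code)
  | .wuntil ψ₁ ψ₂ => (false, false, ((TFormula.wuntil ψ₁ ψ₂).surrAt u).code, (ψ₁.nameAt u).code,
      (ψ₂.nameAt u).code)
  | _ => (false, false, 0, 0, 0)

/-- The records of a formula. -/
def TFormula.records (φ : TFormula) : List Record :=
  φ.slots.flatMap fun u => φ.temporalSubs.map (·.record u)

/-- All categories of a formula. -/
def TFormula.categories (φ : TFormula) : List (List (List ℕ)) :=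
  (φ.atoms.map FO.code).sublists'.sublists'

/-- The formula that describes a type. -/
def typeFormula (L : List FO) (t : List ℕ) : FO :=
  conj (L.map fun x => if x.code ∈ t then x else .neg x)

/-- The formula that describes a category. -/
def categoryFormula (L : List FO) (Γ : List (List ℕ)) : FO :=
  .and (conj (Γ.map fun t => .ex 0 (typeFormula L t))) (.all 0 (disj (Γ.map (typeFormula L))))

open Classical in
/-- The definitions of the names in a category. The names whose codes are not in `B` have closed
definitions. -/
noncomputable def TFormula.namesFormula (φ : TFormula) (B : List ℕ) (Γ : List (List ℕ)) : FO :=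
  conj (φ.args.map fun ψ => if ψ.renaming.code ∈ B then ψ.renaming else
    if ∃ t ∈ Γ, (ψ.nameAt (.var 0)).code ∈ t then ψ.bar else .verum)

/-- A category is consistent if this formula is satisfiable. -/
noncomputable def TFormula.query (φ : TFormula) (B : List ℕ) (Γ : List (List ℕ)) : FO :=
  .and (categoryFormula φ.atoms Γ) (φ.namesFormula B Γ)

theorem realize_typeFormula {D : Type} (M : FOStructure D) (L : List FO) (t : List ℕ) (a : ℕ → D) :
    (typeFormula L t).Realize M a ↔ ∀ x ∈ L, x.Realize M a ↔ x.code ∈ t := by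
  rw [typeFormula, realize_conj, List.forall_mem_map]
  refine forall₂_congr fun x _ => ?_
  split_ifs with h <;> simp [h, FO.Realize]

theorem realize_categoryFormula {D : Type} (M : FOStructure D) (L : List FO) (Γ : List (List ℕ))
    (a : ℕ → D) : (categoryFormula L Γ).Realize M a ↔
      (∀ t ∈ Γ, ∃ d, (typeFormula L t).Realize M (Function.update a 0 d)) ∧
      ∀ d, ∃ t ∈ Γ, (typeFormula L t).Realize M (Function.update a 0 d) := by
  simp only [categoryFormula, FO.Realize, realize_conj, realize_disj, List.mem_map,
    exists_exists_and_eq_and, forall_exists_index, and_imp, forall_apply_eq_imp_iff₂]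

theorem TFormula.mem_atoms_surr {φ χ : TFormula} (hχ : χ ∈ φ.temporalSubs) {u : Term}
    (hu : u ∈ φ.slots) : χ.surrAt u ∈ φ.atoms :=
  List.mem_flatMap.2 ⟨u, hu, List.mem_append_left _ (List.mem_map.2 ⟨χ, hχ, rfl⟩)⟩

theorem TFormula.mem_atoms_name {φ ψ : TFormula} (hψ : ψ ∈ φ.args) {u : Term}
    (hu : u ∈ φ.slots) : ψ.nameAt u ∈ φ.atoms :=
  List.mem_flatMap.2 ⟨u, hu, List.mem_append_right _ (List.mem_map.2 ⟨ψ, hψ, rfl⟩)⟩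

theorem TFormula.atoms_cases {φ : TFormula} {x : FO} (hx : x ∈ φ.atoms) : ∃ u ∈ φ.slots,
    (∃ χ ∈ φ.temporalSubs, x = χ.surrAt u) ∨ ∃ ψ ∈ φ.args, x = ψ.nameAt u := by
  obtain ⟨u, hu, h⟩ := List.mem_flatMap.1 hx
  refine ⟨u, hu, ?_⟩
  rcases List.mem_append.1 h with h | h
  · obtain ⟨χ, hχ, rfl⟩ := List.mem_map.1 h; exact Or.inl ⟨χ, hχ, rfl⟩
  · obtain ⟨ψ, hψ, rfl⟩ := List.mem_map.1 h; exact Or.inr ⟨ψ, hψ, rfl⟩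

theorem TFormula.slots_cases {φ : TFormula} {u : Term} (hu : u ∈ φ.slots) :
    u = .var 0 ∨ ∃ c ∈ φ.constList, u = .const c := by
  rcases List.mem_cons.1 hu with h | h
  · exact Or.inl h
  · obtain ⟨c, hc, rfl⟩ := List.mem_map.1 h; exact Or.inr ⟨c, hc, rfl⟩

theorem TFormula.realize_surrAt {D : Type} (M : FOStructure D) (χ : TFormula) (u : Term)
    (a : ℕ → D) : (χ.surrAt u).Realize M a ↔
      M.pred (.surr χ) (χ.vals M.const fun _ => u.eval M.const a) := by
  unfold TFormula.surrAt TFormula.vals TFormula.params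
  split_ifs <;> simp [FO.Realize, Term.eval]

theorem TFormula.realize_nameAt {D : Type} (M : FOStructure D) (ψ : TFormula) (u : Term)
    (a : ℕ → D) : (ψ.nameAt u).Realize M a ↔ M.pred (.name ψ) [u.eval M.const a] := Iff.rfl

theorem TFormula.realize_atoms_congr {D : Type} (M : FOStructure D) {φ : TFormula} {x : FO}
    (hx : x ∈ φ.atoms) {a b : ℕ → D} (hab : a 0 = b 0) : x.Realize M a ↔ x.Realize M b := by
  obtain ⟨u, hu, h⟩ := TFormula.atoms_cases hx
  have he : u.eval M.const a = u.eval M.const b := by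
    rcases TFormula.slots_cases hu with rfl | ⟨c, -, rfl⟩
    · exact hab
    · rfl
  rcases h with ⟨χ, -, rfl⟩ | ⟨ψ, -, rfl⟩
  · rw [TFormula.realize_surrAt, TFormula.realize_surrAt, he]
  · rw [TFormula.realize_nameAt, TFormula.realize_nameAt, he]

theorem TFormula.realize_typeFormula_congr {D : Type} (M : FOStructure D) (φ : TFormula)
    (t : List ℕ) {a b : ℕ → D} (hab : a 0 = b 0) :
    (typeFormula φ.atoms t).Realize M a ↔ (typeFormula φ.atoms t).Realize M b := by
  rw [realize_typeFormula, realize_typeFormula]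
  exact forall₂_congr fun x hx => by rw [TFormula.realize_atoms_congr M hx hab]

theorem TFormula.mem_categories {φ : TFormula} {Γ : List (List ℕ)} (h : Γ ∈ φ.categories)
    {t : List ℕ} (ht : t ∈ Γ) : t ⊆ φ.atoms.map FO.code :=
  (List.mem_sublists'.1 ((List.mem_sublists'.1 h).subset ht)).subset

/-- `0` is the code of `verum`, not of an atom, so it can serve as the never true third component in
records of `○`, `□`. -/
theorem TFormula.zero_notMem {φ : TFormula} {Γ : List (List ℕ)} (h : Γ ∈ φ.categories)
    {t : List ℕ} (ht : t ∈ Γ) : 0 ∉ t := by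
  intro h0
  obtain ⟨x, hx, h'⟩ := List.mem_map.1 (TFormula.mem_categories h ht h0)
  obtain ⟨u, -, ⟨χ, -, rfl⟩ | ⟨ψ, -, rfl⟩⟩ := TFormula.atoms_cases hx
  all_goals
    have h0 : Nat.pair 0 0 = 0 := rfl
    rw [← h0] at h'
    simp [TFormula.surrAt, TFormula.nameAt, FO.code, Nat.pair_eq_pair] at h'

end FOTL

namespace FOTL

/-! ### Correctness of the criterion -/

theorem TFormula.args_props {φ ψ : TFormula} (hφ : φ.Monodic) (hψ : ψ ∈ φ.args) :
    ψ.Monodic ∧ ψ.fv.card ≤ 1 := by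
  obtain ⟨χ, hχ, h⟩ := List.mem_flatMap.1 hψ
  obtain ⟨-, h₁, h₂⟩ := TFormula.monodic_of_mem_temporalSubs hφ hχ
  exact ⟨TFormula.monodic_temporalArgs h₂ h,
    (Finset.card_le_card (TFormula.fv_temporalArgs h)).trans h₁⟩

theorem TFormula.realize_congr_fvar {D : Type} (M : TStructure D) {ψ : TFormula}
    (hψ : ψ.fv.card ≤ 1) (n : ℕ) {a b : ℕ → D} (h : a ψ.fvar = b ψ.fvar) :
    ψ.Realize M n a ↔ ψ.Realize M n b :=
  ψ.realize_congr M n a b fun x hx => by rwa [← TFormula.fvar_eq hψ hx]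

/-! ### Types and categories read off a temporal structure -/

section
variable {D : Type} (M : TStructure D)

theorem TFormula.realize_nameAt_expand {ψ : TFormula} (hψ : ψ.fv.card ≤ 1) (u : Term) (n : ℕ)
    (a : ℕ → D) : (ψ.nameAt u).Realize (M.expand n) a ↔ ψ.Realize M n fun _ => u.eval M.const a := by
  rw [TFormula.realize_nameAt]
  constructor
  · intro h
    exact h (fun _ => u.eval M.const a) (by simp [TStructure.expand])
  · intro h b hb
    exact (TFormula.realize_congr_fvar M hψ n (hb _ (List.mem_singleton_self _))).2 h

theorem TFormula.realize_surrAt_expand {χ : TFormula} (hχ : χ.fv.card ≤ 1) (u : Term) (n : ℕ)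
    (a : ℕ → D) : (χ.surrAt u).Realize (M.expand n) a ↔ χ.Realize M n fun _ => u.eval M.const a := by
  rw [TFormula.realize_surrAt]
  exact TFormula.expand_surr M hχ n _

open Classical in
/-- The type of an element at a moment. -/
noncomputable def TFormula.typeOf (φ : TFormula) (n : ℕ) (d : D) : List ℕ :=
  (φ.atoms.map FO.code).filter fun k => ∃ x ∈ φ.atoms, x.code = k ∧ x.Realize (M.expand n) fun _ => d

open Classical in
/-- The category of a moment. -/
noncomputable def TFormula.categoryOf (φ : TFormula) (n : ℕ) : List (List ℕ) :=
  (φ.atoms.map FO.code).sublists'.filter fun t => ∃ d, φ.typeOf M n d = t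

theorem TFormula.mem_typeOf {φ : TFormula} {x : FO} (hx : x ∈ φ.atoms) (n : ℕ) (d : D) :
    x.code ∈ φ.typeOf M n d ↔ x.Realize (M.expand n) fun _ => d := by
  classical
  simp only [TFormula.typeOf, List.mem_filter, decide_eq_true_eq]
  constructor
  · rintro ⟨-, y, hy, h, h'⟩
    rwa [← FO.code_injective h]
  · exact fun h => ⟨List.mem_map.2 ⟨x, hx, rfl⟩, x, hx, rfl, h⟩

theorem TFormula.mem_categoryOf {φ : TFormula} {t : List ℕ} (n : ℕ) :
    t ∈ φ.categoryOf M n ↔ ∃ d, φ.typeOf M n d = t := by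
  classical
  simp only [TFormula.categoryOf, List.mem_filter, decide_eq_true_eq, List.mem_sublists']
  refine ⟨fun h => h.2, fun h => ⟨?_, h⟩⟩
  obtain ⟨d, rfl⟩ := h
  exact List.filter_sublist

theorem TFormula.realize_typeOf (φ : TFormula) (n : ℕ) (d : D) {a : ℕ → D} (ha : a 0 = d) :
    (typeFormula φ.atoms (φ.typeOf M n d)).Realize (M.expand n) a := by
  rw [TFormula.realize_typeFormula_congr _ φ _ (b := fun _ => d) ha, realize_typeFormula]
  exact fun x hx => (TFormula.mem_typeOf M hx n d).symm

/-- The query asks only for what is true in the expansion: the category is the one actually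
realised, and names imply their definitions. -/
theorem TFormula.realize_query_expand {φ : TFormula} (hφ : φ.Monodic) {B : List ℕ}
    (hB : ∀ ψ ∈ φ.args, ψ.renaming.code ∉ B → ψ.bar.Closed) (n : ℕ) (a : ℕ → D) :
    (φ.query B (φ.categoryOf M n)).Realize (M.expand n) a := by
  refine ⟨(realize_categoryFormula _ _ _ _).2 ⟨fun t ht => ?_, fun d => ?_⟩, ?_⟩
  · obtain ⟨d, rfl⟩ := (TFormula.mem_categoryOf M n).1 ht
    exact ⟨d, TFormula.realize_typeOf M φ n d (by simp)⟩
  · exact ⟨_, (TFormula.mem_categoryOf M n).2 ⟨d, rfl⟩, TFormula.realize_typeOf M φ n d (by simp)⟩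
  · rw [TFormula.namesFormula, realize_conj, List.forall_mem_map]
    intro ψ hψ
    obtain ⟨hm, hc⟩ := TFormula.args_props hφ hψ
    split_ifs with h h'
    · intro d hd
      have := (TFormula.realize_nameAt_expand M hc (.var ψ.fvar) n _).1 hd
      rw [TFormula.realize_bar M hm]
      refine (TFormula.realize_congr_fvar M hc n ?_).1 this
      rfl
    -- Some element bears the name of `ψ`, so `ψ` is true of it; the definition is closed, hence
    -- true outright.
    · obtain ⟨t, ht, hmem⟩ := h'
      obtain ⟨d, rfl⟩ := (TFormula.mem_categoryOf M n).1 ht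
      rw [TFormula.mem_typeOf M (TFormula.mem_atoms_name hψ List.mem_cons_self),
        TFormula.realize_nameAt_expand M hc, ← TFormula.realize_bar M hm] at hmem
      exact ((hB ψ hψ h).realize_iff _ _ _).1 hmem
    · trivial

/-- A record is the unfolding law of its operator, with `ψ₁ U ψ₂` equivalent to `ψ₂ ∨ (ψ₁ ∧ ○ (ψ₁ U
ψ₂))`. Sometime and until also carry an eventuality; weak until has the same unfolding without it.
-/
theorem TFormula.realize_record {φ χ : TFormula} (hφ : φ.Monodic) (hχ : χ ∈ φ.temporalSubs)
    {u : Term} (hu : u ∈ φ.slots) (n : ℕ) (d : D) :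
    (χ.record u).2.2.1 ∈ φ.typeOf M n d →
      cond (χ.record u).1 ((χ.record u).2.2.2.1 ∈ φ.typeOf M (n + 1) d)
        ((χ.record u).2.2.2.2 ∈ φ.typeOf M n d ∨
          ((χ.record u).2.2.2.1 ∈ φ.typeOf M n d ∧ (χ.record u).2.2.1 ∈ φ.typeOf M (n + 1) d)) ∧
      ((χ.record u).2.1 = true → ∃ m, n ≤ m ∧ (χ.record u).2.2.2.2 ∈ φ.typeOf M m d) := by
  obtain ⟨ht, hc, -⟩ := TFormula.monodic_of_mem_temporalSubs hφ hχ
  have hs : ∀ n, (χ.surrAt u).code ∈ φ.typeOf M n d ↔ χ.Realize M n fun _ => u.eval M.const fun _ => d :=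
    fun n => by
      rw [TFormula.mem_typeOf M (TFormula.mem_atoms_surr hχ hu), TFormula.realize_surrAt_expand M hc]
  have hn : ∀ ψ ∈ χ.temporalArgs, ∀ n, (ψ.nameAt u).code ∈ φ.typeOf M n d ↔
      ψ.Realize M n fun _ => u.eval M.const fun _ => d := fun ψ hψ n => by
    have hψ' := TFormula.mem_args hχ hψ
    rw [TFormula.mem_typeOf M (TFormula.mem_atoms_name hψ' hu),
      TFormula.realize_nameAt_expand M (TFormula.args_props hφ hψ').2]
  generalize (fun _ : ℕ => u.eval M.const fun _ => d) = a at hs hn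
  intro h
  cases χ with
  | verum | falsum | atom | neg | and | or | imp | iff | all | ex => exact ht.elim
  | next ψ =>
    have hψ := hn ψ (by simp [TFormula.temporalArgs])
    exact ⟨(hψ _).2 ((hs n).1 h), fun h => by simp [TFormula.record] at h⟩
  | always ψ =>
    have hψ := hn ψ (by simp [TFormula.temporalArgs])
    have h' := (hs n).1 h
    exact ⟨Or.inr ⟨(hψ n).2 (h' n le_rfl), (hs _).2 fun m hm => h' m (by omega)⟩,
      fun h => by simp [TFormula.record] at h⟩
  | sometime ψ =>
    have hψ := hn ψ (by simp [TFormula.temporalArgs])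
    have h' := (hs n).1 h
    refine ⟨?_, fun _ => ?_⟩
    · by_cases hcase : ψ.Realize M n a
      · exact Or.inl ((hψ n).2 hcase)
      · exact Or.inr ⟨h, (hs _).2 (TFormula.realize_sometime_step M h' hcase)⟩
    · obtain ⟨m, hm, h'⟩ := h'
      exact ⟨m, hm, (hψ m).2 h'⟩
  | wuntil ψ₁ ψ₂ =>
    have hψ₁ := hn ψ₁ (by simp [TFormula.temporalArgs])
    have hψ₂ := hn ψ₂ (by simp [TFormula.temporalArgs])
    refine ⟨?_, fun h => by simp [TFormula.record] at h⟩
    by_cases hcase : ψ₂.Realize M n a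
    · exact Or.inl ((hψ₂ n).2 hcase)
    · rcases (hs n).1 h with h' | h'
      · obtain ⟨h1, h2⟩ := TFormula.realize_until_step M h' hcase
        exact Or.inr ⟨(hψ₁ n).2 h1, (hs _).2 (Or.inl h2)⟩
      · exact Or.inr ⟨(hψ₁ n).2 (h' n le_rfl), (hs _).2 (Or.inr fun m hm => h' m (by omega))⟩
  | _ ψ₁ ψ₂ =>
    have hψ₁ := hn ψ₁ (by simp [TFormula.temporalArgs])
    have hψ₂ := hn ψ₂ (by simp [TFormula.temporalArgs])
    have h' := (hs n).1 h
    refine ⟨?_, fun _ => ?_⟩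
    · by_cases hcase : ψ₂.Realize M n a
      · exact Or.inl ((hψ₂ n).2 hcase)
      · obtain ⟨h1, h2⟩ := TFormula.realize_until_step M h' hcase
        exact Or.inr ⟨(hψ₁ n).2 h1, (hs _).2 h2⟩
    · obtain ⟨m, hm, h', -⟩ := h'
      exact ⟨m, hm, (hψ₂ m).2 h'⟩

theorem TFormula.mem_records {φ : TFormula} {r : Record} : r ∈ φ.records ↔
    ∃ u ∈ φ.slots, ∃ χ ∈ φ.temporalSubs, χ.record u = r := by
  simp only [TFormula.records, List.mem_flatMap, List.mem_map]

end

open Classical in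
-- The categories of the moments of a model form a good set: the next moment is a successor, and an
-- element followed through time witnesses that its eventualities can be reached.
theorem TFormula.decideB_of_satisfiable {φ : TFormula} (hφ : φ.Monodic) {B : List ℕ}
    (hB : ∀ ψ ∈ φ.args, ψ.renaming.code ∉ B → ψ.bar.Closed) {A₁ A₂ : List (List (List ℕ))}
    (hA₁ : ∀ Γ, Γ ∈ A₁ ↔ Γ ∈ φ.categories ∧ (φ.query B Γ).Satisfiable)
    (hA₂ : ∀ Γ, Γ ∈ A₂ ↔ Γ ∈ φ.categories ∧ (FO.and (φ.query B Γ) φ.bar).Satisfiable)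
    (h : φ.Satisfiable) : decideB φ.records A₁ A₂ = true := by
  obtain ⟨D, M, a, h⟩ := h
  have hcat : ∀ n, φ.categoryOf M n ∈ φ.categories := fun n =>
    List.mem_sublists'.2 List.filter_sublist
  have hmem : ∀ n, φ.categoryOf M n ∈ A₁ := fun n =>
    (hA₁ _).2 ⟨hcat n, D, M.expand n, a, TFormula.realize_query_expand M hφ hB n a⟩
  let K := A₁.filter fun Γ => ∃ n, φ.categoryOf M n = Γ
  have hK : ∀ n, φ.categoryOf M n ∈ K := fun n =>
    List.mem_filter.2 ⟨hmem n, by simp⟩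
  have hstep : ∀ n d, stepB φ.records (φ.typeOf M n d) (φ.typeOf M (n + 1) d) = true := by
    intro n d
    rw [stepB_iff]
    intro r hr hq
    obtain ⟨u, hu, χ, hχ, rfl⟩ := TFormula.mem_records.1 hr
    exact (TFormula.realize_record M hφ hχ hu n d hq).1
  have hedge : ∀ n, edgeB φ.records (φ.categoryOf M n) (φ.categoryOf M (n + 1)) = true := by
    intro n
    rw [edgeB_iff]
    refine ⟨fun t ht => ?_, fun t ht => ?_⟩ <;> obtain ⟨d, rfl⟩ := (TFormula.mem_categoryOf M _).1 ht
    · exact ⟨_, (TFormula.mem_categoryOf M _).2 ⟨d, rfl⟩, hstep n d⟩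
    · exact ⟨_, (TFormula.mem_categoryOf M _).2 ⟨d, rfl⟩, hstep n d⟩
  have hreach : ∀ n m, n ≤ m → ∀ d, PairReach φ.records K (φ.categoryOf M n, φ.typeOf M n d)
      (φ.categoryOf M m, φ.typeOf M m d) := by
    intro n m hnm d
    induction m, hnm using Nat.le_induction with
    | base => exact .refl
    | succ m _ ih =>
      exact ih.tail ⟨hK _, hedge m, (TFormula.mem_categoryOf M _).2 ⟨d, rfl⟩, hstep m d⟩
  refine (decideB_iff _ _ _).2 ⟨K, List.filter_sublist, ⟨_, hK 0, (hA₂ _).2 ⟨hcat 0, D, M.expand 0, a,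
    TFormula.realize_query_expand M hφ hB 0 a, (TFormula.realize_bar M hφ 0 a).2 h⟩⟩, fun Γ hΓ => ?_⟩
  obtain ⟨n, rfl⟩ : ∃ n, φ.categoryOf M n = Γ := by simpa using (List.mem_filter.1 hΓ).2
  refine ⟨⟨_, hK (n + 1), hedge n⟩, fun t ht r hr => ?_⟩
  obtain ⟨d, rfl⟩ := (TFormula.mem_categoryOf M n).1 ht
  obtain ⟨u, hu, χ, hχ, rfl⟩ := TFormula.mem_records.1 hr
  -- If the record has no eventuality, or its left-hand side is absent from the type, the goal is
  -- already met at the start.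
  by_cases hq : (χ.record u).2.1 = true ∧ (χ.record u).2.2.1 ∈ φ.typeOf M n d
  · obtain ⟨m, hm, h'⟩ := (TFormula.realize_record M hφ hχ hu n d hq.2).2 hq.1
    exact ⟨_, hreach n m hm d, (goalB_iff _ _).2 fun _ _ => h'⟩
  · exact ⟨_, .refl, (goalB_iff _ _).2 fun h h' => (hq ⟨h, h'⟩).elim⟩

/-- Unfolding the fixed point condition of until and weak until. -/
theorem unfold_cases {Q S T : ℕ → Prop} (h : ∀ i, Q i → T i ∨ (S i ∧ Q (i + 1))) (n : ℕ) (hn : Q n) :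
    (∃ m, n ≤ m ∧ T m ∧ ∀ i, n ≤ i → i < m → S i) ∨ ∀ m, n ≤ m → Q m ∧ ¬ T m ∧ S m := by
  classical
  by_cases hex : ∃ m, n ≤ m ∧ T m
  · refine Or.inl ⟨Nat.find hex, (Nat.find_spec hex).1, (Nat.find_spec hex).2, fun i hi him => ?_⟩
    have hnot : ∀ i, n ≤ i → i < Nat.find hex → ¬ T i := fun i hi him hT =>
      Nat.find_min hex him ⟨hi, hT⟩
    have key : ∀ i, n ≤ i → i < Nat.find hex → Q i ∧ S i := by
      intro i hi
      induction i, hi using Nat.le_induction with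
      | base => exact fun him => ⟨hn, ((h n hn).resolve_left (hnot n le_rfl him)).1⟩
      | succ i hi ih =>
        intro him
        have hQ := ((h i (ih (by omega)).1).resolve_left (hnot i hi (by omega))).2
        exact ⟨hQ, ((h _ hQ).resolve_left (hnot _ (by omega) him)).1⟩
    exact (key i hi him).2
  · push Not at hex
    have key : ∀ m, n ≤ m → Q m := by
      intro m hm
      induction m, hm using Nat.le_induction with
      | base => exact hn
      | succ m hm ih => exact ((h m ih).resolve_left (hex m hm)).2
    exact Or.inr fun m hm => ⟨key m hm, hex m hm, ((h m (key m hm)).resolve_left (hex m hm)).1⟩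

/-- Sequences of types, and structures, along which the records are respected describe the truth of
the surrogates. -/
theorem TFormula.surrogateSound_of_run {X : Type} {N : ℕ → FOStructure X} {R : List Record}
    {χ : TFormula} (ht : χ.IsTemporal) (hχ : χ.record (.var 0) ∈ R)
    (h : ∀ a : ℕ → X, ∃ g : ℕ → List ℕ, (∀ n, stepB R (g n) (g (n + 1)) = true) ∧ (∀ n, 0 ∉ g n) ∧
      (∀ r ∈ R, ∀ n, ∃ m, n ≤ m ∧ goalB r (g m) = true) ∧
      (∀ n, χ.surrogate.Realize (N n) a → (χ.surrAt (.var 0)).code ∈ g n) ∧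
      ∀ ψ ∈ χ.temporalArgs, ∀ n, (ψ.nameAt (.var 0)).code ∈ g n → ψ.bar.Realize (N n) a) :
    χ.SurrogateSound N := by
  have key : ∀ a : ℕ → X, ∃ g : ℕ → List ℕ, (∀ n, (χ.record (.var 0)).2.2.1 ∈ g n →
      cond (χ.record (.var 0)).1 ((χ.record (.var 0)).2.2.2.1 ∈ g (n + 1))
        ((χ.record (.var 0)).2.2.2.2 ∈ g n ∨
          ((χ.record (.var 0)).2.2.2.1 ∈ g n ∧ (χ.record (.var 0)).2.2.1 ∈ g (n + 1)))) ∧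
      (∀ n, 0 ∉ g n) ∧
      (∀ n, ∃ m, n ≤ m ∧ ((χ.record (.var 0)).2.1 = true → (χ.record (.var 0)).2.2.1 ∈ g m →
        (χ.record (.var 0)).2.2.2.2 ∈ g m)) ∧
      (∀ n, χ.surrogate.Realize (N n) a → (χ.surrAt (.var 0)).code ∈ g n) ∧
      ∀ ψ ∈ χ.temporalArgs, ∀ n, (ψ.nameAt (.var 0)).code ∈ g n → ψ.bar.Realize (N n) a := by
    intro a
    obtain ⟨g, h₁, h₂, h₃, h₄, h₅⟩ := h a
    refine ⟨g, fun n => (stepB_iff _ _ _).1 (h₁ n) _ hχ, h₂, fun n => ?_, h₄, h₅⟩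
    obtain ⟨m, hm, h'⟩ := h₃ _ hχ n
    exact ⟨m, hm, (goalB_iff _ _).1 h'⟩
  clear h
  cases χ with
  | verum | falsum | atom | neg | and | or | imp | iff | all | ex => exact ht.elim
  | next ψ =>
    intro n a hn
    obtain ⟨g, h₁, -, -, h₄, h₅⟩ := key a
    exact h₅ ψ (by simp [TFormula.temporalArgs]) _ (h₁ n (h₄ n hn))
  | always ψ =>
    intro n a hn m hm
    obtain ⟨g, h₁, h₂, -, h₄, h₅⟩ := key a
    rcases unfold_cases (Q := fun i => ((TFormula.always ψ).record (.var 0)).2.2.1 ∈ g i)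
      -- For `□` the exit from the unfolding is the code `0`, which is in no type, so the unfolding
      -- goes on forever.
      (T := fun i => 0 ∈ g i) h₁ n (h₄ n hn) with ⟨i, -, h, -⟩ | h
    · exact (h₂ i h).elim
    · exact h₅ ψ (by simp [TFormula.temporalArgs]) _ (h m hm).2.2
  | sometime ψ =>
    intro n a hn
    obtain ⟨g, h₁, -, h₃, h₄, h₅⟩ := key a
    rcases unfold_cases (Q := fun i => ((TFormula.sometime ψ).record (.var 0)).2.2.1 ∈ g i)
      (T := fun i => (ψ.nameAt (.var 0)).code ∈ g i) h₁ n (h₄ n hn) with ⟨i, hi, h, -⟩ | h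
    · exact ⟨i, hi, h₅ ψ (by simp [TFormula.temporalArgs]) _ h⟩
    -- An endless unfolding without `ψ` contradicts the goal, which is met at some `m ≥ n` where the
    -- left-hand side is still in force.
    · obtain ⟨m, hm, h'⟩ := h₃ n
      exact ((h m hm).2.1 (h' rfl (h m hm).1)).elim
  | wuntil ψ₁ ψ₂ =>
    intro n a hn
    obtain ⟨g, h₁, -, -, h₄, h₅⟩ := key a
    have hψ₁ := h₅ ψ₁ (by simp [TFormula.temporalArgs])
    have hψ₂ := h₅ ψ₂ (by simp [TFormula.temporalArgs])
    rcases unfold_cases (Q := fun i => ((TFormula.wuntil ψ₁ ψ₂).record (.var 0)).2.2.1 ∈ g i)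
      (T := fun i => (ψ₂.nameAt (.var 0)).code ∈ g i) h₁ n (h₄ n hn) with ⟨i, hi, h, h'⟩ | h
    · exact Or.inl ⟨i, hi, hψ₂ _ h, fun j hj hji => hψ₁ _ (h' j hj hji)⟩
    · exact Or.inr fun m hm => hψ₁ _ (h m hm).2.2
  | _ ψ₁ ψ₂ =>
    intro n a hn
    obtain ⟨g, h₁, -, h₃, h₄, h₅⟩ := key a
    have hψ₁ := h₅ ψ₁ (by simp [TFormula.temporalArgs])
    have hψ₂ := h₅ ψ₂ (by simp [TFormula.temporalArgs])
    rcases unfold_cases (Q := fun i => ((TFormula.until ψ₁ ψ₂).record (.var 0)).2.2.1 ∈ g i)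
      (T := fun i => (ψ₂.nameAt (.var 0)).code ∈ g i) h₁ n (h₄ n hn) with ⟨i, hi, h, h'⟩ | h
    · exact ⟨i, hi, hψ₂ _ h, fun j hj hji => hψ₁ _ (h' j hj hji)⟩
    · obtain ⟨m, hm, h'⟩ := h₃ n
      exact ((h m hm).2.1 (h' rfl (h m hm).1)).elim

end FOTL

/-! ### From a good set of categories to a model -/

namespace FOTL

/-- The entries of a record are `0` or codes of the surrogate and the names at the slot. Types that
agree on these atoms at two slots therefore agree on the two records. -/
theorem TFormula.record_entries {χ : TFormula} (ht : χ.IsTemporal) (u u' : Term) :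
    (χ.record u).1 = (χ.record u').1 ∧ (χ.record u).2.1 = (χ.record u').2.1 ∧
      ∀ P P' : ℕ → Prop, (P (χ.surrAt u).code ↔ P' (χ.surrAt u').code) →
        (∀ ψ ∈ χ.temporalArgs, P (ψ.nameAt u).code ↔ P' (ψ.nameAt u').code) → (P 0 ↔ P' 0) →
        (P (χ.record u).2.2.1 ↔ P' (χ.record u').2.2.1) ∧
        (P (χ.record u).2.2.2.1 ↔ P' (χ.record u').2.2.2.1) ∧
        (P (χ.record u).2.2.2.2 ↔ P' (χ.record u').2.2.2.2) := by
  cases χ with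
  | verum | falsum | atom | neg | and | or | imp | iff | all | ex => exact ht.elim
  | _ =>
    refine ⟨rfl, rfl, fun P P' h₁ h₂ h₃ => ?_⟩
    simp only [TFormula.temporalArgs, List.mem_cons, List.not_mem_nil, or_false, forall_eq_or_imp,
      forall_eq] at h₂
    simp only [TFormula.record, h₁, h₂, h₃, and_self]

/-- The types of a constant in a sequence of structures form a run, if there is a run at all. -/
theorem TFormula.run_of_const {φ : TFormula} (hφ : φ.Monodic) {c : ℕ} (hc : c ∈ φ.constList)
    {D : ℕ → Type} (M : ∀ n, FOStructure (D n)) {e : ∀ n, D n} {g g' : ℕ → List ℕ}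
    (hg : ∀ n, (typeFormula φ.atoms (g n)).Realize (M n) fun _ => (M n).const c)
    (hg' : ∀ n, (typeFormula φ.atoms (g' n)).Realize (M n) fun _ => e n)
    (h0 : ∀ n, 0 ∉ g n) (h0' : ∀ n, 0 ∉ g' n)
    (hstep : ∀ n, stepB φ.records (g' n) (g' (n + 1)) = true)
    (hgoal : ∀ r ∈ φ.records, ∀ n, ∃ m, n ≤ m ∧ goalB r (g' m) = true) :
    (∀ n, stepB φ.records (g n) (g (n + 1)) = true) ∧
      ∀ r ∈ φ.records, ∀ n, ∃ m, n ≤ m ∧ goalB r (g m) = true := by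
  have hg := fun n => (realize_typeFormula _ _ _ _).1 (hg n)
  have hg' := fun n => (realize_typeFormula _ _ _ _).1 (hg' n)
  have key : ∀ r ∈ φ.records, ∃ r' ∈ φ.records, r.1 = r'.1 ∧ r.2.1 = r'.2.1 ∧ ∀ n,
      (r.2.2.1 ∈ g n ↔ r'.2.2.1 ∈ g' n) ∧ (r.2.2.2.1 ∈ g n ↔ r'.2.2.2.1 ∈ g' n) ∧
        (r.2.2.2.2 ∈ g n ↔ r'.2.2.2.2 ∈ g' n) := by
    intro r hr
    obtain ⟨u, hu, χ, hχ, rfl⟩ := TFormula.mem_records.1 hr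
    -- The variable slot, read at the value of `c`, says the same as the slot `c` read at any
    -- element; a constant slot says the same everywhere. This is why records are also taken at
    -- constants, which here do the work of flooding.
    obtain ⟨u', hu', h⟩ : ∃ u' ∈ φ.slots, ∀ n,
        (u.eval (M n).const fun _ => (M n).const c) = u'.eval (M n).const fun _ => e n := by
      rcases TFormula.slots_cases hu with rfl | ⟨c', -, rfl⟩
      · exact ⟨.const c, List.mem_cons_of_mem _ (List.mem_map.2 ⟨c, hc, rfl⟩), fun n => rfl⟩
      · exact ⟨.const c', hu, fun n => rfl⟩
    obtain ⟨h₁, h₂, h₃⟩ := TFormula.record_entries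
      (TFormula.monodic_of_mem_temporalSubs hφ hχ).1 u u'
    refine ⟨χ.record u', TFormula.mem_records.2 ⟨u', hu', χ, hχ, rfl⟩, h₁, h₂, fun n => ?_⟩
    refine h₃ (· ∈ g n) (· ∈ g' n) ?_ (fun ψ hψ => ?_) (iff_of_false (h0 n) (h0' n))
    · rw [← hg n _ (TFormula.mem_atoms_surr hχ hu), ← hg' n _ (TFormula.mem_atoms_surr hχ hu'),
        TFormula.realize_surrAt, TFormula.realize_surrAt, h]
    · rw [← hg n _ (TFormula.mem_atoms_name (TFormula.mem_args hχ hψ) hu),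
        ← hg' n _ (TFormula.mem_atoms_name (TFormula.mem_args hχ hψ) hu'),
        TFormula.realize_nameAt, TFormula.realize_nameAt, h]
  refine ⟨fun n => (stepB_iff _ _ _).2 fun r hr => ?_, fun r hr n => ?_⟩
  · obtain ⟨r', hr', h₁, -, h⟩ := key r hr
    have := (stepB_iff _ _ _).1 (hstep n) r' hr'
    simpa only [h₁, (h n).1, (h n).2.1, (h n).2.2, (h (n + 1)).1, (h (n + 1)).2.1] using this
  · obtain ⟨r', hr', -, h₂, h⟩ := key r hr
    obtain ⟨m, hm, h'⟩ := hgoal r' hr' n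
    refine ⟨m, hm, (goalB_iff _ _).2 ?_⟩
    rw [h₂, (h m).1, (h m).2.2]
    exact (goalB_iff _ _).1 h'

/-- A good set carries a fair path of categories. Models of the queries along it are glued along
runs, and the run of each element forces the surrogates to imply what they stand for. -/
theorem TFormula.satisfiable_of_decideB {φ : TFormula} (hφ : φ.Monodic) (hnnf : φ.NNF) {B : List ℕ}
    (hB : ∀ ψ ∈ φ.args, ψ.renaming.code ∉ B → ψ.bar.Closed) {A₁ A₂ : List (List (List ℕ))}
    (hA₁ : ∀ Γ, Γ ∈ A₁ ↔ Γ ∈ φ.categories ∧ (φ.query B Γ).Satisfiable)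
    (hA₂ : ∀ Γ, Γ ∈ A₂ ↔ Γ ∈ φ.categories ∧ (FO.and (φ.query B Γ) φ.bar).Satisfiable)
    (h : decideB φ.records A₁ A₂ = true) : φ.Satisfiable := by
  obtain ⟨K, hKA, ⟨Γ₀, hΓ₀, hΓ₀A⟩, hK⟩ := (decideB_iff _ _ _).1 h
  have hfwd : ∀ Γ Γ', edgeB φ.records Γ Γ' = true → ∀ t ∈ Γ, ∃ t' ∈ Γ', stepB φ.records t t' = true :=
    fun Γ Γ' h => ((edgeB_iff _ _ _).1 h).1
  have hbwd : ∀ Γ Γ', edgeB φ.records Γ Γ' = true → ∀ t' ∈ Γ', ∃ t ∈ Γ, stepB φ.records t t' = true :=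
    fun Γ Γ' h => ((edgeB_iff _ _ _).1 h).2
  -- There are no goals for states: closed surrogates are atoms of every type, so their
  -- eventualities are goals of types as well.
  obtain ⟨f, hf0, hfK, hfE, -, hfL⟩ := exists_fair_path
    (Γ := fun Γ : List (List ℕ) => {t | t ∈ Γ}) (Edge := fun Γ Γ' => edgeB φ.records Γ Γ' = true)
    (E := fun t t' => stepB φ.records t t' = true) (K := {Γ | Γ ∈ K}) (J := {r // r ∈ φ.records})
    (J' := Empty) (fun _ _ => True) (fun r t => goalB r.1 t = true) hΓ₀
    (fun Γ hΓ => by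
      obtain ⟨Γ', h, h'⟩ := (hK Γ hΓ).1
      exact ⟨Γ', h, h'⟩)
    hfwd (fun _ _ j => j.elim) (fun Γ hΓ t ht r => (hK Γ hΓ).2 t ht r.1 r.2)
  -- The starting category is in `A₂`, so at moment `0` a model can be chosen in which `φ.bar` is
  -- true too.
  have hsat : ∀ n, ∃ (D : Type) (M : FOStructure D) (a : ℕ → D), (φ.query B (f n)).Realize M a ∧
      (n = 0 → φ.bar.Realize M a) := by
    intro n
    by_cases hn : n = 0
    · obtain ⟨D, M, a, h⟩ := ((hA₂ _).1 hΓ₀A).2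
      rw [← hf0, ← hn] at h
      exact ⟨D, M, a, h.1, fun _ => h.2⟩
    · obtain ⟨D, M, a, h⟩ := ((hA₁ _).1 (hKA.subset (hfK n))).2
      exact ⟨D, M, a, h, fun h => (hn h).elim⟩
  choose D M a hM hbar using hsat
  have hcat : ∀ n, f n ∈ φ.categories := fun n => ((hA₁ _).1 (hKA.subset (hfK n))).1
  have hcatM := fun n => (realize_categoryFormula _ _ _ _).1 (hM n).1
  have htype : ∀ n d, ∃ t ∈ f n, (typeFormula φ.atoms t).Realize (M n) fun _ => d := by
    intro n d
    obtain ⟨t, ht, h⟩ := (hcatM n).2 d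
    exact ⟨t, ht, (TFormula.realize_typeFormula_congr _ _ _ (by simp)).1 h⟩
  let R : Set (∀ n, D n) := {e | ∃ g : ℕ → List ℕ, (∀ n, g n ∈ f n) ∧
    (∀ n, stepB φ.records (g n) (g (n + 1)) = true) ∧
    (∀ r ∈ φ.records, ∀ n, ∃ m, n ≤ m ∧ goalB r (g m) = true) ∧
    ∀ n, (typeFormula φ.atoms (g n)).Realize (M n) fun _ => e n}
  have hsurj : ∀ n (d : D n), ∃ e ∈ R, e n = d := by
    intro n d
    obtain ⟨t, ht, htd⟩ := htype n d
    obtain ⟨g, hgn, hg, hgs, hgg⟩ := exists_run (Γ := fun Γ : List (List ℕ) => {t | t ∈ Γ})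
      (Edge := fun Γ Γ' => edgeB φ.records Γ Γ' = true)
      (E := fun t t' => stepB φ.records t t' = true) (J := {r // r ∈ φ.records})
      (fun r t => goalB r.1 t = true) f hfwd hbwd hfE hfL n t ht
    have he : ∀ m, ∃ d' : D m, (typeFormula φ.atoms (g m)).Realize (M m) fun _ => d' := by
      intro m
      obtain ⟨d', h⟩ := (hcatM m).1 _ (hg m)
      exact ⟨d', (TFormula.realize_typeFormula_congr _ _ _ (by simp)).1 h⟩
    choose e he using he
    refine ⟨Function.update e n d, ⟨g, hg, hgs, fun r hr => hgg ⟨r, hr⟩, fun m => ?_⟩, by simp⟩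
    rcases eq_or_ne m n with rfl | hne
    · rw [Function.update_self, hgn]; exact htd
    · rw [Function.update_of_ne hne]; exact he m
  have hne : R.Nonempty := (hsurj 0 (a 0 0)).imp fun _ h => h.1
  -- Any run will do for the comparison, because it already respects the records at the slot `c`.
  have hconst : ∀ c ∈ φ.constList.toFinset, (fun n => (M n).const c) ∈ R := by
    intro c hc
    obtain ⟨e, g', h₁, h₂, h₃, h₄⟩ := hne
    choose g hg hgc using fun n => htype n ((M n).const c)
    obtain ⟨h, h'⟩ := TFormula.run_of_const hφ (List.mem_toFinset.1 hc) M hgc h₄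
      (fun n => TFormula.zero_notMem (hcat n) (hg n)) (fun n => TFormula.zero_notMem (hcat n) (h₁ n))
      h₂ h₃
    exact ⟨g, hg, h, h', hgc⟩
  obtain ⟨X, I, N, π, -, hI, hπ, hpred, hN, hR⟩ := exists_glued M R _ hsurj hconst hne
  let M' : TStructure X := ⟨fun n p ds => (N n).pred (.base p) ds, I⟩
  -- Preimages of the values of the initial assignment, so that `φ.bar` can be pulled back at moment
  -- `0`.
  choose ρ hρ using hπ 0
  refine ⟨X, M', fun x => ρ (a 0 x), TFormula.realize_of_bar M' N hI (fun _ _ _ => Iff.rfl) φ hnnf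
    (fun χ hχ => ?_) 0 _ ?_⟩
  · obtain ⟨ht, hc, -⟩ := TFormula.monodic_of_mem_temporalSubs hφ hχ
    refine TFormula.surrogateSound_of_run (R := φ.records) ht
      (TFormula.mem_records.2 ⟨_, List.mem_cons_self, χ, hχ, rfl⟩) fun b => ?_
    obtain ⟨g, h₁, h₂, h₃, h₄⟩ := hR (b χ.fvar)
    have h₄ := fun n => (realize_typeFormula _ _ _ _).1 (h₄ n)
    refine ⟨g, h₂, fun n => TFormula.zero_notMem (hcat n) (h₁ n), h₃, fun n hn => ?_,
      fun ψ hψ n hn => ?_⟩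
    · rw [← h₄ n _ (TFormula.mem_atoms_surr hχ List.mem_cons_self), TFormula.realize_surrAt]
      rw [hN n _ (by rw [TFormula.surrogate, FO.consts, TFormula.consts_params]; simp)] at hn
      change (M n).pred (.surr χ) (χ.vals (M n).const (π n ∘ b)) at hn
      by_cases hcl : χ.fv = ∅
      · rwa [TFormula.vals_of_closed hcl] at hn ⊢
      · rwa [TFormula.vals_of_open hcl] at hn ⊢
    · have hψ' := TFormula.mem_args hχ hψ
      have hname := (h₄ n _ (TFormula.mem_atoms_name hψ' List.mem_cons_self)).2 hn
      rw [TFormula.realize_nameAt] at hname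
      have hdef := (realize_conj _ _ _).1 (hM n).2 _ (List.mem_map.2 ⟨ψ, hψ', rfl⟩)
      obtain ⟨hψm, hψc⟩ := TFormula.args_props hφ hψ'
      rw [hN n _ fun c hc => List.mem_toFinset.2 (TFormula.constList_temporalSubs hχ
        (TFormula.constList_temporalArgs hψ (TFormula.consts_bar ψ c hc)))]
      -- Either the query contains the renaming, to be instantiated at the current element, or it
      -- contains the closed definition; the third case, no type with this name, is excluded by the
      -- run through `b χ.fvar`.
      split_ifs at hdef with hmem hex
      · refine (FO.realize_congr _ _ _ _ fun x hx => ?_).1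
          (hdef (π n (b χ.fvar)) (by simpa [FO.Realize, Term.eval] using hname))
        rw [TFormula.fv_bar _ hψm] at hx
        rw [← TFormula.fvar_eq hψc hx, Function.update_self, Function.comp_apply,
          TFormula.fvar_eq hψc hx, TFormula.fvar_eq hc (TFormula.fv_temporalArgs hψ hx)]
      · exact ((hB ψ hψ' hmem).realize_iff _ _ _).1 hdef
      · exact (hex ⟨_, h₁ n, hn⟩).elim
  · rw [hN 0 _ fun c hc => List.mem_toFinset.2 (TFormula.consts_bar φ c hc)]
    have : π 0 ∘ (fun x => ρ (a 0 x)) = a 0 := funext fun x => hρ _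
    rw [this]
    exact hbar 0 rfl

end FOTL


/-! ### Primitive recursive functions

The rules for compositions are given to the tactic `fun_prop`. -/

attribute [fun_prop] Primrec Primrec.id Primrec.const Primrec.comp Primrec.pair Primrec.fst Primrec.snd

namespace FOTL

section
variable {α β γ : Type} [Primcodable α] [Primcodable β] [Primcodable γ]

@[fun_prop]
theorem primrec_fst {f : α → β × γ} (hf : Primrec f) : Primrec fun a => (f a).1 :=
  Primrec.fst.comp hf

@[fun_prop]
theorem primrec_snd {f : α → β × γ} (hf : Primrec f) : Primrec fun a => (f a).2 :=
  Primrec.snd.comp hf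

@[fun_prop]
theorem primrec_natPair {f g : α → ℕ} (hf : Primrec f) (hg : Primrec g) :
    Primrec fun a => Nat.pair (f a) (g a) := Primrec₂.natPair.comp hf hg

@[fun_prop]
theorem primrec_unpair {f : α → ℕ} (hf : Primrec f) : Primrec fun a => (f a).unpair :=
  Primrec.unpair.comp hf

@[fun_prop]
theorem primrec_max {f g : α → ℕ} (hf : Primrec f) (hg : Primrec g) :
    Primrec fun a => max (f a) (g a) := Primrec.nat_max.comp hf hg

@[fun_prop]
theorem primrec_encode {f : α → β} (hf : Primrec f) : Primrec fun a => Encodable.encode (f a) :=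
  Primrec.encode.comp hf

@[fun_prop]
theorem primrec_decode {f : α → ℕ} (hf : Primrec f) :
    Primrec fun a => (Encodable.decode (f a) : Option β) := Primrec.decode.comp hf

@[fun_prop]
theorem primrec_getD {f : α → Option β} {g : α → β} (hf : Primrec f) (hg : Primrec g) :
    Primrec fun a => (f a).getD (g a) := Primrec.option_getD.comp hf hg

@[fun_prop]
theorem primrec_some {f : α → β} (hf : Primrec f) : Primrec fun a => some (f a) :=
  Primrec.option_some.comp hf

@[fun_prop]
theorem primrec_optionMap {f : α → Option β} {g : α → β → γ} (hf : Primrec f)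
    (hg : Primrec fun p : α × β => g p.1 p.2) : Primrec fun a => (f a).map (g a) :=
  Primrec.option_map hf hg

@[fun_prop]
theorem primrec_cond {c : α → Bool} {f g : α → β} (hc : Primrec c) (hf : Primrec f)
    (hg : Primrec g) : Primrec fun a => bif c a then f a else g a := Primrec.cond hc hf hg

@[fun_prop]
theorem primrec_and {f g : α → Bool} (hf : Primrec f) (hg : Primrec g) :
    Primrec fun a => f a && g a := Primrec.and.comp hf hg

@[fun_prop]
theorem primrec_or {f g : α → Bool} (hf : Primrec f) (hg : Primrec g) :
    Primrec fun a => f a || g a := Primrec.or.comp hf hg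

@[fun_prop]
theorem primrec_not {f : α → Bool} (hf : Primrec f) : Primrec fun a => !f a :=
  Primrec.not.comp hf

@[fun_prop]
theorem primrec_beq {f g : α → ℕ} (hf : Primrec f) (hg : Primrec g) :
    Primrec fun a => f a == g a := Primrec.beq.comp hf hg

@[fun_prop]
theorem primrec_ble {f g : α → ℕ} (hf : Primrec f) (hg : Primrec g) :
    Primrec fun a => Nat.ble (f a) (g a) :=
  (Primrec.nat_le.comp hf hg).decide.of_eq fun a => by
    rw [Bool.eq_iff_iff, decide_eq_true_eq, Nat.ble_eq]

@[fun_prop]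
theorem primrec_cons {f : α → β} {g : α → List β} (hf : Primrec f) (hg : Primrec g) :
    Primrec fun a => f a :: g a := Primrec.list_cons.comp hf hg

@[fun_prop]
theorem primrec_append {f g : α → List β} (hf : Primrec f) (hg : Primrec g) :
    Primrec fun a => f a ++ g a := Primrec.list_append.comp hf hg

@[fun_prop]
theorem primrec_flatten {f : α → List (List β)} (hf : Primrec f) :
    Primrec fun a => (f a).flatten := Primrec.list_flatten.comp hf

@[fun_prop]
theorem primrec_length {f : α → List β} (hf : Primrec f) : Primrec fun a => (f a).length :=
  Primrec.list_length.comp hf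

@[fun_prop]
theorem primrec_isEmpty {f : α → List β} (hf : Primrec f) : Primrec fun a => (f a).isEmpty :=
  (primrec_beq (Primrec.list_length.comp hf) (.const 0)).of_eq fun a => by cases f a <;> rfl

@[fun_prop]
theorem primrec_listGetD {f : α → List β} {g : α → ℕ} {h : α → β} (hf : Primrec f)
    (hg : Primrec g) (hh : Primrec h) : Primrec fun a => (f a).getD (g a) (h a) :=
  (primrec_getD (Primrec.list_getElem?.comp hf hg) hh).of_eq fun a => by
    rw [List.getD_eq_getElem?_getD]

@[fun_prop]
theorem primrec_map {f : α → List β} {g : α → β → γ} (hf : Primrec f)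
    (hg : Primrec fun p : α × β => g p.1 p.2) : Primrec fun a => (f a).map (g a) :=
  Primrec.list_map hf hg

@[fun_prop]
theorem primrec_flatMap {f : α → List β} {g : α → β → List γ} (hf : Primrec f)
    (hg : Primrec fun p : α × β => g p.1 p.2) : Primrec fun a => (f a).flatMap (g a) :=
  Primrec.list_flatMap hf hg

@[fun_prop]
theorem primrec_filterMap {f : α → List β} {g : α → β → Option γ} (hf : Primrec f)
    (hg : Primrec fun p : α × β => g p.1 p.2) : Primrec fun a => (f a).filterMap (g a) :=
  Primrec.listFilterMap hf hg

@[fun_prop]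
theorem primrec_foldr {f : α → List β} {g : α → γ} {h : α → β → γ → γ} (hf : Primrec f)
    (hg : Primrec g) (hh : Primrec fun p : α × β × γ => h p.1 p.2.1 p.2.2) :
    Primrec fun a => (f a).foldr (h a) (g a) :=
  Primrec.list_foldr (h := fun a p => h a p.1 p.2) hf hg hh

@[fun_prop]
theorem primrec_all {f : α → List β} {g : α → β → Bool} (hf : Primrec f)
    (hg : Primrec fun p : α × β => g p.1 p.2) : Primrec fun a => (f a).all (g a) :=
  (show Primrec fun a => (f a).foldr (fun b c => g a b && c) true by fun_prop).of_eq fun a => by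
    induction f a with
    | nil => rfl
    | cons b l ih => rw [List.foldr_cons, ih, List.all_cons]

@[fun_prop]
theorem primrec_any {f : α → List β} {g : α → β → Bool} (hf : Primrec f)
    (hg : Primrec fun p : α × β => g p.1 p.2) : Primrec fun a => (f a).any (g a) :=
  (show Primrec fun a => (f a).foldr (fun b c => g a b || c) false by fun_prop).of_eq fun a => by
    induction f a with
    | nil => rfl
    | cons b l ih => rw [List.foldr_cons, ih, List.any_cons]

@[fun_prop]
theorem primrec_filter {f : α → List β} {g : α → β → Bool} (hf : Primrec f)
    (hg : Primrec fun p : α × β => g p.1 p.2) : Primrec fun a => (f a).filter (g a) :=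
  (show Primrec fun a => (f a).foldr (fun b c => bif g a b then b :: c else c) [] by
    fun_prop).of_eq fun a => by
    induction f a with
    | nil => rfl
    | cons b l ih => rw [List.foldr_cons, ih, List.filter_cons, Bool.cond_eq_ite]

@[fun_prop]
theorem primrec_contains [BEq β] [LawfulBEq β] {f : α → List β} {g : α → β} (hf : Primrec f)
    (hg : Primrec g) : Primrec fun a => (f a).contains (g a) := by
  classical
  refine (primrec_any (g := fun a b => decide (g a = b)) hf
    (Primrec.eq.comp (hg.comp Primrec.fst) Primrec.snd).decide).of_eq fun a => ?_
  rw [Bool.eq_iff_iff, List.contains_iff_mem]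
  simp

@[fun_prop]
theorem primrec_sublists' {f : α → List β} (hf : Primrec f) : Primrec fun a => (f a).sublists' :=
  (show Primrec fun a => (f a).foldr (fun b c => c ++ c.map fun l => b :: l) [[]] by
    fun_prop).of_eq fun a => by
    induction f a with
    | nil => rfl
    | cons b l ih => rw [List.foldr_cons, ih, List.sublists'_cons]

end

/-- Course of values recursion along smaller numbers. -/
theorem primrec_of_children {σ : Type} [Primcodable σ] {F : ℕ → σ} {G : ℕ × List σ → σ}
    {c : ℕ → List ℕ} (hG : Primrec G) (hc : Primrec c) (hlt : ∀ n, ∀ k ∈ c n, k < n)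
    (h : ∀ n, F n = G (n, (c n).map F)) : Primrec F := by
  have key : Primrec₂ fun (_ : Unit) n => F n := by
    -- The list `L` holds the values at all smaller numbers, so its length is the current argument.
    -- The default `F 0` is never reached, as children are smaller.
    refine Primrec.nat_strong_rec _ (g := fun _ L => some (G (L.length,
      (c L.length).map fun k => L.getD k (F 0)))) ?_ fun _ n => ?_
    · change Primrec fun p : Unit × List σ => some (G (p.2.length,
        (c p.2.length).map fun k => p.2.getD k (F 0)))
      fun_prop
    · rw [List.length_map, List.length_range, h n]
      refine congrArg (fun l => some (G (n, l))) (List.map_congr_left fun k hk => ?_)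
      rw [List.getD_eq_getElem?_getD]
      simp [hlt n k hk]
  exact key.comp (Primrec.const ()) Primrec.id

end FOTL

namespace FOTL

/-! ### Coding of temporal formulae -/

/-- The codes of the main subformulae of the formula with a given code. -/
def childCodes (n : ℕ) : List ℕ :=
  bif n.unpair.1 == 3 || n.unpair.1 == 10 || n.unpair.1 == 11 || n.unpair.1 == 12 then [n.unpair.2]
  else bif n.unpair.1 == 4 || n.unpair.1 == 5 || n.unpair.1 == 6 || n.unpair.1 == 7 ||
    n.unpair.1 == 13 || n.unpair.1 == 14 then [n.unpair.2.unpair.1, n.unpair.2.unpair.2]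
  else bif n.unpair.1 == 8 || n.unpair.1 == 9 then [n.unpair.2.unpair.2] else []

/-- The codes of the terms of the atom with a given code. -/
def termCodes (n : ℕ) : List ℕ := Denumerable.ofNat (List ℕ) n.unpair.2.unpair.2

/-- The code of a formula is correct at its main connective. -/
def checkCode (n : ℕ) : Bool :=
  Nat.ble n.unpair.1 14 && (!Nat.ble n.unpair.1 1 || n.unpair.2 == 0) &&
    (!(n.unpair.1 == 2) || (termCodes n).all fun k => Nat.ble k.unpair.1 1)

@[fun_prop]
theorem primrec_childCodes : Primrec childCodes := by
  unfold childCodes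
  fun_prop

@[fun_prop]
theorem primrec_termCodes : Primrec termCodes :=
  (Primrec.ofNat (List ℕ)).comp (show Primrec fun n : ℕ => n.unpair.2.unpair.2 by fun_prop)

@[fun_prop]
theorem primrec_checkCode : Primrec checkCode := by
  unfold checkCode
  fun_prop

theorem lt_of_mem_childCodes (n : ℕ) : ∀ k ∈ childCodes n, k < n := by
  intro k hk
  have h₁ : n.unpair.1 + n.unpair.2 ≤ n := by
    simpa using Nat.add_le_pair n.unpair.1 n.unpair.2
  have h₂ := Nat.unpair_left_le n.unpair.2
  have h₃ := Nat.unpair_right_le n.unpair.2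
  -- Every code with children has a positive tag, which makes the payload, and so each child,
  -- strictly smaller than the code.
  have h : 1 ≤ n.unpair.1 ∧ k ≤ n.unpair.2 := by
    unfold childCodes at hk
    generalize n.unpair.1 = t at hk
    simp only [Bool.cond_eq_ite] at hk
    split_ifs at hk with h h' h'' <;> simp at hk <;> simp at * <;> omega
  omega

theorem exists_term_code {k : ℕ} (h : k.unpair.1 ≤ 1) : ∃ t : Term, t.code = k := by
  rcases Nat.le_one_iff_eq_zero_or_eq_one.1 h with h | h
  · exact ⟨.var k.unpair.2, by rw [Term.code, ← h, Nat.pair_unpair]⟩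
  · exact ⟨.const k.unpair.2, by rw [Term.code, ← h, Nat.pair_unpair]⟩

theorem exists_terms_code {l : List ℕ} (h : ∀ k ∈ l, k.unpair.1 ≤ 1) :
    ∃ ts : List Term, ts.map Term.code = l := by
  induction l with
  | nil => exact ⟨[], rfl⟩
  | cons k l ih =>
    obtain ⟨ts, rfl⟩ := ih fun k hk => h k (List.mem_cons_of_mem _ hk)
    obtain ⟨t, rfl⟩ := exists_term_code (h k List.mem_cons_self)
    exact ⟨t :: ts, rfl⟩

theorem TFormula.childCodes_code (φ : TFormula) :
    checkCode φ.code = true ∧ ∀ k ∈ childCodes φ.code, ∃ ψ : TFormula, ψ.code = k := by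
  cases φ with
  | atom p ts =>
    refine ⟨?_, by simp [TFormula.code, childCodes]⟩
    have : ∀ t ∈ ts, t.code.unpair.1 ≤ 1 := fun t _ => by cases t <;> simp [Term.code]
    simpa [checkCode, termCodes, TFormula.code, Nat.ble] using this
  | _ => simp [TFormula.code, childCodes, checkCode, Nat.ble]

/-- Being a code is a local condition at the main connective together with the same condition for
the children, which is what course of values recursion needs. -/
theorem exists_code_iff (n : ℕ) : (∃ φ : TFormula, φ.code = n) ↔
    checkCode n = true ∧ ∀ k ∈ childCodes n, ∃ φ : TFormula, φ.code = k := by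
  constructor
  · rintro ⟨φ, rfl⟩
    exact φ.childCodes_code
  · rintro ⟨h, hc⟩
    obtain ⟨t, m, rfl⟩ : ∃ t m, Nat.pair t m = n := ⟨_, _, Nat.pair_unpair n⟩
    have ht : t ≤ 14 := by
      simp only [checkCode, Bool.and_eq_true, Nat.ble_eq, Nat.unpair_pair] at h
      exact h.1.1
    have hu : childCodes (Nat.pair t m) = [m] → ∃ φ : TFormula, φ.code = m := fun h =>
      hc _ (by rw [h]; exact List.mem_cons_self)
    have hb : childCodes (Nat.pair t m) = [m.unpair.1, m.unpair.2] →
        ∃ φ ψ : TFormula, Nat.pair φ.code ψ.code = m := fun h => by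
      rw [h] at hc
      obtain ⟨φ, hφ⟩ := hc m.unpair.1 (by simp)
      obtain ⟨ψ, hψ⟩ := hc m.unpair.2 (by simp)
      exact ⟨φ, ψ, by rw [hφ, hψ, Nat.pair_unpair]⟩
    have hq : childCodes (Nat.pair t m) = [m.unpair.2] →
        ∃ x, ∃ φ : TFormula, Nat.pair x φ.code = m := fun h => by
      rw [h] at hc
      obtain ⟨φ, hφ⟩ := hc m.unpair.2 (by simp)
      exact ⟨m.unpair.1, φ, by rw [hφ, Nat.pair_unpair]⟩
    interval_cases t
    · have : m = 0 := by simpa [checkCode] using h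
      exact ⟨.verum, by rw [this]; rfl⟩
    · have : m = 0 := by simpa [checkCode] using h
      exact ⟨.falsum, by rw [this]; rfl⟩
    · have h' : ∀ k ∈ termCodes (Nat.pair 2 m), k.unpair.1 ≤ 1 := by
        simpa [checkCode, Nat.ble] using h
      obtain ⟨ts, hts⟩ := exists_terms_code h'
      refine ⟨.atom m.unpair.1 ts, ?_⟩
      rw [TFormula.code, hts, termCodes, Nat.unpair_pair]
      rw [Denumerable.encode_ofNat, Nat.pair_unpair]
    · obtain ⟨φ, rfl⟩ := hu (by simp [childCodes])
      exact ⟨.neg φ, rfl⟩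
    · obtain ⟨φ, ψ, rfl⟩ := hb (by simp [childCodes])
      exact ⟨.and φ ψ, rfl⟩
    · obtain ⟨φ, ψ, rfl⟩ := hb (by simp [childCodes])
      exact ⟨.or φ ψ, rfl⟩
    · obtain ⟨φ, ψ, rfl⟩ := hb (by simp [childCodes])
      exact ⟨.imp φ ψ, rfl⟩
    · obtain ⟨φ, ψ, rfl⟩ := hb (by simp [childCodes])
      exact ⟨.iff φ ψ, rfl⟩
    · obtain ⟨x, φ, rfl⟩ := hq (by simp [childCodes])
      exact ⟨.all x φ, rfl⟩
    · obtain ⟨x, φ, rfl⟩ := hq (by simp [childCodes])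
      exact ⟨.ex x φ, rfl⟩
    · obtain ⟨φ, rfl⟩ := hu (by simp [childCodes])
      exact ⟨.next φ, rfl⟩
    · obtain ⟨φ, rfl⟩ := hu (by simp [childCodes])
      exact ⟨.always φ, rfl⟩
    · obtain ⟨φ, rfl⟩ := hu (by simp [childCodes])
      exact ⟨.sometime φ, rfl⟩
    · obtain ⟨φ, ψ, rfl⟩ := hb (by simp [childCodes])
      exact ⟨.until φ ψ, rfl⟩
    · obtain ⟨φ, ψ, rfl⟩ := hb (by simp [childCodes])
      exact ⟨.wuntil φ ψ, rfl⟩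

open Classical in
theorem primrec_exists_code : Primrec fun n => decide (∃ φ : TFormula, φ.code = n) := by
  refine primrec_of_children (G := fun p : ℕ × List Bool => checkCode p.1 && p.2.all fun b => b)
    (by fun_prop) primrec_childCodes lt_of_mem_childCodes fun n => ?_
  rw [Bool.eq_iff_iff, decide_eq_true_eq, exists_code_iff]
  simp

open Classical in
-- The encoding is `TFormula.code` itself, so that computability on formulae means computability on
-- the codes in `IsDecidableClass`.
noncomputable instance : Encodable TFormula where
  encode := TFormula.code
  decode n := if h : ∃ φ : TFormula, φ.code = n then some h.choose else none
  encodek φ := by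
    have h : ∃ ψ : TFormula, ψ.code = φ.code := ⟨φ, rfl⟩
    rw [dif_pos h, TFormula.code_injective h.choose_spec]

theorem decode_eq_some_iff {n : ℕ} {φ : TFormula} :
    (Encodable.decode n : Option TFormula) = some φ ↔ φ.code = n := by
  constructor
  · classical
    intro h
    change dite _ _ _ = _ at h
    split_ifs at h with h'
    · rw [← Option.some_inj.1 h]; exact h'.choose_spec
  · rintro rfl
    exact Encodable.encodek φ

noncomputable instance : Primcodable TFormula where
  prim := by
    classical
    -- Decoding and encoding again sends a code `n` to `n + 1`, the code of `some`, and everything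
    -- else to `0`, the code of `none`.
    refine Primrec.nat_iff.1 ((primrec_cond primrec_exists_code Primrec.succ (.const 0)).of_eq
      fun n => ?_)
    by_cases h : ∃ φ : TFormula, φ.code = n
    · obtain ⟨φ, rfl⟩ := h
      rw [decode_eq_some_iff.2 rfl, decide_eq_true ⟨φ, rfl⟩]
      rfl
    · have : (Encodable.decode n : Option TFormula) = none :=
        Option.eq_none_iff_forall_ne_some.2 fun φ hφ => h ⟨φ, decode_eq_some_iff.1 hφ⟩
      rw [this, decide_eq_false h]
      rfl

/-- The main subformulae of a formula. -/
def TFormula.children : TFormula → List TFormula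
  | .verum | .falsum | .atom _ _ => []
  | .neg φ | .all _ φ | .ex _ φ | .next φ | .always φ | .sometime φ => [φ]
  | .and φ ψ | .or φ ψ | .imp φ ψ | .iff φ ψ | .until φ ψ | .wuntil φ ψ => [φ, ψ]

theorem TFormula.map_code_children (φ : TFormula) :
    φ.children.map TFormula.code = childCodes φ.code := by
  cases φ <;> simp [TFormula.children, TFormula.code, childCodes]

@[fun_prop]
theorem primrec_code : Primrec TFormula.code := Primrec.encode

@[fun_prop]
theorem primrec_children : Primrec TFormula.children := by
  refine (show Primrec fun φ : TFormula =>
    (childCodes φ.code).filterMap fun n => (Encodable.decode n : Option TFormula) by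
      fun_prop).of_eq fun φ => ?_
  rw [← TFormula.map_code_children, List.filterMap_map]
  conv_rhs => rw [← List.filterMap_some (l := φ.children)]
  exact List.filterMap_congr fun ψ _ => Encodable.encodek ψ

/-- Structural recursion. -/
theorem primrec_of_step {σ : Type} [Primcodable σ] {f : TFormula → σ}
    (step : TFormula × List σ → σ) (hstep : Primrec step)
    (h : ∀ φ, f φ = step (φ, φ.children.map f)) : Primrec f := by
  -- The value `f .verum` at numbers that are not codes is arbitrary.
  let F : ℕ → σ := fun n => ((Encodable.decode n : Option TFormula).map f).getD (f .verum)
  have hF : Primrec F := by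
    refine primrec_of_children (G := fun p : ℕ × List σ =>
      ((Encodable.decode p.1 : Option TFormula).map fun φ => step (φ, p.2)).getD (f .verum))
      (by fun_prop) primrec_childCodes lt_of_mem_childCodes fun n => ?_
    by_cases hn : ∃ φ : TFormula, φ.code = n
    · obtain ⟨φ, rfl⟩ := hn
      simp only [F, decode_eq_some_iff.2 rfl, Option.map_some, Option.getD_some]
      rw [h, ← TFormula.map_code_children, List.map_map]
      congr 2
      refine List.map_congr_left fun ψ _ => ?_
      simp [decode_eq_some_iff.2 (rfl : ψ.code = ψ.code)]
    · have : (Encodable.decode n : Option TFormula) = none :=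
        Option.eq_none_iff_forall_ne_some.2 fun φ hφ => hn ⟨φ, decode_eq_some_iff.1 hφ⟩
      simp [F, this]
  refine (hF.comp primrec_code).of_eq fun φ => ?_
  simp [F, decode_eq_some_iff.2 (rfl : φ.code = φ.code)]

end FOTL

/-! ### Syntactic operations are primitive recursive -/

namespace FOTL

/-- The number of the main connective. -/
def TFormula.tag (φ : TFormula) : ℕ := φ.code.unpair.1

/-- The code of the arguments of the main connective. -/
def TFormula.payload (φ : TFormula) : ℕ := φ.code.unpair.2

@[fun_prop]
theorem primrec_tag : Primrec TFormula.tag := by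
  unfold TFormula.tag
  fun_prop

@[fun_prop]
theorem primrec_payload : Primrec TFormula.payload := by
  unfold TFormula.payload
  fun_prop

theorem termCodes_atom (p : ℕ) (ts : List Term) :
    termCodes (TFormula.atom p ts).code = ts.map Term.code := by
  simp [termCodes, TFormula.code]

/-- The free variables of a formula. -/
def TFormula.fvList : TFormula → List ℕ
  | .verum | .falsum => []
  | .atom _ ts => (ts.map Term.code).filterMap fun k =>
      bif k.unpair.1 == 0 then some k.unpair.2 else none
  | .neg φ | .next φ | .always φ | .sometime φ => φ.fvList
  | .and φ ψ | .or φ ψ | .imp φ ψ | .iff φ ψ | .until φ ψ | .wuntil φ ψ => φ.fvList ++ ψ.fvList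
  | .all x φ | .ex x φ => φ.fvList.filter fun y => !(y == x)

theorem TFormula.mem_fvList {φ : TFormula} {y : ℕ} : y ∈ φ.fvList ↔ y ∈ φ.fv := by
  induction φ with
  | verum | falsum => simp [TFormula.fvList, TFormula.fv]
  | atom p ts =>
    rw [TFormula.fv, mem_foldr_union, TFormula.fvList, List.filterMap_map, List.mem_filterMap]
    refine exists_congr fun t => and_congr_right fun _ => ?_
    cases t <;> simp [Term.code, Term.fv, eq_comm]
  | neg φ ih | next φ ih | always φ ih | sometime φ ih => exact ih
  | and φ ψ ih₁ ih₂ | or φ ψ ih₁ ih₂ | imp φ ψ ih₁ ih₂ | iff φ ψ ih₁ ih₂ | wuntil φ ψ ih₁ ih₂ =>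
    simp only [TFormula.fvList, TFormula.fv, List.mem_append, Finset.mem_union, ih₁, ih₂]
  | all x φ ih | ex x φ ih =>
    simp only [TFormula.fvList, TFormula.fv, List.mem_filter, Finset.mem_erase, ih, and_comm,
      Bool.not_eq_true', beq_eq_false_iff_ne]
  | _ φ ψ ih₁ ih₂ =>
    simp only [TFormula.fvList, TFormula.fv, List.mem_append, Finset.mem_union, ih₁, ih₂]

theorem TFormula.toFinset_fvList (φ : TFormula) : φ.fvList.toFinset = φ.fv := by
  ext y
  rw [List.mem_toFinset, TFormula.mem_fvList]

theorem TFormula.isEmpty_fvList (φ : TFormula) : φ.fvList.isEmpty = true ↔ φ.fv = ∅ := by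
  rw [← TFormula.toFinset_fvList, List.toFinset_eq_empty_iff, List.isEmpty_iff]

theorem TFormula.card_fv_le_one_iff (φ : TFormula) :
    (φ.fvList.all fun x => φ.fvList.all fun y => x == y) = true ↔ φ.fv.card ≤ 1 := by
  simp only [List.all_eq_true, TFormula.mem_fvList, beq_iff_eq, Finset.card_le_one]

theorem TFormula.fvar_eq_foldr (φ : TFormula) :
    φ.fvList.foldr (fun x y => max x y) 0 = φ.fvar := by
  rw [TFormula.fvar, ← TFormula.toFinset_fvList]
  exact List.foldr_sup_eq_sup_toFinset φ.fvList

@[fun_prop]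
-- The tags are those of `TFormula.code`: `2` for atoms, `3` for negation, `8` and `9` for
-- quantifiers, from `10` on for temporal operators.
theorem primrec_fvList : Primrec TFormula.fvList := by
  refine primrec_of_step (fun p => bif p.1.tag == 2 then (termCodes p.1.code).filterMap fun k =>
      bif k.unpair.1 == 0 then some k.unpair.2 else none
    else bif p.1.tag == 8 || p.1.tag == 9 then
      p.2.flatten.filter fun y => !(y == p.1.payload.unpair.1)
    else p.2.flatten) (by fun_prop) fun φ => ?_
  cases φ with
  | atom p ts => rw [termCodes_atom]; simp [TFormula.tag, TFormula.fvList, TFormula.code]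
  | _ => simp [TFormula.tag, TFormula.payload, TFormula.code, TFormula.children, TFormula.fvList]

@[fun_prop]
theorem primrec_fvar : Primrec TFormula.fvar :=
  (show Primrec fun φ : TFormula => φ.fvList.foldr (fun x y => max x y) 0 by fun_prop).of_eq
    TFormula.fvar_eq_foldr

open Classical in
/-- The characteristic function of the monodic formulae. -/
noncomputable def TFormula.monodicB (φ : TFormula) : Bool := φ.Monodic

open Classical in
/-- The characteristic function of the formulae in negation normal form. -/
noncomputable def TFormula.nnfB (φ : TFormula) : Bool := φ.NNF

theorem TFormula.monodicB_iff {φ : TFormula} : φ.monodicB = true ↔ φ.Monodic := by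
  classical exact decide_eq_true_iff

theorem TFormula.nnfB_iff {φ : TFormula} : φ.nnfB = true ↔ φ.NNF := by
  classical exact decide_eq_true_iff

@[fun_prop]
theorem primrec_monodicB : Primrec TFormula.monodicB := by
  refine primrec_of_step (fun p => (!Nat.ble 10 p.1.tag ||
    p.1.fvList.all fun x => p.1.fvList.all fun y => x == y) && p.2.all fun b => b)
    (by fun_prop) fun φ => ?_
  rw [Bool.eq_iff_iff, Bool.and_eq_true, Bool.or_eq_true, TFormula.card_fv_le_one_iff]
  cases φ <;> simp [TFormula.tag, TFormula.code, TFormula.children, TFormula.monodicB_iff,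
    TFormula.Monodic, TFormula.fv, Nat.ble]

@[fun_prop]
theorem primrec_nnfB : Primrec TFormula.nnfB := by
  refine primrec_of_step (fun p => bif p.1.tag == 3 then p.1.children.all fun ψ => ψ.tag == 2
    else !(p.1.tag == 6 || p.1.tag == 7) && p.2.all fun b => b) (by fun_prop) fun φ => ?_
  rw [Bool.eq_iff_iff]
  cases φ with
  | neg φ =>
    cases φ <;> simp [TFormula.tag, TFormula.code, TFormula.children, TFormula.nnfB_iff,
      TFormula.NNF]
  | _ => simp [TFormula.tag, TFormula.code, TFormula.children, TFormula.nnfB_iff,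
      TFormula.NNF]

@[fun_prop]
theorem primrec_temporalSubs : Primrec TFormula.temporalSubs := by
  refine primrec_of_step (fun p => bif Nat.ble 10 p.1.tag then p.1 :: p.2.flatten
    else p.2.flatten) (by fun_prop) fun φ => ?_
  cases φ <;> simp [TFormula.tag, TFormula.code, TFormula.children, TFormula.temporalSubs, Nat.ble]

@[fun_prop]
theorem primrec_temporalArgs : Primrec TFormula.temporalArgs := by
  refine (show Primrec fun φ : TFormula => bif Nat.ble 10 φ.tag then φ.children else [] by
    fun_prop).of_eq fun φ => ?_
  cases φ <;> simp [TFormula.tag, TFormula.code, TFormula.children, TFormula.temporalArgs, Nat.ble]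

@[fun_prop]
theorem primrec_args : Primrec TFormula.args := by
  unfold TFormula.args
  fun_prop

@[fun_prop]
theorem primrec_constList : Primrec TFormula.constList := by
  refine primrec_of_step (fun p => bif p.1.tag == 2 then (termCodes p.1.code).filterMap fun k =>
      bif k.unpair.1 == 1 then some k.unpair.2 else none
    else p.2.flatten) (by fun_prop) fun φ => ?_
  cases φ with
  | atom p ts =>
    rw [termCodes_atom, TFormula.constList, List.filterMap_map]
    simp only [TFormula.tag, TFormula.code, Nat.unpair_pair, beq_self_eq_true, cond_true]
    refine List.filterMap_congr fun t _ => ?_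
    cases t <;> simp [Term.code, Term.const?]
  | _ => simp [TFormula.tag, TFormula.code, TFormula.children, TFormula.constList]

/-- The code of the first-order formula obtained by introducing surrogates. -/
def TFormula.barCode (φ : TFormula) : ℕ := φ.bar.code

/-- The code of the renaming. -/
def TFormula.renamingCode (φ : TFormula) : ℕ := φ.renaming.code

/-- The code of the surrogate at a term with code `v`. -/
def TFormula.surrCode (φ : TFormula) (v : ℕ) : ℕ :=
  Nat.pair 2 (Nat.pair (Nat.pair 1 φ.code)
    (Encodable.encode (bif φ.fvList.isEmpty then [] else [v])))

/-- The code of the name at a term with code `v`. -/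
def TFormula.nameCode (φ : TFormula) (v : ℕ) : ℕ :=
  Nat.pair 2 (Nat.pair (Nat.pair 2 φ.code) (Encodable.encode [v]))

theorem TFormula.surrCode_eq (φ : TFormula) (u : Term) : φ.surrCode u.code = (φ.surrAt u).code := by
  rw [TFormula.surrCode, TFormula.surrAt, FO.code, Sym.code]
  by_cases h : φ.fv = ∅
  · rw [(TFormula.isEmpty_fvList φ).2 h, if_pos h]; rfl
  · rw [Bool.eq_false_iff.2 (mt (TFormula.isEmpty_fvList φ).1 h), if_neg h]; rfl

theorem TFormula.nameCode_eq (φ : TFormula) (u : Term) : φ.nameCode u.code = (φ.nameAt u).code := rfl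

section
variable {α : Type} [Primcodable α] {f : α → TFormula} {g : α → ℕ}

@[fun_prop]
theorem primrec_surrCode (hf : Primrec f) (hg : Primrec g) :
    Primrec fun a => (f a).surrCode (g a) := by
  unfold TFormula.surrCode
  fun_prop

@[fun_prop]
theorem primrec_nameCode (hf : Primrec f) (hg : Primrec g) :
    Primrec fun a => (f a).nameCode (g a) := by
  unfold TFormula.nameCode
  fun_prop

end

@[fun_prop]
theorem primrec_barCode : Primrec TFormula.barCode := by
  -- `FO.code` and `TFormula.code` number the connectives and quantifiers alike, so tags are copied;
  -- only atoms, whose symbols are wrapped as `.base`, and temporal operators change.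
  refine primrec_of_step (fun p => bif Nat.ble 10 p.1.tag then
      p.1.surrCode (Nat.pair 0 p.1.fvar)
    else bif p.1.tag == 2 then
      Nat.pair 2 (Nat.pair (Nat.pair 0 p.1.payload.unpair.1) p.1.payload.unpair.2)
    else bif p.1.tag == 3 then Nat.pair 3 (p.2.getD 0 0)
    else bif p.1.tag == 8 || p.1.tag == 9 then
      Nat.pair p.1.tag (Nat.pair p.1.payload.unpair.1 (p.2.getD 0 0))
    else bif Nat.ble p.1.tag 1 then p.1.code
    else Nat.pair p.1.tag (Nat.pair (p.2.getD 0 0) (p.2.getD 1 0))) (by fun_prop) fun φ => ?_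
  have hs : ∀ χ : TFormula, χ.surrogate.code = χ.surrCode (Nat.pair 0 χ.fvar) := fun χ =>
    (TFormula.surrCode_eq χ (.var χ.fvar)).symm
  cases φ <;> simp [TFormula.tag, TFormula.payload, TFormula.code, TFormula.children,
    TFormula.barCode, TFormula.bar, FO.code, Sym.code, Nat.ble, hs]

@[fun_prop]
theorem primrec_renamingCode : Primrec TFormula.renamingCode :=
  show Primrec fun φ : TFormula => Nat.pair 8 (Nat.pair φ.fvar (Nat.pair 6
    (Nat.pair (φ.nameCode (Nat.pair 0 φ.fvar)) φ.barCode))) by fun_prop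

end FOTL

namespace FOTL

/-! ### Computability of the criterion -/

section
variable {α : Type} [Primcodable α]

@[fun_prop]
theorem primrec_stepB {f : α → List Record} {g h : α → List ℕ} (hf : Primrec f) (hg : Primrec g)
    (hh : Primrec h) : Primrec fun a => stepB (f a) (g a) (h a) := by
  unfold stepB
  fun_prop

@[fun_prop]
theorem primrec_edgeB {f : α → List Record} {g h : α → List (List ℕ)} (hf : Primrec f)
    (hg : Primrec g) (hh : Primrec h) : Primrec fun a => edgeB (f a) (g a) (h a) := by
  unfold edgeB
  fun_prop

@[fun_prop]
theorem primrec_goalB {f : α → Record} {g : α → List ℕ} (hf : Primrec f) (hg : Primrec g) :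
    Primrec fun a => goalB (f a) (g a) := by
  unfold goalB
  fun_prop

@[fun_prop]
theorem primrec_pointed {f : α → List (List (List ℕ))} (hf : Primrec f) :
    Primrec fun a => pointed (f a) := by
  unfold pointed
  fun_prop

@[fun_prop]
theorem primrec_closedB {f : α → List Record} {g : α → List (List (List ℕ))}
    {h : α → List (List (List ℕ) × List ℕ)} (hf : Primrec f) (hg : Primrec g) (hh : Primrec h) :
    Primrec fun a => closedB (f a) (g a) (h a) := by
  unfold closedB
  fun_prop

@[fun_prop]
theorem primrec_reachB {f : α → List Record} {g : α → List (List (List ℕ))}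
    {h : α → List (List ℕ) × List ℕ} {k : α → Record} (hf : Primrec f) (hg : Primrec g)
    (hh : Primrec h) (hk : Primrec k) : Primrec fun a => reachB (f a) (g a) (h a) (k a) := by
  unfold reachB
  fun_prop

@[fun_prop]
theorem primrec_goodB {f : α → List Record} {g : α → List (List (List ℕ))} (hf : Primrec f)
    (hg : Primrec g) : Primrec fun a => goodB (f a) (g a) := by
  unfold goodB
  fun_prop

@[fun_prop]
theorem primrec_decideB {f : α → List Record} {g h : α → List (List (List ℕ))} (hf : Primrec f)
    (hg : Primrec g) (hh : Primrec h) : Primrec fun a => decideB (f a) (g a) (h a) := by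
  unfold decideB
  fun_prop

end

/-- The record at a term with code `v`. -/
def TFormula.recordAt (φ : TFormula) (v : ℕ) : Record :=
  bif φ.tag == 10 then
    (true, false, φ.surrCode v, (φ.children.map fun ψ => ψ.nameCode v).getD 0 0, 0)
  else bif φ.tag == 11 then
    (false, false, φ.surrCode v, (φ.children.map fun ψ => ψ.nameCode v).getD 0 0, 0)
  else bif φ.tag == 12 then
    (false, true, φ.surrCode v, φ.surrCode v, (φ.children.map fun ψ => ψ.nameCode v).getD 0 0)
  else bif Nat.ble 13 φ.tag then
    (false, φ.tag == 13, φ.surrCode v, (φ.children.map fun ψ => ψ.nameCode v).getD 0 0,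
      (φ.children.map fun ψ => ψ.nameCode v).getD 1 0)
  else (false, false, 0, 0, 0)

theorem TFormula.recordAt_code (φ : TFormula) (u : Term) : φ.recordAt u.code = φ.record u := by
  cases φ <;> simp [TFormula.recordAt, TFormula.tag, TFormula.code, TFormula.children,
    TFormula.record, Nat.ble, TFormula.nameCode_eq, ← TFormula.surrCode_eq]

/-- The codes of the slots. -/
def TFormula.slotCodes (φ : TFormula) : List ℕ := 0 :: φ.constList.map fun c => Nat.pair 1 c

theorem TFormula.map_code_slots (φ : TFormula) : φ.slots.map Term.code = φ.slotCodes := by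
  rw [TFormula.slots, List.map_cons, List.map_map]
  rfl

@[fun_prop]
theorem primrec_slotCodes : Primrec TFormula.slotCodes := by
  unfold TFormula.slotCodes
  fun_prop

@[fun_prop]
theorem primrec_recordAt {α : Type} [Primcodable α] {f : α → TFormula} {g : α → ℕ}
    (hf : Primrec f) (hg : Primrec g) : Primrec fun a => (f a).recordAt (g a) := by
  unfold TFormula.recordAt
  fun_prop

@[fun_prop]
theorem primrec_records : Primrec TFormula.records :=
  (show Primrec fun φ : TFormula => φ.slotCodes.flatMap fun v =>
    φ.temporalSubs.map fun χ => χ.recordAt v by fun_prop).of_eq fun φ => by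
    simp only [← TFormula.map_code_slots, List.flatMap_map, TFormula.recordAt_code]
    rfl

/-- The codes of the atoms of which types consist. -/
def TFormula.atomCodes (φ : TFormula) : List ℕ := φ.slotCodes.flatMap fun v =>
  (φ.temporalSubs.map fun χ => χ.surrCode v) ++ φ.args.map fun ψ => ψ.nameCode v

theorem TFormula.map_code_atoms (φ : TFormula) : φ.atoms.map FO.code = φ.atomCodes := by
  simp only [TFormula.atomCodes, ← TFormula.map_code_slots, List.flatMap_map,
    TFormula.surrCode_eq, TFormula.nameCode_eq]
  simp only [TFormula.atoms, List.map_flatMap, List.map_append, List.map_map]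
  rfl

@[fun_prop]
theorem primrec_atomCodes : Primrec TFormula.atomCodes := by
  unfold TFormula.atomCodes
  fun_prop

@[fun_prop]
theorem primrec_categories : Primrec TFormula.categories :=
  (show Primrec fun φ : TFormula => φ.atomCodes.sublists'.sublists' by fun_prop).of_eq fun φ => by
    rw [TFormula.categories, TFormula.map_code_atoms]

/-- The code of a conjunction. -/
def conjCode (l : List ℕ) : ℕ := l.foldr (fun a b => Nat.pair 4 (Nat.pair a b)) (Nat.pair 0 0)

/-- The code of a disjunction. -/
def disjCode (l : List ℕ) : ℕ := l.foldr (fun a b => Nat.pair 5 (Nat.pair a b)) (Nat.pair 1 0)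

theorem code_conj (l : List FO) : (conj l).code = conjCode (l.map FO.code) := by
  induction l with
  | nil => rfl
  | cons φ l ih => exact congrArg (fun n => Nat.pair 4 (Nat.pair φ.code n)) ih

theorem code_disj (l : List FO) : (disj l).code = disjCode (l.map FO.code) := by
  induction l with
  | nil => rfl
  | cons φ l ih => exact congrArg (fun n => Nat.pair 5 (Nat.pair φ.code n)) ih

/-- The code of the formula that describes a type. -/
def typeCode (L t : List ℕ) : ℕ :=
  conjCode (L.map fun c => bif t.contains c then c else Nat.pair 3 c)

theorem code_typeFormula (L : List FO) (t : List ℕ) :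
    (typeFormula L t).code = typeCode (L.map FO.code) t := by
  rw [typeFormula, code_conj, typeCode, List.map_map, List.map_map]
  refine congrArg conjCode (List.map_congr_left fun x _ => ?_)
  by_cases h : x.code ∈ t <;> simp [h, FO.code]

/-- The code of the formula that describes a category. -/
def categoryCode (L : List ℕ) (Γ : List (List ℕ)) : ℕ :=
  Nat.pair 4 (Nat.pair (conjCode (Γ.map fun t => Nat.pair 9 (Nat.pair 0 (typeCode L t))))
    (Nat.pair 8 (Nat.pair 0 (disjCode (Γ.map fun t => typeCode L t)))))

theorem code_categoryFormula (L : List FO) (Γ : List (List ℕ)) :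
    (categoryFormula L Γ).code = categoryCode (L.map FO.code) Γ := by
  simp only [categoryFormula, FO.code, code_conj, code_disj, categoryCode, List.map_map,
    ← code_typeFormula]
  rfl

/-- The code of the query about a category. -/
def TFormula.queryCode (φ : TFormula) (B : List ℕ) (Γ : List (List ℕ)) : ℕ :=
  Nat.pair 4 (Nat.pair (categoryCode φ.atomCodes Γ) (conjCode (φ.args.map fun ψ =>
    bif B.contains ψ.renamingCode then ψ.renamingCode else
      bif Γ.any fun t => t.contains (ψ.nameCode 0) then ψ.barCode else Nat.pair 0 0)))

/-- The decision algorithms for the class work on codes, so the queries have to be produced as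
codes. -/
theorem TFormula.code_query (φ : TFormula) (B : List ℕ) (Γ : List (List ℕ)) :
    (φ.query B Γ).code = φ.queryCode B Γ := by
  rw [TFormula.query, FO.code, code_categoryFormula, TFormula.map_code_atoms, TFormula.queryCode,
    TFormula.namesFormula, code_conj, List.map_map]
  congr 3
  refine List.map_congr_left fun ψ _ => ?_
  have h : ψ.nameCode 0 = (ψ.nameAt (.var 0)).code := rfl
  rw [Function.comp_apply, h]
  by_cases h₁ : ψ.renaming.code ∈ B
  · simp [TFormula.renamingCode, h₁]
  · by_cases h₂ : ∃ t ∈ Γ, (ψ.nameAt (.var 0)).code ∈ t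
    · have h₃ : (Γ.any fun t => t.contains (ψ.nameAt (.var 0)).code) = true := by simpa using h₂
      rw [if_neg h₁, if_pos h₂, h₃]
      simp [TFormula.renamingCode, TFormula.barCode, h₁]
    · have h₃ : (Γ.any fun t => t.contains (ψ.nameAt (.var 0)).code) = false := by
        simpa using h₂
      rw [if_neg h₁, if_neg h₂, h₃]
      simp [TFormula.renamingCode, FO.code, h₁]

section
variable {α : Type} [Primcodable α]

@[fun_prop]
theorem primrec_conjCode {f : α → List ℕ} (hf : Primrec f) : Primrec fun a => conjCode (f a) := by
  unfold conjCode
  fun_prop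

@[fun_prop]
theorem primrec_disjCode {f : α → List ℕ} (hf : Primrec f) : Primrec fun a => disjCode (f a) := by
  unfold disjCode
  fun_prop

@[fun_prop]
theorem primrec_typeCode {f g : α → List ℕ} (hf : Primrec f) (hg : Primrec g) :
    Primrec fun a => typeCode (f a) (g a) := by
  unfold typeCode
  fun_prop

@[fun_prop]
theorem primrec_categoryCode {f : α → List ℕ} {g : α → List (List ℕ)} (hf : Primrec f)
    (hg : Primrec g) : Primrec fun a => categoryCode (f a) (g a) := by
  unfold categoryCode
  fun_prop

@[fun_prop]
theorem primrec_queryCode {f : α → TFormula} {g : α → List ℕ} {h : α → List (List ℕ)}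
    (hf : Primrec f) (hg : Primrec g) (hh : Primrec h) :
    Primrec fun a => (f a).queryCode (g a) (h a) := by
  unfold TFormula.queryCode
  fun_prop

end

end FOTL

namespace FOTL

/-! ### Decidability of the temporalisation -/

/-- The predicate comes from an arbitrary decidable class and is computable only, so the list is
filtered by recursion on the index instead of by the primitive recursive tools. -/
theorem computable_filter {p : ℕ → Bool} (hp : Computable p) :
    Computable fun l : List ℕ => l.filter p := by
  have hget : Computable fun x : List ℕ × ℕ × List ℕ => x.1.getD x.2.1 0 :=
    Primrec.to_comp (by fun_prop)
  have h : Computable fun l : List ℕ => Nat.rec (motive := fun _ => List ℕ) []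
      (fun i acc => acc ++ bif p (l.getD i 0) then [l.getD i 0] else []) l.length := by
    refine Computable.nat_rec (h := fun (l : List ℕ) (x : ℕ × List ℕ) =>
      x.2 ++ bif p (l.getD x.1 0) then [l.getD x.1 0] else []) Computable.list_length (.const [])
      (Computable.list_append.comp (Computable.snd.comp Computable.snd) ?_)
    exact Computable.cond (hp.comp hget) (Computable.list_cons.comp hget (.const [])) (.const [])
  refine h.of_eq fun l => ?_
  -- After `n` rounds the accumulator is the filtered initial segment of length `n`.
  have key : ∀ n ≤ l.length, Nat.rec (motive := fun _ => List ℕ) []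
      (fun i acc => acc ++ bif p (l.getD i 0) then [l.getD i 0] else []) n =
      (l.take n).filter p := by
    intro n
    induction n with
    | zero => simp
    | succ n ih =>
      intro hn
      have hl : n < l.length := hn
      rw [List.take_succ_eq_append_getElem hl, List.filter_append, ← ih hl.le]
      simp only [List.getD_eq_getElem?_getD, List.getElem?_eq_getElem hl, Option.getD_some]
      cases hpl : p l[n] <;> simp [hpl]
  rw [key _ le_rfl, List.take_length]

/-- The codes of the formulae on which membership in the temporalisation of a class depends. -/
def TFormula.memberCodes (φ : TFormula) : List ℕ :=
  φ.barCode :: φ.args.flatMap fun ψ => [ψ.barCode, ψ.renamingCode]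

/-- Membership in the temporalisation of a class that contains the formulae with codes in `B`. -/
noncomputable def TFormula.trenB (φ : TFormula) (B : List ℕ) : Bool :=
  φ.monodicB && (φ.nnfB && (B.contains φ.barCode && φ.args.all fun ψ =>
    (ψ.fvList.isEmpty && B.contains ψ.barCode) || B.contains ψ.renamingCode))

/-- The code of the query about an initial category. -/
def TFormula.initCode (φ : TFormula) (B : List ℕ) (Γ : List (List ℕ)) : ℕ :=
  Nat.pair 4 (Nat.pair (φ.queryCode B Γ) φ.barCode)

/-- The codes of the formulae on which satisfiability depends. -/
def TFormula.satCodes (φ : TFormula) (B : List ℕ) : List ℕ :=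
  φ.categories.flatMap fun Γ => [φ.queryCode B Γ, φ.initCode B Γ]

/-- Satisfiability, if the satisfiable queries are those with codes in `S`. -/
def TFormula.satB (φ : TFormula) (B S : List ℕ) : Bool :=
  decideB φ.records (φ.categories.filter fun Γ => S.contains (φ.queryCode B Γ))
    (φ.categories.filter fun Γ => S.contains (φ.initCode B Γ))

@[fun_prop]
theorem primrec_memberCodes : Primrec TFormula.memberCodes := by
  unfold TFormula.memberCodes
  fun_prop

section
variable {α : Type} [Primcodable α] {f : α → TFormula} {g h : α → List ℕ}

@[fun_prop]
theorem primrec_trenB (hf : Primrec f) (hg : Primrec g) : Primrec fun a => (f a).trenB (g a) := by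
  unfold TFormula.trenB
  fun_prop

@[fun_prop]
theorem primrec_initCode {k : α → List (List ℕ)} (hf : Primrec f) (hg : Primrec g)
    (hk : Primrec k) : Primrec fun a => (f a).initCode (g a) (k a) := by
  unfold TFormula.initCode
  fun_prop

@[fun_prop]
theorem primrec_satCodes (hf : Primrec f) (hg : Primrec g) :
    Primrec fun a => (f a).satCodes (g a) := by
  unfold TFormula.satCodes
  fun_prop

@[fun_prop]
theorem primrec_satB (hf : Primrec f) (hg : Primrec g) (hh : Primrec h) :
    Primrec fun a => (f a).satB (g a) (h a) := by
  unfold TFormula.satB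
  fun_prop

end

/-! ### The queries belong to the class; the decision procedure -/

section
variable {C : Set FO}

theorem TFormula.trenB_iff {φ : TFormula} {B : List ℕ}
    (hB : ∀ x : FO, x.code ∈ φ.memberCodes → (x.code ∈ B ↔ x ∈ C)) :
    φ.trenB B = true ↔ φ ∈ Tren C := by
  have hbar : φ.barCode ∈ B ↔ φ.bar ∈ C := hB φ.bar List.mem_cons_self
  simp only [TFormula.trenB, Bool.and_eq_true, TFormula.monodicB_iff, TFormula.nnfB_iff,
    List.contains_iff_mem, hbar]
  refine and_congr_right fun hm => and_congr_right fun _ => and_congr_right fun _ => ?_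
  simp only [List.all_eq_true, TFormula.args, List.mem_flatMap, forall_exists_index, and_imp]
  rw [forall_comm]
  refine forall_congr' fun χ => ?_
  rw [forall_comm]
  refine forall_congr' fun hχ => forall₂_congr fun ψ hψ => ?_
  have hψ' := TFormula.mem_args hχ hψ
  have h₁ : ψ.barCode ∈ B ↔ ψ.bar ∈ C := hB ψ.bar
    (List.mem_cons_of_mem _ (List.mem_flatMap.2 ⟨ψ, hψ', List.mem_cons_self⟩))
  have h₂ : ψ.renamingCode ∈ B ↔ ψ.renaming ∈ C := hB ψ.renaming
    (List.mem_cons_of_mem _ (List.mem_flatMap.2 ⟨ψ, hψ', List.mem_cons_of_mem _ List.mem_cons_self⟩))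
  rw [Bool.or_eq_true, Bool.and_eq_true, TFormula.isEmpty_fvList, List.contains_iff_mem,
    List.contains_iff_mem, h₁, h₂, FO.Closed, TFormula.fv_bar _ (TFormula.args_props hm hψ').1]

theorem conj_mem (hconj : ∀ φ ∈ C, ∀ ψ ∈ C, FO.and φ ψ ∈ C)
    (hmonadic : ∀ φ : FO, φ.Monadic → φ.Closed → φ ∈ C) {l : List FO} (h : ∀ φ ∈ l, φ ∈ C) :
    conj l ∈ C := by
  induction l with
  | nil => exact hmonadic _ trivial rfl
  | cons φ l ih =>
    exact hconj _ (h _ List.mem_cons_self) _ (ih fun ψ hψ => h _ (List.mem_cons_of_mem _ hψ))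

theorem monadic_conj {l : List FO} (h : ∀ φ ∈ l, φ.Monadic) : (conj l).Monadic := by
  induction l with
  | nil => trivial
  | cons φ l ih => exact ⟨h _ List.mem_cons_self, ih fun ψ hψ => h _ (List.mem_cons_of_mem _ hψ)⟩

theorem monadic_disj {l : List FO} (h : ∀ φ ∈ l, φ.Monadic) : (disj l).Monadic := by
  induction l with
  | nil => trivial
  | cons φ l ih => exact ⟨h _ List.mem_cons_self, ih fun ψ hψ => h _ (List.mem_cons_of_mem _ hψ)⟩

theorem fv_conj_subset {l : List FO} {s : Finset ℕ} (h : ∀ φ ∈ l, φ.fv ⊆ s) : (conj l).fv ⊆ s := by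
  induction l with
  | nil => exact Finset.empty_subset _
  | cons φ l ih =>
    exact Finset.union_subset (h _ List.mem_cons_self) (ih fun ψ hψ => h _ (List.mem_cons_of_mem _ hψ))

theorem fv_disj_subset {l : List FO} {s : Finset ℕ} (h : ∀ φ ∈ l, φ.fv ⊆ s) : (disj l).fv ⊆ s := by
  induction l with
  | nil => exact Finset.empty_subset _
  | cons φ l ih =>
    exact Finset.union_subset (h _ List.mem_cons_self) (ih fun ψ hψ => h _ (List.mem_cons_of_mem _ hψ))

theorem TFormula.atoms_monadic {φ : TFormula} {x : FO} (hx : x ∈ φ.atoms) :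
    x.Monadic ∧ x.fv ⊆ {0} := by
  obtain ⟨u, hu, h⟩ := TFormula.atoms_cases hx
  have hv : u.fv ⊆ {0} := by
    rcases TFormula.slots_cases hu with rfl | ⟨c, -, rfl⟩ <;> simp [Term.fv]
  rcases h with ⟨χ, -, rfl⟩ | ⟨ψ, -, rfl⟩
  · unfold TFormula.surrAt
    split_ifs <;> simp [FO.Monadic, FO.fv, hv]
  · simp [TFormula.nameAt, FO.Monadic, FO.fv, hv]

theorem TFormula.typeFormula_monadic (φ : TFormula) (t : List ℕ) :
    (typeFormula φ.atoms t).Monadic ∧ (typeFormula φ.atoms t).fv ⊆ {0} := by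
  refine ⟨monadic_conj fun x hx => ?_, fv_conj_subset fun x hx => ?_⟩ <;>
    obtain ⟨y, hy, rfl⟩ := List.mem_map.1 hx <;> split_ifs
  exacts [(TFormula.atoms_monadic hy).1, (TFormula.atoms_monadic hy).1,
    (TFormula.atoms_monadic hy).2, (TFormula.atoms_monadic hy).2]

theorem TFormula.categoryFormula_monadic (φ : TFormula) (Γ : List (List ℕ)) :
    (categoryFormula φ.atoms Γ).Monadic ∧ (categoryFormula φ.atoms Γ).Closed := by
  have hfv : ∀ x : FO, x.fv ⊆ {0} → x.fv.erase 0 = ∅ := fun x hx => by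
    rw [← Finset.subset_empty]
    exact (Finset.erase_subset_erase 0 hx).trans (by simp)
  refine ⟨⟨monadic_conj fun x hx => ?_, monadic_disj fun x hx => ?_⟩, ?_⟩
  · obtain ⟨t, -, rfl⟩ := List.mem_map.1 hx
    exact (φ.typeFormula_monadic t).1
  · obtain ⟨t, -, rfl⟩ := List.mem_map.1 hx
    exact (φ.typeFormula_monadic t).1
  · refine Finset.subset_empty.1 (Finset.union_subset (fv_conj_subset fun x hx => ?_) ?_)
    · obtain ⟨t, -, rfl⟩ := List.mem_map.1 hx
      exact (hfv _ (φ.typeFormula_monadic t).2).le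
    · refine (hfv _ (fv_disj_subset fun x hx => ?_)).le
      obtain ⟨t, -, rfl⟩ := List.mem_map.1 hx
      exact (φ.typeFormula_monadic t).2

/-- The description of the category is closed and monadic. A name contributes its renaming if that
is in the class, otherwise its closed definition, which then is in the class, or `verum`. Closure
under conjunction does the rest. -/
theorem TFormula.query_mem (hconj : ∀ φ ∈ C, ∀ ψ ∈ C, FO.and φ ψ ∈ C)
    (hmonadic : ∀ φ : FO, φ.Monadic → φ.Closed → φ ∈ C) {φ : TFormula} {B : List ℕ}
    (hB : ∀ ψ ∈ φ.args, (ψ.renaming.code ∈ B → ψ.renaming ∈ C) ∧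
      (ψ.renaming.code ∉ B → ψ.bar ∈ C)) (Γ : List (List ℕ)) : φ.query B Γ ∈ C := by
  have h := φ.categoryFormula_monadic Γ
  refine hconj _ (hmonadic _ h.1 h.2) _ (conj_mem hconj hmonadic fun x hx => ?_)
  obtain ⟨ψ, hψ, rfl⟩ := List.mem_map.1 hx
  split_ifs with h₁ h₂
  · exact (hB ψ hψ).1 h₁
  · exact (hB ψ hψ).2 h₁
  · exact hmonadic _ trivial rfl

/-- Membership in the temporalisation puts every query into the class, so `S` gives the true answers
about satisfiability, and the two directions of the criterion apply. -/
theorem TFormula.satB_iff (hconj : ∀ φ ∈ C, ∀ ψ ∈ C, FO.and φ ψ ∈ C)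
    (hmonadic : ∀ φ : FO, φ.Monadic → φ.Closed → φ ∈ C) {φ : TFormula} (hφ : φ ∈ Tren C)
    {B S : List ℕ} (hB : ∀ x : FO, x.code ∈ φ.memberCodes → (x.code ∈ B ↔ x ∈ C))
    (hS : ∀ x : FO, x.code ∈ φ.satCodes B → (x.code ∈ S ↔ x ∈ C ∧ x.Satisfiable)) :
    φ.satB B S = true ↔ φ.Satisfiable := by
  obtain ⟨hm, hn, hbar, hargs⟩ := hφ
  have hren : ∀ ψ ∈ φ.args, ψ.renaming.code ∈ B ↔ ψ.renaming ∈ C := fun ψ hψ => hB ψ.renaming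
    (List.mem_cons_of_mem _ (List.mem_flatMap.2 ⟨ψ, hψ, List.mem_cons_of_mem _ List.mem_cons_self⟩))
  have hor : ∀ ψ ∈ φ.args, (ψ.bar.Closed ∧ ψ.bar ∈ C) ∨ ψ.renaming ∈ C := by
    intro ψ hψ
    obtain ⟨χ, hχ, h⟩ := List.mem_flatMap.1 hψ
    exact hargs χ hχ ψ h
  have hquery := TFormula.query_mem hconj hmonadic fun ψ hψ => ⟨(hren ψ hψ).1, fun h =>
    ((hor ψ hψ).resolve_right fun h' => h ((hren ψ hψ).2 h')).2⟩
  have hclosed : ∀ ψ ∈ φ.args, ψ.renaming.code ∉ B → ψ.bar.Closed := fun ψ hψ h =>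
    ((hor ψ hψ).resolve_right fun h' => h ((hren ψ hψ).2 h')).1
  have hA₁ : ∀ Γ, Γ ∈ (φ.categories.filter fun Γ => S.contains (φ.queryCode B Γ)) ↔
      Γ ∈ φ.categories ∧ (φ.query B Γ).Satisfiable := by
    intro Γ
    rw [List.mem_filter, List.contains_iff_mem, ← TFormula.code_query]
    refine and_congr_right fun hΓ => ?_
    rw [hS _ (List.mem_flatMap.2 ⟨Γ, hΓ, by rw [TFormula.code_query]; exact List.mem_cons_self⟩)]
    exact and_iff_right (hquery Γ)
  have hinit : ∀ Γ, (FO.and (φ.query B Γ) φ.bar).code = φ.initCode B Γ := fun Γ => by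
    rw [FO.code, TFormula.code_query]
    rfl
  have hA₂ : ∀ Γ, Γ ∈ (φ.categories.filter fun Γ => S.contains (φ.initCode B Γ)) ↔
      Γ ∈ φ.categories ∧ (FO.and (φ.query B Γ) φ.bar).Satisfiable := by
    intro Γ
    rw [List.mem_filter, List.contains_iff_mem, ← hinit]
    refine and_congr_right fun hΓ => ?_
    rw [hS _ (List.mem_flatMap.2 ⟨Γ, hΓ, by
      rw [hinit]; exact List.mem_cons_of_mem _ List.mem_cons_self⟩)]
    exact and_iff_right (hconj _ (hquery Γ) _ hbar)
  exact ⟨TFormula.satisfiable_of_decideB hm hn hclosed hA₁ hA₂,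
    TFormula.decideB_of_satisfiable hm hclosed hA₁ hA₂⟩

/-- A predicate on codes that holds of codes of formulae only is computable if it is computable on
formulae. -/
theorem computablePred_of_formula {F : TFormula → Bool} (hF : Computable F) :
    ComputablePred fun n => ∃ φ : TFormula, φ.code = n ∧ F φ = true := by
  refine ComputablePred.computable_iff.2 ⟨fun n =>
    ((Encodable.decode n : Option TFormula).map F).getD false,
    Computable.option_getD (Computable.option_map Computable.decode (hF.comp Computable.snd))
      (.const false), funext fun n => propext ?_⟩
  constructor
  · rintro ⟨φ, rfl, h⟩
    beta_reduce
    rw [decode_eq_some_iff.2 rfl]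
    exact h
  · intro h
    beta_reduce at h
    cases hd : (Encodable.decode n : Option TFormula) with
    | none => rw [hd] at h; cases h
    | some φ =>
      rw [hd] at h
      exact ⟨φ, decode_eq_some_iff.1 hd, h⟩

/-- Two rounds of questions to the given algorithms suffice. Membership of finitely many formulae
gives `B`; this determines finitely many queries, whose satisfiability gives `S`. Everything else is
primitive recursive. The answer about satisfiability is combined with the test of membership, since
it is meaningful for members only. -/
theorem isDecidableClass_tren (hdec : IsDecidableClass FO.code FO.Satisfiable C)
    (hconj : ∀ φ ∈ C, ∀ ψ ∈ C, FO.and φ ψ ∈ C)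
    (hmonadic : ∀ φ : FO, φ.Monadic → φ.Closed → φ ∈ C) :
    IsDecidableClass TFormula.code TFormula.Satisfiable (Tren C) := by
  obtain ⟨p, hp, hpC⟩ := ComputablePred.computable_iff.1 hdec.1
  obtain ⟨q, hq, hqC⟩ := ComputablePred.computable_iff.1 hdec.2
  have hp' : ∀ x : FO, p x.code = true ↔ x ∈ C := fun x => by
    rw [← congrFun hpC x.code]
    exact ⟨fun ⟨y, hy, h⟩ => FO.code_injective h ▸ hy, fun h => ⟨x, h, rfl⟩⟩
  have hq' : ∀ x : FO, q x.code = true ↔ x ∈ C ∧ x.Satisfiable := fun x => by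
    rw [← congrFun hqC x.code]
    exact ⟨fun ⟨y, hy, h, h'⟩ => FO.code_injective h ▸ ⟨hy, h'⟩, fun h => ⟨x, h.1, rfl, h.2⟩⟩
  let B : TFormula → List ℕ := fun φ => φ.memberCodes.filter p
  let S : TFormula → List ℕ := fun φ => (φ.satCodes (B φ)).filter q
  have hB : ∀ φ : TFormula, ∀ x : FO, x.code ∈ φ.memberCodes → (x.code ∈ B φ ↔ x ∈ C) :=
    fun φ x hx => by rw [List.mem_filter, hp']; exact and_iff_right hx
  have hS : ∀ φ : TFormula, ∀ x : FO, x.code ∈ φ.satCodes (B φ) →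
      (x.code ∈ S φ ↔ x ∈ C ∧ x.Satisfiable) :=
    fun φ x hx => by rw [List.mem_filter, hq']; exact and_iff_right hx
  have hBc : Computable B := (computable_filter hp).comp primrec_memberCodes.to_comp
  have hSc : Computable S := by
    have h : Primrec fun x : TFormula × List ℕ => x.1.satCodes x.2 := by fun_prop
    have h' := h.to_comp.comp (Computable.id.pair hBc)
    exact (computable_filter hq).comp h'
  have htren : Computable fun φ : TFormula => φ.trenB (B φ) := by
    have h : Primrec fun x : TFormula × List ℕ => x.1.trenB x.2 := by fun_prop
    have h' := h.to_comp.comp (Computable.id.pair hBc)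
    exact h'
  have hsat : Computable fun φ : TFormula => φ.trenB (B φ) && φ.satB (B φ) (S φ) := by
    have h : Primrec fun x : TFormula × List ℕ × List ℕ => x.1.trenB x.2.1 && x.1.satB x.2.1 x.2.2 := by
      fun_prop
    have h' := h.to_comp.comp (Computable.id.pair (hBc.pair hSc))
    exact h'
  refine ⟨(computablePred_of_formula htren).of_eq fun n => exists_congr fun φ => ?_,
    (computablePred_of_formula hsat).of_eq fun n => exists_congr fun φ => ?_⟩
  · rw [TFormula.trenB_iff (hB φ), and_comm]
  · rw [Bool.and_eq_true, TFormula.trenB_iff (hB φ), and_left_comm]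
    refine and_congr_right fun hφ => and_congr_right fun _ => ?_
    exact TFormula.satB_iff hconj hmonadic hφ (hB φ) (hS φ)

end

end FOTL

theorem mainTheorem6 (C : Set FOTL.FO)
    (hdec : FOTL.IsDecidableClass FOTL.FO.code FOTL.FO.Satisfiable C)
    (hconj : ∀ φ ∈ C, ∀ ψ ∈ C, FOTL.FO.and φ ψ ∈ C)
    (hmonadic : ∀ φ : FOTL.FO, φ.Monadic → φ.Closed → φ ∈ C) :
    FOTL.IsDecidableClass FOTL.TFormula.code FOTL.TFormula.Satisfiable (FOTL.Tren C) ∧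
      ∀ φ ∈ FOTL.Tren C, (¬ φ.Satisfiable ↔ φ.dsnf.flooded.Refutable) := by
  exact ⟨FOTL.isDecidableClass_tren hdec hconj hmonadic, fun φ hφ =>
    FOTL.TFormula.not_satisfiable_iff_refutable hφ.1 hφ.2.1⟩
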